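/- **Setting.** Let $S,A_1,A_2,H\ge 1$ be integers, $\mathcal S=\{1,\dots,S\}$, $\mathcal A_i=\{1,\dots,A_i\}$, $\mathcal A=\mathcal A_1\times\mathcal A_2$, and write $\Delta(X)$ for the set of probability distributions on a finite set $X$. A two-player zero-sum robust Markov game has rewards $r_{1,h}:\mathcal S\times\mathcal A\to[0,1]$ and $r_{2,h}=-r_{1,h}$, a nominal kernel $P^0_h:\mathcal S\times\mathcal A\to\Delta(\mathcal S)$ ($1\le h\le H$), and an uncertainty level $R$; its uncertainty set $\mathcal U^R$ is the set of all kernels $P=(P_h)_h$ such that for all $(h,s,\boldsymbol a)$ there is $P'\in\Delta(\mathcal S)$ with $P_h(\cdot|s,\boldsymbol a)=(1-R)P^0_h(\cdot|s,\boldsymbol a)+RP'$. For a joint Markov policy $\pi$ put $$V^{\pi,R}_{i,h}(s)=\inf_{P\in\mathcal U^R}\mathbb E_{\pi,P}\Big[\sum_{t=h}^H r_{i,t}(s_t,\boldsymbol a_t)\,\Big|\,s_h=s\Big],\qquad V^{\star,\pi_{-i},R}_{i,h}(s)=\max_{\pi_i'}V^{\pi_i'\times\pi_{-i},R}_{i,h}(s),$$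 the maximum being over Markov policies of player $i$. A product policy $\pi=\pi_1\times\pi_2$ is an $\varepsilon$-robust Nash equilibrium if $$\mathsf{gap}_{\mathsf{NE}}(\pi)=\max_{s\in\mathcal S}\max_{i=1,2}\big\{V^{\star,\pi_{-i},R}_{i,1}(s)-V^{\pi,R}_{i,1}(s)\big\}\le\varepsilon .$$ **Algorithm.** Let $L=\min\{H,1/R\}$ (with $1/0=\infty$). Given $K\ge1$, $\delta$ and constants $c_\alpha,c_{\mathsf b}>0$, let $$\alpha_k=\frac{c_\alpha\log K}{k-1+c_\alpha\log K},\qquad \eta_k=\sqrt{\frac{\log K}{\alpha_kL}},\qquad \alpha_k^K=\alpha_k\prod_{j=k+1}^K(1-\alpha_j).$$ Start from $\widehat V_{i,H+1}=0$. For $h=H,\dots,1$ set $Q^0_{i,h}=0$ and $\pi^1_{i,h}(\cdot|s)$ uniform, and for $k=1,\dots,K$ do the following for each player $i$. Independently for all $(s,a_i)\in\mathcal S\times\mathcal A_i$ (and for both players), draw $a_j\sim\pi^k_{j,h}(\cdot|s)$ for $j\ne i$, let $\boldsymbol a$ be the resulting joint action in which player $i$ plays $a_i$, draw $s'\sim P^0_h(\cdot|s,\boldsymbol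 a)$, and set $$q^k_{i,h}(s,a_i)=r_{i,h}(s,\boldsymbol a)+(1-R)\widehat V_{i,h+1}(s')+R\min_{\tilde s}\widehat V_{i,h+1}(\tilde s),$$ $$Q^k_{i,h}=(1-\alpha_k)Q^{k-1}_{i,h}+\alpha_kq^k_{i,h},\qquad \pi^{k+1}_{i,h}(\cdot|s)\propto\exp\big(\eta_{k+1}Q^k_{i,h}(s,\cdot)\big).$$ After the $K$ rounds at step $h$, let $$\beta_{i,h}(s)=c_{\mathsf b}\sqrt{\frac{\log^3\frac{KS(A_1+A_2)}{\delta}}{KL}}\sum_{k=1}^K\alpha_k^K\Big\{\mathsf{Var}_{a\sim\pi^k_{i,h}(\cdot|s)}\big(q^k_{i,h}(s,a)\big)+L\Big\},$$ $$\widehat V_{i,h}(s)=\min\Big\{\sum_{k=1}^K\alpha_k^K\,\mathbb E_{a\sim\pi^k_{i,h}(\cdot|s)}\big[q^k_{i,h}(s,a)\big]+\beta_{i,h}(s),\;H-h+1\Big\}.$$ The output is $\widehat\pi_1\times\widehat\pi_2$ with $\widehat\pi_{i,h}=\sum_{k=1}^K\alpha_k^K\pi^k_{i,h}$; the total number of samples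 drawn is $KHS(A_1+A_2)$. **Corollary.** For every constant $c_\alpha>0$, every sufficiently large constant $c_{\mathsf b}$ (how large depends only on $c_\alpha$), there is a constant $C>0$ depending only on $c_\alpha$ and $c_{\mathsf b}$ such that the following holds. For every two-player zero-sum robust Markov game as above with $0\le R<1$, every $\varepsilon\in(0,H]$, every $\delta\in(0,1)$ and every integer $K\ge1$ with $$KHS(A_1+A_2)\ge\frac{CH^3S(A_1+A_2)}{\varepsilon^2}\min\Big\{H,\frac1R\Big\}\log^3\Big(\frac{KS(A_1+A_2)}{\delta}\Big),$$ with probability at least $1-\delta$ the product policy $\widehat\pi_1\times\widehat\pi_2$ returned by the algorithm is an $\varepsilon$-robust Nash equilibrium, that is, $\mathsf{gap}_{\mathsf{NE}}(\widehat\pi_1\times\widehat\pi_2)\le\varepsilon$. -/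

import Mathlib

noncomputable section

namespace RobustMG

/-! ### Finite probability -/

/-- A point of the probability simplex, as a law one can sample from. -/
def simplexPMF {X : Type} [Fintype X] (p : stdSimplex ℝ X) : PMF X :=
  PMF.ofFintype (fun x => ENNReal.ofReal (p x)) (by
    have h0 : ∀ x, 0 ≤ p x := p.2.1
    have h1 : ∑ x, p x = 1 := p.2.2
    rw [← ENNReal.ofReal_sum_of_nonneg (fun x _ => h0 x), h1, ENNReal.ofReal_one])

/-- The law of a finite family of independent random elements with laws `p i`. -/
def indepPMF {ι : Type} [Fintype ι] [DecidableEq ι] {X : ι → Type} [∀ i, Fintype (X i)]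
    (p : ∀ i, PMF (X i)) : PMF (∀ i, X i) :=
  PMF.ofFintype (fun x => ∏ i, p i (x i)) (by
    rw [← Fintype.prod_sum]
    refine Finset.prod_eq_one fun i _ => ?_
    rw [← tsum_fintype (L := .unconditional _)]
    exact (p i).tsum_coe)

/-- The softmax (exponential weights) distribution `x ↦ exp (f x) / ∑ y, exp (f y)`. -/
def softmax {X : Type} [Fintype X] [Nonempty X] (f : X → ℝ) : stdSimplex ℝ X :=
  ⟨fun x => Real.exp (f x) / ∑ y, Real.exp (f y),
    fun x => div_nonneg (Real.exp_pos _).le (Finset.sum_nonneg fun y _ => (Real.exp_pos _).le),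
    by
      rw [← Finset.sum_div]
      exact div_self (Finset.sum_pos (fun y _ => Real.exp_pos _) Finset.univ_nonempty).ne'⟩

/-- The mean of `f` under the weights `p`. -/
def mean {X : Type} [Fintype X] (p : stdSimplex ℝ X) (f : X → ℝ) : ℝ := ∑ x, p x * f x

/-- The variance of `f` under the weights `p`. -/
def var {X : Type} [Fintype X] (p : stdSimplex ℝ X) (f : X → ℝ) : ℝ :=
  mean p fun x => (f x - mean p f) ^ 2

/-! ### Robust Markov games -/

/-- Joint actions of `m` players, player `i` having the actions `Fin (A i)`. -/
abbrev Joint {m : ℕ} (A : Fin m → ℕ) : Type := (i : Fin m) → Fin (A i)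

/-- Non-stationary transition kernels. The steps are `1, …, H`; the other indices are never used. -/
abbrev TransKernel {m : ℕ} (S : ℕ) (A : Fin m → ℕ) : Type :=
  ℕ → Fin S → Joint A → stdSimplex ℝ (Fin S)

/-- A profile `(π_1, …, π_m)` of Markov policies, `π i h s a` being the weight that player `i` puts
on its action `a` in state `s` at step `h`. -/
abbrev Profile {m : ℕ} (S : ℕ) (A : Fin m → ℕ) : Type :=
  (i : Fin m) → ℕ → Fin S → Fin (A i) → ℝ

/-- A finite-horizon `m`-player Markov game with states `Fin S` and an `R`-contamination
uncertainty set around the nominal kernel `P0`. -/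
structure Game (m S : ℕ) (A : Fin m → ℕ) where
  /-- the horizon -/
  H : ℕ
  /-- the uncertainty level -/
  R : ℝ
  /-- the nominal transition kernel -/
  P0 : TransKernel S A
  /-- `r i h s a` is the reward of player `i` at step `h` -/
  r : Fin m → ℕ → Fin S → Joint A → ℝ

/-- Two-player zero-sum: the first player's rewards lie in `[0, 1]`, the second one's are their
negatives. -/
def Game.IsZeroSum {S : ℕ} {A : Fin 2 → ℕ} (G : Game 2 S A) : Prop :=
  ∀ h ∈ Finset.Icc 1 G.H, ∀ s a, G.r 0 h s a ∈ Set.Icc (0 : ℝ) 1 ∧ G.r 1 h s a = -G.r 0 h s a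

/-- `min {H, 1/R}`, with `1/0 = ∞`. -/
def Game.effHorizon {m S : ℕ} {A : Fin m → ℕ} (G : Game m S A) : ℝ :=
  if G.R = 0 then (G.H : ℝ) else min (G.H : ℝ) (1 / G.R)

/-- The uncertainty set: the product over `(h, s, a)` of the sets
`{(1 - R) P0_{h,s,a} + R P' | P' ∈ Δ(S)}`. -/
def Game.uncertaintySet {m S : ℕ} {A : Fin m → ℕ} (G : Game m S A) : Set (TransKernel S A) :=
  {P | ∀ h s a, ∃ P' : stdSimplex ℝ (Fin S),
    ∀ s', P h s a s' = (1 - G.R) * G.P0 h s a s' + G.R * P' s'}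

/-- Expectation, over the trajectory `s_h = s`, `a_t ∼ π_t(· | s_t)`, `s_{t+1} ∼ P_t(· | s_t, a_t)`,
of `g + ∑_{t = h}^{H} r_{i,t}(s_t, a_t)`, where `n` is the number `H - h + 1` of steps still to be
played (so that the first of `n + 1` remaining steps is step `H - n`) and `g` is the reward
accumulated before. -/
def Game.expReturn {m S : ℕ} {A : Fin m → ℕ} (G : Game m S A) (π : ℕ → Fin S → Joint A → ℝ)
    (P : TransKernel S A) (i : Fin m) : ℕ → Fin S → ℝ → ℝ
  | 0, _, g => g
  | n + 1, s, g => ∑ a, π (G.H - n) s a *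
      ∑ s', P (G.H - n) s a s' * G.expReturn π P i n s' (g + G.r i (G.H - n) s a)

/-- The value function `V_{i,h}^{π,P}(s)` of a joint Markov policy `π` under the kernel `P`. -/
def Game.value {m S : ℕ} {A : Fin m → ℕ} (G : Game m S A) (π : ℕ → Fin S → Joint A → ℝ)
    (P : TransKernel S A) (i : Fin m) (h : ℕ) (s : Fin S) : ℝ :=
  G.expReturn π P i (G.H + 1 - h) s 0

/-- The robust value function `V_{i,h}^{π,R}(s)`. -/
def Game.robustValue {m S : ℕ} {A : Fin m → ℕ} (G : Game m S A) (π : ℕ → Fin S → Joint A → ℝ)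
    (i : Fin m) (h : ℕ) (s : Fin S) : ℝ :=
  ⨅ P : G.uncertaintySet, G.value π P.1 i h s

/-- The product policy `π_1 × ⋯ × π_m`. -/
def prodPolicy {m S : ℕ} {A : Fin m → ℕ} (π : Profile S A) : ℕ → Fin S → Joint A → ℝ :=
  fun h s a => ∏ i, π i h s (a i)

/-- `V_{i,h}^{⋆,π_{-i},R}(s)`: the optimal robust value of player `i` over its Markov policies, the
other players following `π`. -/
def Game.bestResponseValue {m S : ℕ} {A : Fin m → ℕ} (G : Game m S A) (π : Profile S A)
    (i : Fin m) (h : ℕ) (s : Fin S) : ℝ :=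
  ⨆ π' : ℕ → Fin S → stdSimplex ℝ (Fin (A i)),
    G.robustValue (prodPolicy (Function.update π i fun t x a => π' t x a)) i h s

/-- `gap_NE(π)`. -/
def Game.gapNE {m S : ℕ} {A : Fin m → ℕ} (G : Game m S A) (π : Profile S A) : ℝ :=
  ⨆ s : Fin S, ⨆ i : Fin m, (G.bestResponseValue π i 1 s - G.robustValue (prodPolicy π) i 1 s)

/-- `π_1 × ⋯ × π_m` is an `ε`-robust Nash equilibrium. -/
def Game.IsRobustNE {m S : ℕ} {A : Fin m → ℕ} (G : Game m S A) (ε : ℝ) (π : Profile S A) : Prop :=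
  (∀ i, ∀ h ∈ Finset.Icc 1 G.H, ∀ s, π i h s ∈ stdSimplex ℝ (Fin (A i))) ∧ G.gapNE π ≤ ε

/-! ### The robust Q-FTRL algorithm -/

/-- The step size `α_k = c_α log K / (k - 1 + c_α log K)`. -/
def stepAlpha (cα : ℝ) (K k : ℕ) : ℝ :=
  cα * Real.log K / ((k : ℝ) - 1 + cα * Real.log K)

/-- The weight `α_k^K = α_k ∏_{j = k+1}^{K} (1 - α_j)`. -/
def weightAlpha (cα : ℝ) (K k : ℕ) : ℝ :=
  stepAlpha cα K k * ∏ j ∈ Finset.Icc (k + 1) K, (1 - stepAlpha cα K j)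

/-- The step size `η_k = √(log K / (α_k min {H, 1/R}))`. -/
def Game.stepEta {m S : ℕ} {A : Fin m → ℕ} (G : Game m S A) (cα : ℝ) (K k : ℕ) : ℝ :=
  Real.sqrt (Real.log K / (stepAlpha cα K k * G.effHorizon))

/-- The data drawn in one round at one step: for every player `i`, state `s` and action `a_i`, a
joint action and a next state. -/
abbrev Sample {m : ℕ} (S : ℕ) (A : Fin m → ℕ) : Type :=
  (i : Fin m) → Fin S → Fin (A i) → Joint A × Fin S

/-- The law of the data of one round at step `h` when the current policies are `p`. The draws for
different `(i, s, a_i)` are independent; in the draw for `(i, s, a_i)` player `i` plays `a_i`, the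
other players play independently according to `p`, and then the next state is drawn from the
nominal kernel. -/
def Game.sampleLaw {m S : ℕ} {A : Fin m → ℕ} (G : Game m S A) (h : ℕ)
    (p : (i : Fin m) → Fin S → stdSimplex ℝ (Fin (A i))) : PMF (Sample S A) :=
  indepPMF fun i => indepPMF fun s => indepPMF fun ai =>
    (indepPMF (Function.update (fun j => simplexPMF (p j s)) i (PMF.pure ai))).bind fun a =>
      (simplexPMF (G.P0 h s a)).map fun s' => (a, s')

/-- `q_{i,h}^k = r_{i,h}^k + (1 - R) P_{i,h}^k V_{i,h+1} + R min V_{i,h+1}` for the data `x` of round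
`k`, where `V = V_{·,h+1}`; the row `P_{i,h}^k(· | s, a_i)` is the point mass at the drawn next
state. -/
def Game.qHat {m S : ℕ} {A : Fin m → ℕ} (G : Game m S A) (h : ℕ) (V : Fin m → Fin S → ℝ)
    (x : Sample S A) (i : Fin m) (s : Fin S) (ai : Fin (A i)) : ℝ :=
  G.r i h s (x i s ai).1 + (1 - G.R) * V i (x i s ai).2 + G.R * ⨅ s', V i s'

/-- The Q-estimate `Q_{i,h}^k`, from the data `x 1, …, x k` of the first `k` rounds. -/
def Game.QHat {m S : ℕ} {A : Fin m → ℕ} (G : Game m S A) (cα : ℝ) (K h : ℕ)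
    (V : Fin m → Fin S → ℝ) (x : ℕ → Sample S A) (i : Fin m) (s : Fin S) : ℕ → Fin (A i) → ℝ
  | 0, _ => 0
  | k + 1, ai => (1 - stepAlpha cα K (k + 1)) * G.QHat cα K h V x i s k ai
      + stepAlpha cα K (k + 1) * G.qHat h V (x (k + 1)) i s ai

/-- The policy `π_{i,h}^k(· | s) ∝ exp (η_k Q_{i,h}^{k-1}(s, ·))`, for `k ≥ 1`; it is uniform for
`k = 1` since `Q_{i,h}^0 = 0`. -/
def Game.iterPolicy {m S : ℕ} {A : Fin m → ℕ} [∀ i, NeZero (A i)] (G : Game m S A) (cα : ℝ)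
    (K h : ℕ) (V : Fin m → Fin S → ℝ) (x : ℕ → Sample S A) (k : ℕ) (i : Fin m) (s : Fin S) :
    stdSimplex ℝ (Fin (A i)) :=
  softmax fun ai => G.stepEta cα K k * G.QHat cα K h V x i s (k - 1) ai

/-- The law of the data `x 1, …, x k` of the first `k` rounds at step `h` (the entries of other
indices are not used and keep a default value): in round `k + 1` one samples with the policies
`π_{·,h}^{k+1}` obtained from the data of the rounds before. -/
def Game.roundsLaw {m S : ℕ} {A : Fin m → ℕ} [NeZero S] [∀ i, NeZero (A i)] (G : Game m S A)
    (cα : ℝ) (K h : ℕ) (V : Fin m → Fin S → ℝ) : ℕ → PMF (ℕ → Sample S A)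
  | 0 => PMF.pure fun _ _ _ _ => (fun _ => 0, 0)
  | k + 1 => (G.roundsLaw cα K h V k).bind fun x =>
      (G.sampleLaw h (G.iterPolicy cα K h V x (k + 1))).map fun y => Function.update x (k + 1) y

/-- The averaged policy `∑_k α_k^K π_{i,h}^k(· | s)`. -/
def Game.avgPolicy {m S : ℕ} {A : Fin m → ℕ} [∀ i, NeZero (A i)] (G : Game m S A) (cα : ℝ)
    (K h : ℕ) (V : Fin m → Fin S → ℝ) (x : ℕ → Sample S A) (i : Fin m) (s : Fin S) :
    Fin (A i) → ℝ :=
  fun ai => ∑ k ∈ Finset.Icc 1 K, weightAlpha cα K k * G.iterPolicy cα K h V x k i s ai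

/-- The bonus `β_{i,h}(s)`. -/
def Game.bonus {m S : ℕ} {A : Fin m → ℕ} [∀ i, NeZero (A i)] (G : Game m S A) (cα cb δ : ℝ)
    (K h : ℕ) (V : Fin m → Fin S → ℝ) (x : ℕ → Sample S A) (i : Fin m) (s : Fin S) : ℝ :=
  cb * Real.sqrt (Real.log (K * S * (∑ j, (A j : ℝ)) / δ) ^ 3 / (K * G.effHorizon)) *
    ∑ k ∈ Finset.Icc 1 K, weightAlpha cα K k *
      (var (G.iterPolicy cα K h V x k i s) (G.qHat h V (x k) i s) + G.effHorizon)

/-- The value estimate `V̂_{i,h}(s)` obtained at step `h` from `V = V̂_{·,h+1}` and the data `x`. -/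
def Game.valueHat {m S : ℕ} {A : Fin m → ℕ} [∀ i, NeZero (A i)] (G : Game m S A) (cα cb δ : ℝ)
    (K h : ℕ) (V : Fin m → Fin S → ℝ) (x : ℕ → Sample S A) (i : Fin m) (s : Fin S) : ℝ :=
  min ((∑ k ∈ Finset.Icc 1 K, weightAlpha cα K k *
        mean (G.iterPolicy cα K h V x k i s) (G.qHat h V (x k) i s))
      + G.bonus cα cb δ K h V x i s)
    ((G.H : ℝ) - h + 1)

/-- The joint law of the value estimates `V̂_{·,h}` and of the averaged policies at the steps
`h, …, H`, after the `n = H - h + 1` steps `H, …, h` have been processed. -/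
def Game.run {m S : ℕ} {A : Fin m → ℕ} [NeZero S] [∀ i, NeZero (A i)] (G : Game m S A)
    (cα cb δ : ℝ) (K : ℕ) : ℕ → PMF ((Fin m → Fin S → ℝ) × Profile S A)
  | 0 => PMF.pure (0, 0)
  | n + 1 => (G.run cα cb δ K n).bind fun o =>
      (G.roundsLaw cα K (G.H - n) o.1 K).map fun x =>
        (G.valueHat cα cb δ K (G.H - n) o.1 x,
          fun i => Function.update (o.2 i) (G.H - n) (G.avgPolicy cα K (G.H - n) o.1 x i))

/-- The law of the profile `(π̂_1, …, π̂_m)` that the algorithm returns with `K` rounds per step. -/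
def Game.output {m S : ℕ} {A : Fin m → ℕ} [NeZero S] [∀ i, NeZero (A i)] (G : Game m S A)
    (cα cb δ : ℝ) (K : ℕ) : PMF (Profile S A) :=
  (G.run cα cb δ K G.H).map Prod.snd

end RobustMG

end

/-! Contamination adds to the Bellman recursion the number `R * min V`, which does not depend on the
state. Without these numbers the recursion is that of an ordinary game with discount factor `1 - R`:
the robust value is the discounted value plus `R` times the sum of the minima of the discounted
values with fewer steps to go. The discounted game is still zero-sum, although the robust one is
not, since there each player faces a worst kernel of its own. Hence the equilibrium gap is
controlled by the sums of the two players' optimal discounted values (`Game.IsZeroSum.gapNE_le`).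

At a single step, exponential weights (`expWeights_regret`) ensure that no action beats the average
gain of the played policies by more than a small multiple of the played variance plus a constant;
the bonus covers the variance part. The played gains of both players refer to the same joint
policies, so the rewards cancel when the two value estimates are added. A fixed action against the
averaged policy of the single opponent earns the average of its gains, so the bounds pass to the
product of the averaged policies.

Let ι be the logarithmic factor, L the effective horizon and b = √(ι³/(KL)). A step costs a multiple
of b (variance + L), and the variance may be of order L², so a separate bound for each step would
lose a factor L. Instead a multiple of b times the squared excess of the estimate over its minimum
is carried along as a potential, whose change from step to step pays for the variance
(`potential_upper`, `potential_lower`). There remains O(bL) per step, in total O(HbL) =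
O(√(H²Lι³/K)), which is at most a fraction of ε under the sample size condition.

Within a step, concentration comes from exponential supermartingales. Since ι contains no log H and
K may be much smaller than H, a union bound over the H steps is not affordable. But a failed step
costs only O(L). So the invariant `Game.Inv` carries a number N of exceptional steps, whose
expectation is bounded in `Game.Regime.pexp_badCount_le`, and Markov's inequality at the level
ε/(40L) gives the probability 1 - δ. -/

noncomputable section
namespace RobustMG
open Finset
open scoped ENNReal

/-! ### Expectations under probability mass functions -/

/-- The expectation of an extended nonnegative function. -/
def pexp {α : Type*} (p : PMF α) (f : α → ℝ≥0∞) : ℝ≥0∞ := ∑' a, p a * f a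

/-- The expectation of a real function on a finite type. -/
def rexp {α : Type*} [Fintype α] (p : PMF α) (f : α → ℝ) : ℝ := ∑ a, (p a).toReal * f a

section pexp
variable {α β : Type*}

lemma pexp_mono (p : PMF α) {f g : α → ℝ≥0∞} (h : ∀ a, f a ≤ g a) : pexp p f ≤ pexp p g :=
  ENNReal.tsum_le_tsum fun a => mul_le_mul_right (h a) _

lemma pexp_const (p : PMF α) (c : ℝ≥0∞) : pexp p (fun _ => c) = c := by
  rw [pexp, ENNReal.tsum_mul_right, p.tsum_coe, one_mul]

lemma pexp_add (p : PMF α) (f g : α → ℝ≥0∞) :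
    pexp p (fun a => f a + g a) = pexp p f + pexp p g := by
  simp only [pexp, mul_add, ENNReal.tsum_add]

lemma pexp_finset_sum {ι : Type*} (t : Finset ι) (p : PMF α) (f : ι → α → ℝ≥0∞) :
    pexp p (fun a => ∑ i ∈ t, f i a) = ∑ i ∈ t, pexp p (f i) := by
  classical
  induction t using Finset.induction_on with
  | empty => simp [pexp]
  | insert i t hi ih => simp only [Finset.sum_insert hi, pexp_add, ih]

lemma pexp_mul_left (p : PMF α) (c : ℝ≥0∞) (f : α → ℝ≥0∞) :
    pexp p (fun a => c * f a) = c * pexp p f := by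
  simp only [pexp, ← ENNReal.tsum_mul_left]
  exact tsum_congr fun a => by ring

lemma pexp_pure (a : α) (f : α → ℝ≥0∞) : pexp (PMF.pure a) f = f a := by
  rw [pexp, tsum_eq_single a]
  · simp
  · intro b hb
    simp [hb]

lemma pexp_bind (p : PMF α) (k : α → PMF β) (f : β → ℝ≥0∞) :
    pexp (p.bind k) f = pexp p fun a => pexp (k a) f := by
  simp only [pexp, PMF.bind_apply, ← ENNReal.tsum_mul_right, ← ENNReal.tsum_mul_left]
  rw [ENNReal.tsum_comm]
  exact tsum_congr fun a => tsum_congr fun b => by ring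

lemma pexp_map (p : PMF α) (k : α → β) (f : β → ℝ≥0∞) :
    pexp (p.map k) f = pexp p fun a => f (k a) := by
  rw [← PMF.bind_pure_comp, pexp_bind]
  simp only [Function.comp, pexp_pure]

lemma toOuterMeasure_eq_pexp (p : PMF α) (s : Set α) :
    p.toOuterMeasure s = pexp p (s.indicator 1) := by
  rw [PMF.toOuterMeasure_apply]
  refine tsum_congr fun a => ?_
  by_cases h : a ∈ s <;> simp [h]

/-- Markov's inequality for the probability of the complementary event. -/
lemma one_sub_le_toOuterMeasure (p : PMF α) (s : Set α) (f : α → ℝ≥0∞) (ε : ℝ≥0∞)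
    (hf : pexp p f ≤ ε) (h : ∀ a, a ∉ s → 1 ≤ f a) : 1 - ε ≤ p.toOuterMeasure s := by
  rw [toOuterMeasure_eq_pexp, tsub_le_iff_right]
  calc (1 : ℝ≥0∞) = pexp p fun _ => 1 := (pexp_const p 1).symm
    _ ≤ pexp p fun a => s.indicator 1 a + f a := by
        refine pexp_mono p fun a => ?_
        by_cases ha : a ∈ s
        · simp [ha]
        · simpa [ha] using h a ha
    _ ≤ _ := by rw [pexp_add]; gcongr

lemma pexp_ofReal [Fintype α] (p : PMF α) (f : α → ℝ) (hf : ∀ a, 0 ≤ f a) :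
    pexp p (fun a => ENNReal.ofReal (f a)) = ENNReal.ofReal (rexp p f) := by
  rw [pexp, tsum_fintype, rexp, ENNReal.ofReal_sum_of_nonneg
    (fun a _ => mul_nonneg ENNReal.toReal_nonneg (hf a))]
  refine Finset.sum_congr rfl fun a _ => ?_
  rw [ENNReal.ofReal_mul ENNReal.toReal_nonneg, ENNReal.ofReal_toReal (p.apply_ne_top a)]

end pexp

section rexp
variable {α β : Type*} [Fintype α] [Fintype β]

lemma sum_toReal (p : PMF α) : ∑ a, (p a).toReal = 1 := by
  rw [← ENNReal.toReal_sum fun a _ => p.apply_ne_top a, ← tsum_fintype (L := .unconditional _),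
    p.tsum_coe, ENNReal.toReal_one]

lemma rexp_mono (p : PMF α) {f g : α → ℝ} (h : ∀ a, f a ≤ g a) : rexp p f ≤ rexp p g :=
  Finset.sum_le_sum fun a _ => mul_le_mul_of_nonneg_left (h a) ENNReal.toReal_nonneg

lemma rexp_const (p : PMF α) (c : ℝ) : rexp p (fun _ => c) = c := by
  rw [rexp, ← Finset.sum_mul, sum_toReal, one_mul]

lemma rexp_add (p : PMF α) (f g : α → ℝ) :
    rexp p (fun a => f a + g a) = rexp p f + rexp p g := by
  simp only [rexp, mul_add, Finset.sum_add_distrib]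

lemma rexp_mul_left (p : PMF α) (c : ℝ) (f : α → ℝ) :
    rexp p (fun a => c * f a) = c * rexp p f := by
  simp only [rexp, Finset.mul_sum]
  exact Finset.sum_congr rfl fun a _ => by ring

lemma rexp_sub (p : PMF α) (f g : α → ℝ) :
    rexp p (fun a => f a - g a) = rexp p f - rexp p g := by
  simp only [rexp, mul_sub, Finset.sum_sub_distrib]

lemma rexp_sum {ι : Type*} (t : Finset ι) (p : PMF α) (f : ι → α → ℝ) :
    rexp p (fun a => ∑ i ∈ t, f i a) = ∑ i ∈ t, rexp p (f i) := by
  simp only [rexp, Finset.mul_sum]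
  exact Finset.sum_comm

lemma rexp_bind (p : PMF α) (k : α → PMF β) (f : β → ℝ) :
    rexp (p.bind k) f = rexp p fun a => rexp (k a) f := by
  simp only [rexp, PMF.bind_apply, tsum_fintype, Finset.mul_sum]
  rw [Finset.sum_comm]
  refine Finset.sum_congr rfl fun b _ => ?_
  rw [ENNReal.toReal_sum fun a _ => ENNReal.mul_ne_top (p.apply_ne_top a) ((k a).apply_ne_top b),
    Finset.sum_mul]
  exact Finset.sum_congr rfl fun a _ => by rw [ENNReal.toReal_mul]; ring

lemma rexp_pure (a : α) (f : α → ℝ) : rexp (PMF.pure a) f = f a := by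
  classical
  rw [rexp, Finset.sum_eq_single a]
  · simp
  · intro b _ hb
    simp [hb]
  · simp

lemma rexp_map (p : PMF α) (k : α → β) (f : β → ℝ) :
    rexp (p.map k) f = rexp p fun a => f (k a) := by
  rw [← PMF.bind_pure_comp, rexp_bind]
  simp only [Function.comp, rexp_pure]

lemma simplexPMF_toReal {X : Type} [Fintype X] (p : stdSimplex ℝ X) (x : X) :
    (simplexPMF p x).toReal = p x := by
  have h : 0 ≤ p x := p.2.1 x
  rw [simplexPMF, PMF.ofFintype_apply, ENNReal.toReal_ofReal h]

lemma rexp_simplexPMF {X : Type} [Fintype X] (p : stdSimplex ℝ X) (f : X → ℝ) :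
    rexp (simplexPMF p) f = ∑ x, p x * f x := by
  simp only [rexp, simplexPMF_toReal]

/-- A centred random variable bounded above by `1` has exponential moment at most the exponential
of its variance. -/
lemma rexp_exp_sub_le_one (p : PMF α) (X : α → ℝ) (v : ℝ) (hX : ∀ a, X a ≤ 1)
    (h1 : rexp p X ≤ 0) (h2 : rexp p (fun a => X a ^ 2) ≤ v) :
    rexp p (fun a => Real.exp (X a - v)) ≤ 1 := by
  -- No lower bound on `x` is needed: below `-1` the left side is at most `1` and `x + x ^ 2` is
  -- nonnegative.
  have key : ∀ x : ℝ, x ≤ 1 → Real.exp x ≤ 1 + x + x ^ 2 := by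
    intro x hx
    rcases le_total (-1) x with h | h
    · have := Real.abs_exp_sub_one_sub_id_le (x := x) (abs_le.2 ⟨h, hx⟩)
      have := (abs_le.1 this).2
      linarith
    · have h1 : Real.exp x ≤ 1 := Real.exp_le_one_iff.2 (by linarith)
      nlinarith
  calc rexp p (fun a => Real.exp (X a - v))
      = Real.exp (-v) * rexp p (fun a => Real.exp (X a)) := by
        rw [← rexp_mul_left]
        congr 1; ext a; rw [← Real.exp_add]; ring_nf
    _ ≤ Real.exp (-v) * rexp p (fun a => (1 + X a) + X a ^ 2) :=
        mul_le_mul_of_nonneg_left (rexp_mono p fun a => key _ (hX a)) (Real.exp_pos _).le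
    _ ≤ Real.exp (-v) * Real.exp v := by
        refine mul_le_mul_of_nonneg_left ?_ (Real.exp_pos _).le
        rw [rexp_add, rexp_add, rexp_const]
        have := Real.add_one_le_exp v
        linarith
    _ = 1 := by rw [← Real.exp_add]; simp

/-- The exponential moment of a random variable with values in `[0, 1]`. -/
lemma rexp_exp_sub_two_mul_le_one (p : PMF α) (X : α → ℝ) (v : ℝ) (hX0 : ∀ a, 0 ≤ X a)
    (hX : ∀ a, X a ≤ 1) (h1 : rexp p X ≤ v) :
    rexp p (fun a => Real.exp (X a - 2 * v)) ≤ 1 := by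
  have key : ∀ x : ℝ, 0 ≤ x → x ≤ 1 → Real.exp x ≤ 1 + 2 * x := by
    intro x h0 hx
    have := Real.abs_exp_sub_one_sub_id_le (x := x) (abs_le.2 ⟨by linarith, hx⟩)
    have := (abs_le.1 this).2
    nlinarith
  calc rexp p (fun a => Real.exp (X a - 2 * v))
      = Real.exp (-(2 * v)) * rexp p (fun a => Real.exp (X a)) := by
        rw [← rexp_mul_left]
        congr 1; ext a; rw [← Real.exp_add]; ring_nf
    _ ≤ Real.exp (-(2 * v)) * rexp p (fun a => 1 + 2 * X a) :=
        mul_le_mul_of_nonneg_left (rexp_mono p fun a => key _ (hX0 a) (hX a)) (Real.exp_pos _).le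
    _ ≤ Real.exp (-(2 * v)) * Real.exp (2 * v) := by
        refine mul_le_mul_of_nonneg_left ?_ (Real.exp_pos _).le
        rw [rexp_add, rexp_mul_left, rexp_const]
        have := Real.add_one_le_exp (2 * v)
        linarith
    _ = 1 := by rw [← Real.exp_add]; simp

end rexp

/-! ### Product weights -/

lemma prod_update_apply {ι : Type*} [Fintype ι] [DecidableEq ι] {X : ι → Type*}
    (μ : ∀ i, X i → ℝ) (i : ι) (ν : X i → ℝ) (x : ∀ i, X i) :
    ∏ j, Function.update μ i ν j (x j) = ν (x i) * ∏ j ∈ univ.erase i, μ j (x j) := by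
  rw [← Finset.mul_prod_erase _ _ (mem_univ i), Function.update_self]
  congr 1
  exact Finset.prod_congr rfl fun j hj => by rw [Function.update_of_ne (Finset.ne_of_mem_erase hj)]

section prodMean
variable {ι : Type*} [Fintype ι] [DecidableEq ι] {X : ι → Type*} [∀ i, Fintype (X i)]

/-- The integral of `F` against the product of the weights `μ i`. -/
def prodMean (μ : ∀ i, X i → ℝ) (F : (∀ i, X i) → ℝ) : ℝ := ∑ x, (∏ i, μ i (x i)) * F x

lemma prodMean_mono (μ : ∀ i, X i → ℝ) (hμ : ∀ i a, 0 ≤ μ i a) {F F' : (∀ i, X i) → ℝ}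
    (h : ∀ x, F x ≤ F' x) : prodMean μ F ≤ prodMean μ F' :=
  Finset.sum_le_sum fun x _ =>
    mul_le_mul_of_nonneg_left (h x) (Finset.prod_nonneg fun i _ => hμ i _)

lemma prodMean_add (μ : ∀ i, X i → ℝ) (F F' : (∀ i, X i) → ℝ) :
    prodMean μ (fun x => F x + F' x) = prodMean μ F + prodMean μ F' := by
  simp only [prodMean, mul_add, Finset.sum_add_distrib]

lemma prodMean_mul_left (μ : ∀ i, X i → ℝ) (c : ℝ) (F : (∀ i, X i) → ℝ) :
    prodMean μ (fun x => c * F x) = c * prodMean μ F := by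
  simp only [prodMean, Finset.mul_sum]
  exact Finset.sum_congr rfl fun a _ => by ring

lemma prodMean_const (μ : ∀ i, X i → ℝ) (hμ : ∀ i, ∑ a, μ i a = 1) (c : ℝ) :
    prodMean μ (fun _ => c) = c := by
  rw [prodMean, ← Finset.sum_mul, ← Fintype.prod_sum, Finset.prod_eq_one fun i _ => hμ i, one_mul]

lemma prodMean_apply (μ : ∀ i, X i → ℝ) (hμ : ∀ i, ∑ a, μ i a = 1) (i : ι) (g : X i → ℝ) :
    prodMean μ (fun x => g (x i)) = ∑ a, μ i a * g a := by
  -- The factor `g` is absorbed into the `i`-th weight, so that the sum factorizes.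
  have h : prodMean μ (fun x => g (x i))
      = ∑ x : ∀ i, X i, ∏ j, Function.update μ i (fun a => μ i a * g a) j (x j) := by
    refine Finset.sum_congr rfl fun x _ => ?_
    rw [prod_update_apply, ← Finset.mul_prod_erase _ _ (mem_univ i)]
    ring
  rw [h, ← Fintype.prod_sum, ← Finset.mul_prod_erase _ _ (mem_univ i), Function.update_self,
    Finset.prod_eq_one, mul_one]
  intro j hj
  rw [Function.update_of_ne (Finset.ne_of_mem_erase hj), hμ j]

/-- Conditioning on the `i`-th coordinate. -/
lemma prodMean_update_eq_sum [∀ i, DecidableEq (X i)] (μ : ∀ i, X i → ℝ) (i : ι) (ν : X i → ℝ)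
    (F : (∀ i, X i) → ℝ) :
    prodMean (Function.update μ i ν) F
      = ∑ a, ν a * prodMean (Function.update μ i (Pi.single a 1)) F := by
  simp only [prodMean, prod_update_apply, Finset.mul_sum]
  rw [Finset.sum_comm]
  refine Finset.sum_congr rfl fun x _ => ?_
  rw [Finset.sum_eq_single (x i)]
  · simp; ring
  · intro b _ hb
    rw [Pi.single_eq_of_ne (Ne.symm hb)]
    ring
  · simp

lemma prodMean_eq_sum [∀ i, DecidableEq (X i)] (μ : ∀ i, X i → ℝ) (i : ι)
    (F : (∀ i, X i) → ℝ) :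
    prodMean μ F = ∑ a, μ i a * prodMean (Function.update μ i (Pi.single a 1)) F := by
  conv_lhs => rw [← Function.update_eq_self i μ]
  exact prodMean_update_eq_sum μ i (μ i) F

/-- Linearity in one factor of the product; it turns the averaged policy of an opponent into an
average over rounds. -/
lemma prodMean_update_sum {κ : Type*} (t : Finset κ) (μ : ∀ i, X i → ℝ) (i : ι) (w : κ → ℝ)
    (ν : κ → X i → ℝ) (F : (∀ i, X i) → ℝ) :
    prodMean (Function.update μ i fun a => ∑ k ∈ t, w k * ν k a) F
      = ∑ k ∈ t, w k * prodMean (Function.update μ i (ν k)) F := by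
  simp only [prodMean, prod_update_apply, Finset.mul_sum]
  rw [Finset.sum_comm]
  refine Finset.sum_congr rfl fun x _ => ?_
  rw [Finset.sum_mul, Finset.sum_mul]
  exact Finset.sum_congr rfl fun k _ => by ring

end prodMean

lemma rexp_indepPMF {ι : Type} [Fintype ι] [DecidableEq ι] {X : ι → Type} [∀ i, Fintype (X i)]
    (p : ∀ i, PMF (X i)) (F : (∀ i, X i) → ℝ) :
    rexp (indepPMF p) F = prodMean (fun i a => (p i a).toReal) F := by
  refine Finset.sum_congr rfl fun x _ => ?_
  rw [indepPMF, PMF.ofFintype_apply, ENNReal.toReal_prod]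

/-- The analysis of a round uses only the marginals of its table of samples: linearity and Jensen's
inequality replace independence between the entries. -/
lemma rexp_indepPMF_apply {ι : Type} [Fintype ι] [DecidableEq ι] {X : ι → Type}
    [∀ i, Fintype (X i)] (p : ∀ i, PMF (X i)) (i : ι) (g : X i → ℝ) :
    rexp (indepPMF p) (fun x => g (x i)) = rexp (p i) g := by
  rw [rexp_indepPMF, prodMean_apply _ (fun j => sum_toReal (p j))]
  rfl

end RobustMG
end

noncomputable section
namespace RobustMG
open Finset

/-! ### Means and variances on a finite set -/

section meanVar
variable {X : Type} [Fintype X]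

lemma simplex_nonneg (p : stdSimplex ℝ X) (x : X) : 0 ≤ p x := p.2.1 x

lemma simplex_sum (p : stdSimplex ℝ X) : ∑ x, p x = 1 := p.2.2

lemma mean_mono (p : stdSimplex ℝ X) {f g : X → ℝ} (h : ∀ x, f x ≤ g x) : mean p f ≤ mean p g :=
  Finset.sum_le_sum fun x _ => mul_le_mul_of_nonneg_left (h x) (simplex_nonneg p x)

lemma mean_const (p : stdSimplex ℝ X) (c : ℝ) : mean p (fun _ => c) = c := by
  rw [mean, ← Finset.sum_mul, simplex_sum, one_mul]

lemma mean_add (p : stdSimplex ℝ X) (f g : X → ℝ) :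
    mean p (fun x => f x + g x) = mean p f + mean p g := by
  simp only [mean, mul_add, Finset.sum_add_distrib]

lemma mean_mul_left (p : stdSimplex ℝ X) (c : ℝ) (f : X → ℝ) :
    mean p (fun x => c * f x) = c * mean p f := by
  simp only [mean, Finset.mul_sum]
  exact Finset.sum_congr rfl fun a _ => by ring

lemma mean_sub_sq (p : stdSimplex ℝ X) (f : X → ℝ) (c : ℝ) :
    mean p (fun x => (f x - c) ^ 2) = mean p (fun x => f x ^ 2) - 2 * c * mean p f + c ^ 2 := by
  have : (fun x => (f x - c) ^ 2) = fun x => f x ^ 2 + ((-(2 * c)) * f x + c ^ 2) := by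
    ext x; ring
  rw [this, mean_add, mean_add, mean_mul_left, mean_const]
  ring

lemma var_eq (p : stdSimplex ℝ X) (f : X → ℝ) :
    var p f = mean p (fun x => f x ^ 2) - mean p f ^ 2 := by
  rw [var, mean_sub_sq]; ring

lemma var_nonneg (p : stdSimplex ℝ X) (f : X → ℝ) : 0 ≤ var p f :=
  Finset.sum_nonneg fun x _ => mul_nonneg (simplex_nonneg p x) (sq_nonneg _)

lemma sq_mean_le (p : stdSimplex ℝ X) (f : X → ℝ) : mean p f ^ 2 ≤ mean p (fun x => f x ^ 2) := by
  have := var_nonneg p f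
  rw [var_eq] at this
  linarith

lemma var_le_mean_sub_sq (p : stdSimplex ℝ X) (f : X → ℝ) (c : ℝ) :
    var p f ≤ mean p (fun x => (f x - c) ^ 2) := by
  rw [var_eq, mean_sub_sq]
  nlinarith [sq_nonneg (mean p f - c)]

lemma var_add_const (p : stdSimplex ℝ X) (f : X → ℝ) (c : ℝ) :
    var p (fun x => f x + c) = var p f := by
  simp only [var, mean_add, mean_const, add_sub_add_right_eq_sub]

/-- The Bhatia–Davis inequality. -/
lemma var_le_mul (p : stdSimplex ℝ X) (f : X → ℝ) {lo hi : ℝ} (hlo : ∀ x, lo ≤ f x)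
    (hhi : ∀ x, f x ≤ hi) : var p f ≤ (hi - mean p f) * (mean p f - lo) := by
  have h : mean p (fun x => f x ^ 2) ≤ mean p (fun x => (hi + lo) * f x + (-(hi * lo))) :=
    mean_mono p fun x => by nlinarith [mul_nonneg (sub_nonneg.2 (hlo x)) (sub_nonneg.2 (hhi x))]
  rw [mean_add, mean_mul_left, mean_const] at h
  rw [var_eq]
  nlinarith

lemma le_mean (p : stdSimplex ℝ X) (f : X → ℝ) {lo : ℝ} (hlo : ∀ x, lo ≤ f x) : lo ≤ mean p f := by
  simpa [mean_const] using mean_mono p hlo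

lemma mean_le (p : stdSimplex ℝ X) (f : X → ℝ) {hi : ℝ} (hhi : ∀ x, f x ≤ hi) : mean p f ≤ hi := by
  simpa [mean_const] using mean_mono p hhi

/-- Adding a small multiple of the variance keeps the mean below the maximum. -/
lemma mean_add_mul_var_le (p : stdSimplex ℝ X) (f : X → ℝ) {lo hi b : ℝ} (hlo : ∀ x, lo ≤ f x)
    (hhi : ∀ x, f x ≤ hi) (hb : 0 ≤ b) (hb1 : b * (hi - lo) ≤ 1) :
    mean p f + b * var p f ≤ hi := by
  have h1 := var_le_mul p f hlo hhi
  have h2 := mean_le p f hhi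
  have h3 := le_mean p f hlo
  have h4 : b * var p f ≤ b * ((hi - mean p f) * (hi - lo)) := by
    refine mul_le_mul_of_nonneg_left (h1.trans ?_) hb
    exact mul_le_mul_of_nonneg_left (by linarith) (by linarith)
  nlinarith [mul_le_mul_of_nonneg_right hb1 (sub_nonneg.2 h2)]

end meanVar

/-! ### Exponential weights -/

section logMean
variable {X : Type} [Fintype X]

/-- The logarithmic mean `η⁻¹ log (|X|⁻¹ ∑ exp (η f))`. -/
def logMean (η : ℝ) (f : X → ℝ) : ℝ :=
  Real.log (∑ x, (Fintype.card X : ℝ)⁻¹ * Real.exp (η * f x)) / η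

lemma card_inv_nonneg : (0 : ℝ) ≤ (Fintype.card X : ℝ)⁻¹ := by positivity

/-- Scaling the gains is the same as scaling the learning rate; this handles the factor `1 - α k` in
the update of `Q`. -/
lemma logMean_mul {η c : ℝ} (hc : 0 < c) (f : X → ℝ) :
    logMean η (fun x => c * f x) = c * logMean (c * η) f := by
  have h : ∀ x, η * (c * f x) = c * η * f x := fun x => by ring
  simp only [logMean, h]
  rw [mul_div_assoc', mul_div_mul_left _ _ hc.ne']

/-- Centre `f` at its mean and use `exp x ≤ 1 + x + x ^ 2` for `x ≤ 1`, then `1 + y ≤ exp y`. The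
condition on `θ` is needed only for upward deviations. -/
lemma log_mean_exp_le_add_var (p : stdSimplex ℝ X) (f : X → ℝ) {θ lo hi : ℝ} (hθ : 0 ≤ θ)
    (hlo : ∀ x, lo ≤ f x) (hhi : ∀ x, f x ≤ hi) (h1 : θ * (hi - lo) ≤ 1) :
    Real.log (mean p fun x => Real.exp (θ * f x)) ≤ θ * mean p f + θ ^ 2 * var p f := by
  have hm1 := le_mean p f hlo
  have key : ∀ x : ℝ, x ≤ 1 → Real.exp x ≤ 1 + x + x ^ 2 := by
    intro x hx
    rcases le_total (-1) x with h | h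
    · have := Real.abs_exp_sub_one_sub_id_le (x := x) (abs_le.2 ⟨h, hx⟩)
      have := (abs_le.1 this).2
      linarith
    · have h1 : Real.exp x ≤ 1 := Real.exp_le_one_iff.2 (by linarith)
      nlinarith
  have hpos : 0 < mean p fun x => Real.exp (θ * f x) :=
    lt_of_lt_of_le (Real.exp_pos (θ * lo)) (le_mean p _ fun x =>
      Real.exp_le_exp.2 (mul_le_mul_of_nonneg_left (hlo x) hθ))
  rw [← Real.log_exp (θ * mean p f + θ ^ 2 * var p f)]
  refine Real.log_le_log hpos ?_
  have hb : ∀ x, Real.exp (θ * f x) ≤ Real.exp (θ * mean p f)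
      * (1 + (θ * f x + (-(θ * mean p f)) + θ ^ 2 * (f x - mean p f) ^ 2)) := by
    intro x
    have h := key (θ * f x - θ * mean p f) (by nlinarith [hhi x])
    have e : Real.exp (θ * f x)
        = Real.exp (θ * mean p f) * Real.exp (θ * f x - θ * mean p f) := by
      rw [← Real.exp_add]; ring_nf
    rw [e]
    refine mul_le_mul_of_nonneg_left (h.trans (le_of_eq ?_)) (Real.exp_pos _).le
    ring
  refine (mean_mono p hb).trans ?_
  rw [mean_mul_left, mean_add, mean_add, mean_add, mean_mul_left, mean_mul_left, mean_const,
    mean_const, Real.exp_add]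
  refine mul_le_mul_of_nonneg_left ?_ (Real.exp_pos _).le
  have := Real.add_one_le_exp (θ ^ 2 * var p f)
  rw [← var]
  linarith

/-- The crude substitute for the variance bound in the early rounds, where `θ` may be large. -/
lemma log_mean_exp_le_mul (p : stdSimplex ℝ X) (f : X → ℝ) {θ lo hi : ℝ} (hθ : 0 ≤ θ)
    (hlo : ∀ x, lo ≤ f x) (hhi : ∀ x, f x ≤ hi) :
    Real.log (mean p fun x => Real.exp (θ * f x)) ≤ θ * (mean p f + (hi - lo)) := by
  have hm1 := le_mean p f hlo
  have hpos : 0 < mean p fun x => Real.exp (θ * f x) :=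
    lt_of_lt_of_le (Real.exp_pos (θ * lo)) (le_mean p _ fun x =>
      Real.exp_le_exp.2 (mul_le_mul_of_nonneg_left (hlo x) hθ))
  rw [← Real.log_exp (θ * (mean p f + (hi - lo)))]
  refine Real.log_le_log hpos (mean_le p _ fun x => Real.exp_le_exp.2 ?_)
  exact mul_le_mul_of_nonneg_left (by linarith [hhi x]) hθ

variable [Nonempty X]

lemma card_inv_pos : (0 : ℝ) < (Fintype.card X : ℝ)⁻¹ := by
  have : 0 < Fintype.card X := Fintype.card_pos
  positivity

lemma sum_card_inv : ∑ _x : X, (Fintype.card X : ℝ)⁻¹ = 1 := by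
  rw [Finset.sum_const, Finset.card_univ, nsmul_eq_mul]
  exact mul_inv_cancel₀ (by exact_mod_cast Fintype.card_ne_zero)

lemma sum_exp_pos (f : X → ℝ) : 0 < ∑ x, (Fintype.card X : ℝ)⁻¹ * Real.exp (f x) :=
  Finset.sum_pos (fun _ _ => mul_pos card_inv_pos (Real.exp_pos _)) Finset.univ_nonempty

/-- The power mean inequality with exponent `η / η'`, applied to `exp (η' * f x)`. -/
lemma logMean_mono_left {η η' : ℝ} (hη' : 0 < η') (h : η' ≤ η) (f : X → ℝ) :
    logMean η' f ≤ logMean η f := by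
  have hη : 0 < η := hη'.trans_le h
  have key := Real.rpow_arith_mean_le_arith_mean_rpow Finset.univ
    (fun _ : X => (Fintype.card X : ℝ)⁻¹) (fun x => Real.exp (η' * f x))
    (fun _ _ => card_inv_nonneg) sum_card_inv (fun x _ => (Real.exp_pos _).le)
    (p := η / η') ((one_le_div hη').2 h)
  have h2 : ∀ x, Real.exp (η' * f x) ^ (η / η') = Real.exp (η * f x) := by
    intro x
    rw [← Real.exp_mul]
    congr 1
    field_simp
  simp only [h2] at key
  have h3 := Real.log_le_log (Real.rpow_pos_of_pos (sum_exp_pos _) _) key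
  rw [Real.log_rpow (sum_exp_pos _)] at h3
  rw [logMean, logMean, div_le_div_iff₀ hη' hη]
  rw [div_mul_eq_mul_div, div_le_iff₀ hη'] at h3
  linarith

lemma logMean_le {η M : ℝ} (hη : 0 < η) (f : X → ℝ) (hf : ∀ x, f x ≤ M) : logMean η f ≤ M := by
  rw [logMean, div_le_iff₀ hη]
  have h : ∑ x, (Fintype.card X : ℝ)⁻¹ * Real.exp (η * f x) ≤ Real.exp (M * η) := by
    calc _ ≤ ∑ _x : X, (Fintype.card X : ℝ)⁻¹ * Real.exp (M * η) := by
          refine Finset.sum_le_sum fun x _ => mul_le_mul_of_nonneg_left ?_ card_inv_nonneg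
          exact Real.exp_le_exp.2 (by nlinarith [hf x])
      _ = _ := by rw [← Finset.sum_mul, sum_card_inv, one_mul]
  calc _ ≤ Real.log (Real.exp (M * η)) := Real.log_le_log (sum_exp_pos _) h
    _ = _ := Real.log_exp _

lemma le_logMean_add {η : ℝ} (hη : 0 < η) (f : X → ℝ) (x : X) :
    f x ≤ logMean η f + Real.log (Fintype.card X) / η := by
  rw [logMean, ← add_div, le_div_iff₀ hη]
  have h : (Fintype.card X : ℝ)⁻¹ * Real.exp (η * f x)
      ≤ ∑ x, (Fintype.card X : ℝ)⁻¹ * Real.exp (η * f x) :=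
    Finset.single_le_sum (f := fun x => (Fintype.card X : ℝ)⁻¹ * Real.exp (η * f x))
      (fun x _ => mul_nonneg card_inv_nonneg (Real.exp_pos _).le) (mem_univ x)
  have h2 := Real.log_le_log (mul_pos card_inv_pos (Real.exp_pos _)) h
  rw [Real.log_mul card_inv_pos.ne' (Real.exp_pos _).ne', Real.log_inv, Real.log_exp] at h2
  linarith

/-- Changing the exponent amounts to an exponential moment under the softmax distribution. -/
lemma logMean_add {η : ℝ} (f g : X → ℝ) :
    logMean η (fun x => f x + g x) = logMean η f
      + Real.log (mean (softmax fun x => η * f x) fun x => Real.exp (η * g x)) / η := by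
  have hs : 0 < ∑ y, Real.exp (η * f y) :=
    Finset.sum_pos (fun y _ => Real.exp_pos _) Finset.univ_nonempty
  have hm : mean (softmax fun x => η * f x) (fun x => Real.exp (η * g x))
      = (∑ x, (Fintype.card X : ℝ)⁻¹ * Real.exp (η * (f x + g x)))
        / (∑ x, (Fintype.card X : ℝ)⁻¹ * Real.exp (η * f x)) := by
    rw [eq_div_iff (sum_exp_pos _).ne', ← Finset.mul_sum, ← Finset.mul_sum]
    have : mean (softmax fun x => η * f x) (fun x => Real.exp (η * g x))
        * (∑ y, Real.exp (η * f y)) = ∑ x, Real.exp (η * (f x + g x)) := by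
      rw [mean, Finset.sum_mul]
      refine Finset.sum_congr rfl fun x _ => ?_
      change Real.exp (η * f x) / (∑ y, Real.exp (η * f y)) * Real.exp (η * g x) * _ = _
      rw [mul_add, Real.exp_add]
      field_simp
    rw [← this]; ring
  rw [hm, Real.log_div (sum_exp_pos _).ne' (sum_exp_pos _).ne', logMean, logMean, ← add_div]
  congr 1
  ring

end logMean

/-! ### Weighted averages along a sequence of step sizes -/

/-- The weight of round `k` in the average over `n` rounds with the step sizes `α`. -/
def stepWeight (α : ℕ → ℝ) (n k : ℕ) : ℝ := α k * ∏ j ∈ Finset.Icc (k + 1) n, (1 - α j)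

lemma weightAlpha_eq (cα : ℝ) (K k : ℕ) : weightAlpha cα K k = stepWeight (stepAlpha cα K) K k :=
  rfl

lemma stepWeight_self (α : ℕ → ℝ) (n : ℕ) : stepWeight α n n = α n := by
  simp [stepWeight]

lemma stepWeight_succ (α : ℕ → ℝ) {n k : ℕ} (h : k ≤ n) :
    stepWeight α (n + 1) k = (1 - α (n + 1)) * stepWeight α n k := by
  rw [stepWeight, stepWeight, Finset.prod_Icc_succ_top (by omega)]
  ring

lemma sum_stepWeight_succ (α : ℕ → ℝ) (g : ℕ → ℝ) (n : ℕ) :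
    ∑ k ∈ Icc 1 (n + 1), stepWeight α (n + 1) k * g k
      = (1 - α (n + 1)) * ∑ k ∈ Icc 1 n, stepWeight α n k * g k + α (n + 1) * g (n + 1) := by
  rw [Finset.sum_Icc_succ_top (by omega), stepWeight_self, Finset.mul_sum]
  congr 1
  refine Finset.sum_congr rfl fun k hk => ?_
  rw [stepWeight_succ α (Finset.mem_Icc.1 hk).2]
  ring

lemma sum_stepWeight (α : ℕ → ℝ) (h1 : α 1 = 1) {n : ℕ} (hn : 1 ≤ n) :
    ∑ k ∈ Icc 1 n, stepWeight α n k = 1 := by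
  induction n, hn using Nat.le_induction with
  | base => simp [stepWeight, h1]
  | succ n hn ih =>
    have h := sum_stepWeight_succ α (fun _ => 1) n
    simp only [mul_one] at h
    rw [h, ih]; ring

lemma stepWeight_nonneg (α : ℕ → ℝ) (h0 : ∀ k, 1 ≤ k → 0 ≤ α k) (h1 : ∀ k, 1 ≤ k → α k ≤ 1)
    {n k : ℕ} (hk : 1 ≤ k) : 0 ≤ stepWeight α n k :=
  mul_nonneg (h0 k hk) (Finset.prod_nonneg fun j hj => by
    have := h1 j (by have := (Finset.mem_Icc.1 hj).1; omega)
    linarith)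

/-- At time `k₀` these weights sum to `1`, and each later round `j` multiplies them by `1 - α j`. -/
lemma sum_stepWeight_prefix (α : ℕ → ℝ) (h1 : α 1 = 1) {n k₀ : ℕ} (hk : 1 ≤ k₀) (hn : k₀ ≤ n) :
    ∑ k ∈ Icc 1 k₀, stepWeight α n k = ∏ j ∈ Icc (k₀ + 1) n, (1 - α j) := by
  induction n, hn using Nat.le_induction with
  | base => simp [sum_stepWeight α h1 hk]
  | succ n hn ih =>
    rw [Finset.prod_Icc_succ_top (by omega), ← ih, Finset.sum_mul]
    refine Finset.sum_congr rfl fun k hk' => ?_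
    rw [stepWeight_succ α ((Finset.mem_Icc.1 hk').2.trans hn)]
    ring

/-- The regret bound of exponential weights with decreasing step sizes: the rounds after `k₀`
contribute their variances, the others the whole range of the gains. -/
theorem expWeights_regret {X : Type} [Fintype X] [Nonempty X] (α η : ℕ → ℝ) (q Q : ℕ → X → ℝ)
    {n k₀ : ℕ} {D : ℝ} (lo : ℝ) (hn : 1 ≤ n) (hk₀ : 1 ≤ k₀)
    (h1 : α 1 = 1) (hα0 : ∀ k, 1 ≤ k → 0 < α k) (hα1 : ∀ k, 2 ≤ k → α k < 1)
    (hη : ∀ k, 1 ≤ k → 0 < η k) (hηα : ∀ k, 1 ≤ k → (1 - α k) * η (k + 1) ≤ η k)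
    (hQ0 : ∀ x, Q 0 x = 0)
    (hQ : ∀ k x, Q (k + 1) x = (1 - α (k + 1)) * Q k x + α (k + 1) * q (k + 1) x)
    (hlo : ∀ k ∈ Icc 1 n, ∀ x, lo ≤ q k x) (hhi : ∀ k ∈ Icc 1 n, ∀ x, q k x ≤ lo + D)
    (hD : ∀ k ∈ Icc (k₀ + 1) n, η k * α k / (1 - α k) * D ≤ 1) (x : X) :
    Q n x ≤ ∑ k ∈ Icc 1 n, stepWeight α n k *
        (mean (softmax fun y => η k * Q (k - 1) y) (q k)
          + if k₀ < k then η k * α k / (1 - α k) *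
              var (softmax fun y => η k * Q (k - 1) y) (q k) else D)
      + Real.log (Fintype.card X) / η (n + 1) := by
  set g : ℕ → ℝ := fun k => mean (softmax fun y => η k * Q (k - 1) y) (q k)
          + if k₀ < k then η k * α k / (1 - α k) *
              var (softmax fun y => η k * Q (k - 1) y) (q k) else D with hg
  -- The potential is the logarithmic mean of the current `Q`, taken at the learning rate of the
  -- next round.
  have main : ∀ m, m + 1 ≤ n →
      logMean (η (m + 2)) (Q (m + 1)) ≤ ∑ k ∈ Icc 1 (m + 1), stepWeight α (m + 1) k * g k := by
    intro m
    induction m with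
    | zero =>
      intro _
      have hg1 : g 1 = mean (softmax fun y => η 1 * Q (1 - 1) y) (q 1) + D := by
        simp only [hg, if_neg (show ¬ k₀ < 1 by omega)]
      have hm := le_mean (softmax fun y => η 1 * Q (1 - 1) y) (q 1) (hlo 1 (by simp; omega))
      simp only [zero_add, Icc_self, sum_singleton, stepWeight_self, h1, one_mul]
      refine logMean_le (hη 2 (by omega)) _ fun y => ?_
      have := hhi 1 (by simp; omega) y
      rw [hQ 0 y, hQ0, zero_add, h1, hg1]
      linarith
    | succ m ih =>
      intro hm
      have ih := ih (by omega)
      rw [sum_stepWeight_succ]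
      set k := m + 2 with hk
      have hk' : m + 1 + 1 = k := rfl
      have hkmem : k ∈ Icc 1 n := by simp; omega
      have ha0 := hα0 k (by omega)
      have ha1 := hα1 k (by omega)
      have hpos : 0 < 1 - α k := by linarith
      have hηk := hη k (by omega)
      have e1 : Q k = fun y => (1 - α k) * (Q (m + 1) y + α k / (1 - α k) * q k y) := by
        ext y
        have := hQ (m + 1) y
        rw [hk'] at this
        rw [this]
        field_simp
      -- Pulling out `1 - α k` changes the rate to `(1 - α k) * η (k + 1)`, which `hηα` bounds by `η
      -- k`, so monotonicity of the logarithmic mean restores the rate at which round `k` was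
      -- played.
      have e2 : logMean (η (m + 1 + 2)) (Q k)
          ≤ (1 - α k) * logMean (η k) (fun y => Q (m + 1) y + α k / (1 - α k) * q k y) := by
        rw [e1, logMean_mul hpos]
        refine mul_le_mul_of_nonneg_left (logMean_mono_left ?_ ?_ _) hpos.le
        · exact mul_pos hpos (hη _ (by omega))
        · exact hηα k (by omega)
      refine e2.trans ?_
      rw [logMean_add, mul_add]
      refine add_le_add (mul_le_mul_of_nonneg_left ih hpos.le) ?_
      set θ := η k * α k / (1 - α k) with hθ
      have hθ0 : 0 ≤ θ := by positivity
      have e3 : (fun y => Real.exp (η k * (α k / (1 - α k) * q k y)))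
          = fun y => Real.exp (θ * q k y) := by
        ext y; congr 1; rw [hθ]; ring
      have hk1 : Q (m + 1) = Q (k - 1) := rfl
      rw [e3, hk1]
      have e4 : ∀ z, (1 - α k) * (θ * z / η k) = α k * z := by
        intro z; rw [hθ]; field_simp
      by_cases hkk : k₀ < k
      · have hl := log_mean_exp_le_add_var (softmax fun y => η k * Q (k - 1) y) (q k) hθ0
          (hlo k hkmem) (hhi k hkmem) (by
            have := hD k (by simp; omega)
            simpa using this)
        simp only [hg, if_pos hkk]
        rw [← e4]
        refine mul_le_mul_of_nonneg_left ?_ hpos.le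
        refine (div_le_div_of_nonneg_right hl hηk.le).trans (le_of_eq ?_)
        ring
      · have hl := log_mean_exp_le_mul (softmax fun y => η k * Q (k - 1) y) (q k) hθ0
          (hlo k hkmem) (hhi k hkmem)
        simp only [hg, if_neg hkk]
        rw [← e4]
        refine mul_le_mul_of_nonneg_left ?_ hpos.le
        refine (div_le_div_of_nonneg_right hl hηk.le).trans (le_of_eq ?_)
        ring
  obtain ⟨m, rfl⟩ : ∃ m, n = m + 1 := ⟨n - 1, by omega⟩
  exact (le_logMean_add (hη _ (by omega)) (Q (m + 1)) x).trans
    (add_le_add_left (main m le_rfl) _)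

end RobustMG
end

noncomputable section
namespace RobustMG
open Finset

/-! ### Step sizes -/

section stepSizes
variable {cα : ℝ} {K : ℕ}

lemma stepAlpha_one (hc : 1 ≤ cα * Real.log K) : stepAlpha cα K 1 = 1 := by
  rw [stepAlpha, Nat.cast_one, sub_self, zero_add]
  exact div_self (by linarith)

lemma stepAlpha_pos (hc : 1 ≤ cα * Real.log K) {k : ℕ} (hk : 1 ≤ k) : 0 < stepAlpha cα K k := by
  have : (1 : ℝ) ≤ k := by exact_mod_cast hk
  exact div_pos (by linarith) (by linarith)

lemma stepAlpha_le_one (hc : 1 ≤ cα * Real.log K) {k : ℕ} (hk : 1 ≤ k) :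
    stepAlpha cα K k ≤ 1 := by
  have : (1 : ℝ) ≤ k := by exact_mod_cast hk
  exact (div_le_one (by linarith)).2 (by linarith)

lemma stepAlpha_lt_one (hc : 1 ≤ cα * Real.log K) {k : ℕ} (hk : 2 ≤ k) :
    stepAlpha cα K k < 1 := by
  have : (2 : ℝ) ≤ k := by exact_mod_cast hk
  exact (div_lt_one (by linarith)).2 (by linarith)

lemma stepAlpha_le_div (hc : 1 ≤ cα * Real.log K) {k : ℕ} (hk : 1 ≤ k) :
    stepAlpha cα K k ≤ cα * Real.log K / k := by
  have : (1 : ℝ) ≤ k := by exact_mod_cast hk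
  exact div_le_div_of_nonneg_left (by linarith) (by linarith) (by linarith)

lemma weightAlpha_nonneg (hc : 1 ≤ cα * Real.log K) {k : ℕ} (hk : k ∈ Icc 1 K) :
    0 ≤ weightAlpha cα K k :=
  stepWeight_nonneg _ (fun _ h => (stepAlpha_pos hc h).le) (fun _ h => stepAlpha_le_one hc h)
    (mem_Icc.1 hk).1

lemma sum_weightAlpha (hc : 1 ≤ cα * Real.log K) (hK : 1 ≤ K) :
    ∑ k ∈ Icc 1 K, weightAlpha cα K k = 1 :=
  sum_stepWeight _ (stepAlpha_one hc) hK

/-- With `c = cα * log K`, the inductive step `(1 - α_{n+1}) α_n ≤ α_{n+1}` reduces to `n ≤ n - 1 +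
c`, which is the assumption `1 ≤ c`. -/
lemma stepWeight_stepAlpha_le (hc : 1 ≤ cα * Real.log K) {n k : ℕ} (hk : 1 ≤ k) (hn : k ≤ n) :
    stepWeight (stepAlpha cα K) n k ≤ stepAlpha cα K n := by
  induction n, hn using Nat.le_induction with
  | base => rw [stepWeight_self]
  | succ n hn ih =>
    have hn1 : (1 : ℝ) ≤ n := by exact_mod_cast hk.trans hn
    rw [stepWeight_succ _ hn]
    refine (mul_le_mul_of_nonneg_left ih
      (sub_nonneg.2 (stepAlpha_le_one hc (by omega)))).trans ?_
    simp only [stepAlpha]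
    push_cast
    set c := cα * Real.log K
    have h1 : (0 : ℝ) < n - 1 + c := by linarith
    have h2 : (0 : ℝ) < n + 1 - 1 + c := by linarith
    rw [one_sub_div h2.ne', div_mul_div_comm, div_le_div_iff₀ (mul_pos h2 h1) h2]
    have h3 : 0 ≤ c * (n + 1 - 1 + c) := by nlinarith
    nlinarith

lemma weightAlpha_le (hc : 1 ≤ cα * Real.log K) {k : ℕ} (hk : k ∈ Icc 1 K) :
    weightAlpha cα K k ≤ cα * Real.log K / K :=
  (stepWeight_stepAlpha_le hc (mem_Icc.1 hk).1 (mem_Icc.1 hk).2).trans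
    (stepAlpha_le_div hc ((mem_Icc.1 hk).1.trans (mem_Icc.1 hk).2))

/-- Each factor is at most `exp (-c / (n + c))`, and `1 / (n + c)` dominates `log ((n + 1 + c) / (n
+ c))`; these logarithms telescope. -/
lemma prod_one_sub_stepAlpha_le (hc : 1 ≤ cα * Real.log K) {n k₀ : ℕ} (hn : k₀ ≤ n) :
    ∏ j ∈ Icc (k₀ + 1) n, (1 - stepAlpha cα K j)
      ≤ Real.exp (-(cα * Real.log K * Real.log ((n + cα * Real.log K) / (k₀ + cα * Real.log K)))) := by
  set c := cα * Real.log K with hcdef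
  induction n, hn using Nat.le_induction with
  | base =>
    have : (0 : ℝ) < k₀ + c := by positivity
    simp [div_self this.ne']
  | succ n hn ih =>
    rw [Finset.prod_Icc_succ_top (by omega)]
    have hp : 0 < (n : ℝ) + c := by positivity
    have hk : 0 < (k₀ : ℝ) + c := by positivity
    have h1 : 1 - stepAlpha cα K (n + 1) ≤ Real.exp (-(c * Real.log ((n + 1 + c) / (n + c)))) := by
      refine (Real.one_sub_le_exp_neg _).trans (Real.exp_le_exp.2 (neg_le_neg ?_))
      have h2 : Real.log ((n + 1 + c) / (n + c)) ≤ 1 / (n + c) := by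
        refine (Real.log_le_sub_one_of_pos (by positivity)).trans (le_of_eq ?_)
        field_simp; ring
      refine (mul_le_mul_of_nonneg_left h2 (by linarith)).trans (le_of_eq ?_)
      rw [stepAlpha, ← hcdef]; push_cast; ring
    refine (mul_le_mul ih h1 (sub_nonneg.2 (stepAlpha_le_one hc (by omega)))
      (Real.exp_pos _).le).trans (le_of_eq ?_)
    rw [← Real.exp_add]
    congr 1
    rw [Real.log_div hp.ne' hk.ne', Real.log_div (by positivity) hp.ne',
      Real.log_div (by positivity) hk.ne']
    push_cast; ring

/-- The number of initial rounds whose total weight is negligible. -/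
def burnIn (M : ℝ) (K : ℕ) : ℕ := ⌈(K : ℝ) / M⌉₊

/-- The prefix weight is at most `((k₀ + c) / (K + c)) ^ c` with `c = cα * log K`. Both `c` and the
rounding error `1` are at most `K / M`, so the ratio `(K + c) / (k₀ + c)` is at least `M / 3 = exp
(1 / cα)`, and its power `c` is at least `K`. -/
lemma sum_weightAlpha_burnIn_le (hα : 0 < cα) (hc : 1 ≤ cα * Real.log K) (hK : 1 ≤ K) {M : ℝ}
    (hM : M = 3 * Real.exp (1 / cα)) (hcM : cα * Real.log K * M ≤ K / 2) :
    ∑ k ∈ Icc 1 (burnIn M K), weightAlpha cα K k ≤ 1 / K := by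
  have hM3 : 3 ≤ M := by
    rw [hM]; linarith [Real.add_one_le_exp (1 / cα), one_div_pos.2 hα]
  have hM0 : 0 < M := by linarith
  have hKp : (0 : ℝ) < K := by exact_mod_cast hK
  have h1 : 1 ≤ burnIn M K := Nat.one_le_ceil_iff.2 (by positivity)
  have h2 : burnIn M K ≤ K := Nat.ceil_le.2 (div_le_self hKp.le (by linarith))
  simp only [weightAlpha_eq]
  rw [sum_stepWeight_prefix _ (stepAlpha_one hc) h1 h2]
  refine (prod_one_sub_stepAlpha_le hc h2).trans ?_
  have h3 : ((burnIn M K : ℕ) : ℝ) ≤ K / M + 1 := (Nat.ceil_lt_add_one (by positivity)).le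
  set c := cα * Real.log K with hcdef
  have h4 : c ≤ K / M := by
    rw [le_div_iff₀ hM0]; linarith
  have h5 : M / 3 ≤ (K + c) / (burnIn M K + c) := by
    rw [div_le_div_iff₀ (by norm_num) (by positivity)]
    have : M * (burnIn M K + c) ≤ M * (K / M + K / M + K / M) :=
      mul_le_mul_of_nonneg_left (by linarith) hM0.le
    have e : M * (K / M + K / M + K / M) = 3 * K := by field_simp; ring
    nlinarith
  have h6 : 1 / cα ≤ Real.log ((K + c) / (burnIn M K + c)) := by
    have := Real.log_le_log (by positivity) h5
    rwa [hM, mul_div_cancel_left₀ _ (by norm_num : (3 : ℝ) ≠ 0), Real.log_exp, ← hM] at this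
  have h7 : Real.log K ≤ c * Real.log ((K + c) / (burnIn M K + c)) := by
    refine le_trans (le_of_eq ?_) (mul_le_mul_of_nonneg_left h6 (by linarith))
    rw [hcdef]; field_simp
  refine (Real.exp_le_exp.2 (neg_le_neg h7)).trans (le_of_eq ?_)
  rw [Real.exp_neg, Real.exp_log hKp, one_div]

lemma stepAlpha_le_of_burnIn_lt (hc : 1 ≤ cα * Real.log K) (hK : 1 ≤ K) {M : ℝ} (hM : 0 < M)
    {k : ℕ} (hk : burnIn M K < k) : stepAlpha cα K k ≤ cα * Real.log K * M / K := by
  have hKp : (0 : ℝ) < K := by exact_mod_cast hK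
  have h1 : (K : ℝ) / M ≤ k := (Nat.le_ceil _).trans (by exact_mod_cast hk.le)
  refine (stepAlpha_le_div hc (by omega)).trans ?_
  have hk0 : (0 : ℝ) < k := lt_of_lt_of_le (by positivity) h1
  rw [div_le_div_iff₀ hk0 hKp]
  rw [div_le_iff₀ hM] at h1
  nlinarith

variable {m S : ℕ} {A : Fin m → ℕ} (G : Game m S A)

lemma stepEta_pos (hc : 1 ≤ cα * Real.log K) (hlog : 0 < Real.log K) (hL : 0 < G.effHorizon)
    {k : ℕ} (hk : 1 ≤ k) : 0 < G.stepEta cα K k :=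
  Real.sqrt_pos.2 (div_pos hlog (mul_pos (stepAlpha_pos hc hk) hL))

lemma one_sub_mul_stepEta_le (hc : 1 ≤ cα * Real.log K) (hlog : 0 < Real.log K)
    (hL : 0 < G.effHorizon) {k : ℕ} (hk : 1 ≤ k) :
    (1 - stepAlpha cα K k) * G.stepEta cα K (k + 1) ≤ G.stepEta cα K k := by
  have hk1 : (1 : ℝ) ≤ k := by exact_mod_cast hk
  have h1 := stepAlpha_le_one hc hk
  rw [Game.stepEta, Game.stepEta]
  refine Real.le_sqrt_of_sq_le ?_
  rw [mul_pow, Real.sq_sqrt (div_nonneg hlog.le (mul_nonneg (stepAlpha_pos hc (by omega)).le hL.le))]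
  simp only [stepAlpha]
  push_cast
  set c := cα * Real.log K
  set n : ℝ := k - 1 with hn
  have hn0 : 0 ≤ n := by linarith
  have e : (k : ℝ) = n + 1 := by linarith
  have hnc : 0 < n + c := by linarith
  rw [e, one_sub_div hnc.ne']
  have e1 : ((n + c - c) / (n + c)) ^ 2 * (Real.log K / (c / (n + 1 + 1 - 1 + c) * G.effHorizon))
      = Real.log K / (c * G.effHorizon) * (n ^ 2 * (n + 1 + c) / (n + c) ^ 2) := by
    field_simp; ring
  have e2 : Real.log K / (c / (n + c) * G.effHorizon)
      = Real.log K / (c * G.effHorizon) * (n + c) := by field_simp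
  rw [e1, e2]
  refine mul_le_mul_of_nonneg_left ?_ (by positivity)
  -- With `n = k - 1` the claim has become `n² (n + 1 + c) ≤ (n + c)³`, which holds as soon as `c ≥
  -- 1/2`.
  rw [div_le_iff₀ (by positivity)]
  have h2 : 0 ≤ n ^ 2 * (2 * c - 1) := mul_nonneg (sq_nonneg _) (by linarith)
  have h3 : 0 ≤ n * c ^ 2 := by positivity
  have h4 : 0 ≤ c ^ 3 := by positivity
  nlinarith

/-- After the burn-in `α_k` is `O(log K / K)` and at most `1/2`, so the variance coefficient of the
regret is at most `2 √(α_k log K / L)`. The constant found here is the lower bound required of `cb`.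
-/
lemma stepEta_mul_div_le (hα : 0 < cα) (hc : 1 ≤ cα * Real.log K) (hK : 1 ≤ K)
    (hlog : 0 < Real.log K) (hL : 0 < G.effHorizon) {M ι : ℝ} (hM : 0 < M)
    (hcM : cα * Real.log K * M ≤ K / 2) (hι : Real.log K ≤ ι) (hι2 : 1 / 2 ≤ ι) {k : ℕ}
    (hk : burnIn M K < k) :
    G.stepEta cα K k * stepAlpha cα K k / (1 - stepAlpha cα K k)
      ≤ 4 * Real.sqrt (cα * M) * Real.sqrt (ι ^ 3 / (K * G.effHorizon)) := by
  have hKp : (0 : ℝ) < K := by exact_mod_cast hK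
  have hk1 : 1 ≤ k := by omega
  have ha := stepAlpha_le_of_burnIn_lt hc hK hM hk
  have hap := stepAlpha_pos hc hk1
  have ha2 : stepAlpha cα K k ≤ 1 / 2 := by
    refine ha.trans ?_
    rw [div_le_iff₀ hKp]; linarith
  set a := stepAlpha cα K k
  set L := G.effHorizon
  have h1 : G.stepEta cα K k * a = Real.sqrt (a * Real.log K / L) := by
    calc G.stepEta cα K k * a = Real.sqrt (Real.log K / (a * L)) * Real.sqrt (a ^ 2) := by
          rw [Real.sqrt_sq hap.le]; rfl
      _ = Real.sqrt (Real.log K / (a * L) * a ^ 2) := (Real.sqrt_mul (by positivity) _).symm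
      _ = _ := by congr 1; field_simp
  have h2 : G.stepEta cα K k * a / (1 - a) ≤ 2 * (G.stepEta cα K k * a) := by
    rw [div_le_iff₀ (by linarith)]
    have : 0 ≤ G.stepEta cα K k * a := mul_nonneg (Real.sqrt_nonneg _) hap.le
    nlinarith
  refine h2.trans ?_
  rw [h1]
  have h3 : Real.sqrt (a * Real.log K / L) ≤ Real.sqrt (2 ^ 2 * (cα * M * (ι ^ 3 / (K * L)))) := by
    refine Real.sqrt_le_sqrt ?_
    have h4 : a * Real.log K / L ≤ cα * Real.log K * M / K * Real.log K / L := by gcongr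
    refine h4.trans ?_
    have h5 : Real.log K ^ 2 ≤ 2 ^ 2 * ι ^ 3 := by nlinarith [sq_nonneg ι, mul_self_nonneg (ι - Real.log K)]
    calc cα * Real.log K * M / K * Real.log K / L
        = cα * M / (K * L) * Real.log K ^ 2 := by field_simp
      _ ≤ cα * M / (K * L) * (2 ^ 2 * ι ^ 3) := by gcongr
      _ = _ := by field_simp
  rw [Real.sqrt_mul (by norm_num), Real.sqrt_sq (by norm_num), Real.sqrt_mul (by positivity)] at h3
  linarith

/-- The entropy term of the regret, with `a` the logarithm of the number of actions, has the order
of the error of one step. -/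
lemma log_div_stepEta_le (hα : 0 < cα) (hK : 1 ≤ K)
    (hlog : 0 < Real.log K) (hL : 0 < G.effHorizon) {ι a : ℝ} (ha : a ≤ ι) (hι2 : 1 / 2 ≤ ι) :
    a / G.stepEta cα K (K + 1)
      ≤ 2 * Real.sqrt cα * (Real.sqrt (ι ^ 3 / (K * G.effHorizon)) * G.effHorizon) := by
  have hKp : (0 : ℝ) < K := by exact_mod_cast hK
  set L := G.effHorizon
  have hη : Real.sqrt (K / (cα * L)) ≤ G.stepEta cα K (K + 1) := by
    refine Real.sqrt_le_sqrt ?_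
    simp only [stepAlpha]
    push_cast
    change (K : ℝ) / (cα * L) ≤ Real.log K / (cα * Real.log K / (K + 1 - 1 + cα * Real.log K) * L)
    have : Real.log K / (cα * Real.log K / (K + 1 - 1 + cα * Real.log K) * L)
      = (K + cα * Real.log K) / (cα * L) := by
        have : (0:ℝ) < K + 1 - 1 + cα * Real.log K := by
          have := mul_pos hα hlog
          linarith
        field_simp; ring
    rw [this]
    have := mul_pos hα hlog
    gcongr
    linarith
  have hs : 0 < Real.sqrt (K / (cα * L)) := Real.sqrt_pos.2 (by positivity)
  rw [div_le_iff₀ (hs.trans_le hη)]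
  refine ha.trans ?_
  calc ι ≤ 2 * Real.sqrt (ι ^ 3) := by
        have : Real.sqrt (ι ^ 2) ≤ Real.sqrt (2 ^ 2 * ι ^ 3) := Real.sqrt_le_sqrt (by nlinarith [sq_nonneg ι])
        rwa [Real.sqrt_sq (by linarith), Real.sqrt_mul (by norm_num), Real.sqrt_sq (by norm_num)] at this
    _ = 2 * Real.sqrt cα * (Real.sqrt (ι ^ 3 / (K * L)) * L) * Real.sqrt (K / (cα * L)) := by
        have e : Real.sqrt cα * Real.sqrt (ι ^ 3 / (K * L)) * Real.sqrt (K / (cα * L))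
            = Real.sqrt (ι ^ 3) / L := by
          have hι3 : 0 ≤ ι ^ 3 := by positivity
          rw [← Real.sqrt_mul hα.le, ← Real.sqrt_mul (by positivity)]
          rw [show cα * (ι ^ 3 / (K * L)) * (K / (cα * L)) = ι ^ 3 / L ^ 2 by field_simp,
            Real.sqrt_div hι3, Real.sqrt_sq hL.le]
        have : 2 * Real.sqrt cα * (Real.sqrt (ι ^ 3 / (K * L)) * L) * Real.sqrt (K / (cα * L))
          = 2 * L * (Real.sqrt cα * Real.sqrt (ι ^ 3 / (K * L)) * Real.sqrt (K / (cα * L))) := by ring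
        rw [this, e]
        field_simp
    _ ≤ _ := by
        refine mul_le_mul_of_nonneg_left hη (by positivity)

end stepSizes
end RobustMG
end

noncomputable section
namespace RobustMG
open Finset

/-! ### Robust values through discounted games -/

section values
variable {m S : ℕ} {A : Fin m → ℕ} (G : Game m S A)

/-- The reward of player `i` plus the discounted nominal expectation of `W` at the next state. -/
def Game.discGain (i : Fin m) (h : ℕ) (s : Fin S) (W : Fin S → ℝ) (a : Joint A) : ℝ :=
  G.r i h s a + (1 - G.R) * ∑ s', G.P0 h s a s' * W s'

/-- The discounted value of player `i` with `n` steps to go when all players follow `π`. -/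
def Game.policyDisc (G : Game m S A) (π : Profile S A) (i : Fin m) : ℕ → Fin S → ℝ
  | 0, _ => 0
  | n + 1, s => prodMean (fun j => π j (G.H - n) s)
      (G.discGain i (G.H - n) s (G.policyDisc π i n))

/-- The optimal discounted value of player `i` with `n` steps to go when the other players
follow `π`. -/
def Game.bestDisc (G : Game m S A) (π : Profile S A) (i : Fin m) : ℕ → Fin S → ℝ
  | 0, _ => 0
  | n + 1, s => ⨆ ai : Fin (A i),
      prodMean (Function.update (fun j => π j (G.H - n) s) i (Pi.single ai 1))
        (G.discGain i (G.H - n) s (G.bestDisc π i n))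

/-- A family of joint action weights is a Markov policy on the steps `1, …, H`. -/
def Game.IsPolicy (π : ℕ → Fin S → Joint A → ℝ) : Prop :=
  ∀ h ∈ Icc 1 G.H, ∀ s, (∀ a, 0 ≤ π h s a) ∧ ∑ a, π h s a = 1

variable {G}

lemma Game.discGain_mono (hR1 : G.R ≤ 1) (i : Fin m) (h : ℕ) (s : Fin S) {W W' : Fin S → ℝ}
    (hW : ∀ s, W s ≤ W' s) (a : Joint A) : G.discGain i h s W a ≤ G.discGain i h s W' a := by
  refine add_le_add le_rfl (mul_le_mul_of_nonneg_left ?_ (by linarith))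
  exact Finset.sum_le_sum fun s' _ =>
    mul_le_mul_of_nonneg_left (hW s') (simplex_nonneg (G.P0 h s a) s')

lemma finite_iInf_le (W : Fin S → ℝ) (s : Fin S) : ⨅ s', W s' ≤ W s :=
  ciInf_le (Set.finite_range W).bddBelow s

lemma Game.uncertaintySet_nonempty : Nonempty G.uncertaintySet :=
  ⟨⟨G.P0, fun h s a => ⟨G.P0 h s a, fun s' => by ring⟩⟩⟩

/-- The components of `π` are distributions at the steps `1, …, H`. -/
def Game.IsProfile (G : Game m S A) (π : Profile S A) : Prop :=
  ∀ i, ∀ h ∈ Icc 1 G.H, ∀ s, π i h s ∈ stdSimplex ℝ (Fin (A i))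

lemma Game.IsProfile.isPolicy {π : Profile S A} (hπ : G.IsProfile π) :
    G.IsPolicy (prodPolicy π) := fun h hh s =>
  ⟨fun _ => Finset.prod_nonneg fun i _ => (hπ i h hh s).1 _, by
    simp only [prodPolicy]
    rw [← Fintype.prod_sum (fun i a => π i h s a)]
    exact Finset.prod_eq_one fun i _ => (hπ i h hh s).2⟩

lemma Game.IsProfile.update {π : Profile S A} (hπ : G.IsProfile π) (i : Fin m)
    (π' : ℕ → Fin S → stdSimplex ℝ (Fin (A i))) :
    G.IsProfile (Function.update π i fun t x a => π' t x a) := by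
  intro j h hh s
  by_cases hj : j = i
  · subst hj
    rw [Function.update_self]
    exact (π' h s).2
  · rw [Function.update_of_ne hj]
    exact hπ j h hh s

/-- The robust Bellman inequality: a discounted subsolution, corrected by the worst next states,
bounds the return under every kernel of the uncertainty set from below. -/
lemma Game.le_expReturn (hR0 : 0 ≤ G.R) {π : ℕ → Fin S → Joint A → ℝ}
    (hπ : G.IsPolicy π) (i : Fin m) (W : ℕ → Fin S → ℝ) (hW0 : ∀ s, W 0 s = 0)
    (hW : ∀ n < G.H, ∀ s, W (n + 1) s ≤ ∑ a, π (G.H - n) s a * G.discGain i (G.H - n) s (W n) a)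
    {P : TransKernel S A} (hP : P ∈ G.uncertaintySet) {n : ℕ} (hn : n ≤ G.H) (s : Fin S) (g : ℝ) :
    g + (W n s + G.R * ∑ j ∈ range n, ⨅ s', W j s') ≤ G.expReturn π P i n s g := by
  induction n generalizing s g with
  | zero => simp [Game.expReturn, hW0]
  | succ n ih =>
    obtain ⟨hp0, hp1⟩ := hπ (G.H - n) (mem_Icc.2 ⟨by omega, by omega⟩) s
    set h := G.H - n with hh
    set T := G.R * ∑ j ∈ range n, ⨅ s', W j s' with hT
    rw [Game.expReturn, Finset.sum_range_succ, mul_add, ← hT, ← hh]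
    -- The shift `T` and the minimum do not depend on the state, so the discount does not act on
    -- them: under any kernel they pass unchanged through the expectation.
    have key : ∀ a, g + G.discGain i h s (W n) a + T + G.R * ⨅ s', W n s'
        ≤ ∑ s', P h s a s' * G.expReturn π P i n s' (g + G.r i h s a) := by
      intro a
      obtain ⟨P', hP'⟩ := hP h s a
      have h1 : ∑ s', P h s a s' * (g + G.r i h s a + (W n s' + T))
          ≤ ∑ s', P h s a s' * G.expReturn π P i n s' (g + G.r i h s a) :=
        Finset.sum_le_sum fun s' _ => mul_le_mul_of_nonneg_left (ih (by omega) s' _)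
          (simplex_nonneg _ s')
      refine le_trans ?_ h1
      have h2 : ∑ s', P h s a s' * (g + G.r i h s a + (W n s' + T))
          = g + G.r i h s a + T + ∑ s', P h s a s' * W n s' := by
        have e : ∀ s', P h s a s' * (g + G.r i h s a + (W n s' + T))
          = P h s a s' * (g + G.r i h s a + T) + P h s a s' * W n s' := fun s' => by ring
        simp only [e, Finset.sum_add_distrib, ← Finset.sum_mul, simplex_sum, one_mul]
      have h3 : ∑ s', P h s a s' * W n s'
          = (1 - G.R) * (∑ s', G.P0 h s a s' * W n s') + G.R * ∑ s', P' s' * W n s' := by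
        simp only [hP', Finset.mul_sum, ← Finset.sum_add_distrib]
        exact Finset.sum_congr rfl fun s' _ => by ring
      have h4 : ⨅ s', W n s' ≤ ∑ s', P' s' * W n s' := le_mean P' _ (finite_iInf_le _)
      rw [h2, h3, Game.discGain]
      nlinarith [mul_le_mul_of_nonneg_left h4 hR0]
    have h5 : ∑ a, π h s a * (g + G.discGain i h s (W n) a + T + G.R * ⨅ s', W n s')
        = g + (∑ a, π h s a * G.discGain i h s (W n) a) + T + G.R * ⨅ s', W n s' := by
      have e : ∀ a, π h s a * (g + G.discGain i h s (W n) a + T + G.R * ⨅ s', W n s')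
        = π h s a * (g + T + G.R * ⨅ s', W n s') + π h s a * G.discGain i h s (W n) a :=
          fun a => by ring
      simp only [e, Finset.sum_add_distrib, ← Finset.sum_mul, hp1, one_mul]
      ring
    have h6 := Finset.sum_le_sum fun a (_ : a ∈ univ) => mul_le_mul_of_nonneg_left (key a) (hp0 a)
    rw [h5] at h6
    have := hW n (by omega) s
    rw [← hh] at this
    linarith

/-- The gain is linear in the player's own mixed action, so pure actions suffice in the definition
of `bestDisc`. -/
lemma Game.prodMean_le_bestDisc (π : Profile S A) (i : Fin m) (n : ℕ) (s : Fin S)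
    {ν : Fin (A i) → ℝ} (hν : ν ∈ stdSimplex ℝ (Fin (A i))) :
    prodMean (Function.update (fun j => π j (G.H - n) s) i ν)
      (G.discGain i (G.H - n) s (G.bestDisc π i n)) ≤ G.bestDisc π i (n + 1) s := by
  rw [prodMean_update_eq_sum]
  refine mean_le ⟨ν, hν⟩ _ fun a => ?_
  exact le_ciSup (f := fun ai : Fin (A i) =>
      prodMean (Function.update (fun j => π j (G.H - n) s) i (Pi.single ai 1))
        (G.discGain i (G.H - n) s (G.bestDisc π i n))) (Set.finite_range _).bddAbove a

lemma Game.le_robustValue (hR0 : 0 ≤ G.R) {π : Profile S A} (hπ : G.IsProfile π)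
    (i : Fin m) (s : Fin S) :
    G.policyDisc π i G.H s + G.R * ∑ j ∈ range G.H, ⨅ s', G.policyDisc π i j s'
      ≤ G.robustValue (prodPolicy π) i 1 s := by
  have := G.uncertaintySet_nonempty
  refine le_ciInf fun P => ?_
  have h := Game.le_expReturn hR0 hπ.isPolicy i (G.policyDisc π i) (fun _ => rfl)
    (fun n _ s => le_rfl) P.2 le_rfl s 0
  simpa [Game.value] using h

lemma Game.policyDisc_le_bestDisc (hR1 : G.R ≤ 1) {π : Profile S A} (hπ : G.IsProfile π)
    (i : Fin m) {n : ℕ} (hn : n ≤ G.H) (s : Fin S) :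
    G.policyDisc π i n s ≤ G.bestDisc π i n s := by
  induction n generalizing s with
  | zero => rfl
  | succ n ih =>
    have hmem : G.H - n ∈ Icc 1 G.H := mem_Icc.2 ⟨by omega, by omega⟩
    refine le_trans ?_ (G.prodMean_le_bestDisc π i n s (hπ i (G.H - n) hmem s))
    rw [Function.update_eq_self i (fun j => π j (G.H - n) s)]
    exact prodMean_mono _ (fun j => (hπ j _ hmem s).1)
      (Game.discGain_mono hR1 i _ s fun s => ih (by omega) s)

variable [NeZero S]

lemma exists_eq_finite_iInf (W : Fin S → ℝ) : ∃ s, W s = ⨅ s', W s' :=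
  exists_eq_ciInf_of_finite

/-- A discounted supersolution bounds the return under some kernel of the uncertainty set from
above: the contamination moves to a state minimizing the supersolution. -/
lemma Game.exists_expReturn_le (hR0 : 0 ≤ G.R) (hR1 : G.R ≤ 1) (i : Fin m)
    (W : ℕ → Fin S → ℝ) (hW0 : ∀ s, W 0 s = 0) :
    ∃ P ∈ G.uncertaintySet, ∀ π : ℕ → Fin S → Joint A → ℝ, G.IsPolicy π →
      (∀ n < G.H, ∀ s, ∑ a, π (G.H - n) s a * G.discGain i (G.H - n) s (W n) a ≤ W (n + 1) s) →
      ∀ n ≤ G.H, ∀ s g,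
        G.expReturn π P i n s g ≤ g + (W n s + G.R * ∑ j ∈ range n, ⨅ s', W j s') := by
  choose t ht using fun n => exists_eq_finite_iInf (W n)
  -- After step `h` there are `H - h` steps to go, hence the index of the minimizer. The kernel
  -- depends on `W` alone and not on the policy.
  let P : TransKernel S A := fun h s a =>
    ⟨fun s' => (1 - G.R) * G.P0 h s a s' + G.R * (Pi.single (t (G.H - h)) 1 : Fin S → ℝ) s',
      fun s' => add_nonneg (mul_nonneg (by linarith) (simplex_nonneg _ s'))
        (mul_nonneg hR0 (by rw [Pi.single_apply]; split_ifs <;> norm_num)), by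
        rw [Finset.sum_add_distrib, ← Finset.mul_sum, ← Finset.mul_sum, simplex_sum]
        simp⟩
  have hPv : ∀ h s a s', P h s a s'
      = (1 - G.R) * G.P0 h s a s' + G.R * (Pi.single (t (G.H - h)) 1 : Fin S → ℝ) s' :=
    fun h s a s' => rfl
  refine ⟨P, fun h s a => ⟨⟨Pi.single (t (G.H - h)) 1, single_mem_stdSimplex ℝ _⟩,
    fun s' => rfl⟩, fun π hπ hW n hn s g => ?_⟩
  induction n generalizing s g with
  | zero => simp [Game.expReturn, hW0]
  | succ n ih =>
    obtain ⟨hp0, hp1⟩ := hπ (G.H - n) (mem_Icc.2 ⟨by omega, by omega⟩) s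
    have hHn : G.H - (G.H - n) = n := by omega
    set h := G.H - n with hh
    set T := G.R * ∑ j ∈ range n, ⨅ s', W j s' with hT
    rw [Game.expReturn, Finset.sum_range_succ, mul_add, ← hT, ← hh]
    have key : ∀ a, ∑ s', P h s a s' * G.expReturn π P i n s' (g + G.r i h s a)
        ≤ g + G.discGain i h s (W n) a + T + G.R * ⨅ s', W n s' := by
      intro a
      have h1 : ∑ s', P h s a s' * G.expReturn π P i n s' (g + G.r i h s a)
          ≤ ∑ s', P h s a s' * (g + G.r i h s a + (W n s' + T)) :=
        Finset.sum_le_sum fun s' _ => mul_le_mul_of_nonneg_left (ih (by omega) s' _)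
          (simplex_nonneg _ s')
      refine h1.trans (le_of_eq ?_)
      have h2 : ∑ s', P h s a s' * (g + G.r i h s a + (W n s' + T))
          = g + G.r i h s a + T + ∑ s', P h s a s' * W n s' := by
        have e : ∀ s', P h s a s' * (g + G.r i h s a + (W n s' + T))
          = P h s a s' * (g + G.r i h s a + T) + P h s a s' * W n s' := fun s' => by ring
        simp only [e, Finset.sum_add_distrib, ← Finset.sum_mul, simplex_sum, one_mul]
      have h3 : ∑ s', P h s a s' * W n s'
          = (1 - G.R) * (∑ s', G.P0 h s a s' * W n s') + G.R * W n (t n) := by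
        simp only [hPv, hHn, add_mul, Finset.sum_add_distrib, Finset.mul_sum, mul_assoc]
        congr 1
        rw [Finset.sum_eq_single (t n)]
        · simp
        · intro b _ hb
          simp [Pi.single_eq_of_ne hb]
        · simp
      rw [h2, h3, ht, Game.discGain]
      ring
    have h5 : ∑ a, π h s a * (g + G.discGain i h s (W n) a + T + G.R * ⨅ s', W n s')
        = g + (∑ a, π h s a * G.discGain i h s (W n) a) + T + G.R * ⨅ s', W n s' := by
      have e : ∀ a, π h s a * (g + G.discGain i h s (W n) a + T + G.R * ⨅ s', W n s')
        = π h s a * (g + T + G.R * ⨅ s', W n s') + π h s a * G.discGain i h s (W n) a :=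
          fun a => by ring
      simp only [e, Finset.sum_add_distrib, ← Finset.sum_mul, hp1, one_mul]
      ring
    have h6 := Finset.sum_le_sum fun a (_ : a ∈ univ) => mul_le_mul_of_nonneg_left (key a) (hp0 a)
    rw [h5] at h6
    have := hW n (by omega) s
    rw [← hh] at this
    linarith

variable [∀ i, NeZero (A i)]

/-- `bestDisc` is a supersolution for every deviation of player `i`, so the kernel attached to it
bounds the robust value of each deviation. -/
lemma Game.bestResponseValue_le (hR0 : 0 ≤ G.R) (hR1 : G.R ≤ 1) {π : Profile S A}
    (hπ : G.IsProfile π) (i : Fin m) (s : Fin S) :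
    G.bestResponseValue π i 1 s
      ≤ G.bestDisc π i G.H s + G.R * ∑ j ∈ range G.H, ⨅ s', G.bestDisc π i j s' := by
  have : Nonempty (stdSimplex ℝ (Fin (A i))) := ⟨⟨_, single_mem_stdSimplex ℝ (0 : Fin (A i))⟩⟩
  refine ciSup_le fun π' => ?_
  set π₁ := Function.update π i fun t x a => π' t x a with hπ₁
  have hprof : G.IsProfile π₁ := hπ.update i π'
  obtain ⟨P, hP, hval⟩ := Game.exists_expReturn_le hR0 hR1 i (G.bestDisc π i) (fun _ => rfl)
  -- A real infimum is at most each of its terms only when the family is bounded below.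
  have hbdd : BddBelow (Set.range fun P : G.uncertaintySet => G.value (prodPolicy π₁) P.1 i 1 s) := by
    refine ⟨G.policyDisc π₁ i G.H s + G.R * ∑ j ∈ range G.H, ⨅ s', G.policyDisc π₁ i j s', ?_⟩
    rintro _ ⟨P, rfl⟩
    have h := Game.le_expReturn hR0 hprof.isPolicy i (G.policyDisc π₁ i) (fun _ => rfl)
      (fun n _ s => le_rfl) P.2 le_rfl s 0
    simpa [Game.value] using h
  refine (ciInf_le hbdd ⟨P, hP⟩).trans ?_
  have h := hval (prodPolicy π₁) hprof.isPolicy (fun n hn s => ?_) G.H le_rfl s 0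
  · simpa [Game.value] using h
  · have h2 := G.prodMean_le_bestDisc π i n s (π' (G.H - n) s).2
    refine le_trans (le_of_eq ?_) h2
    refine Finset.sum_congr rfl fun a _ => ?_
    congr 1
    rw [prod_update_apply, prodPolicy, ← Finset.mul_prod_erase _ _ (mem_univ i), hπ₁,
      Function.update_self]
    congr 1
    exact Finset.prod_congr rfl fun j hj => by
      rw [Function.update_of_ne (Finset.ne_of_mem_erase hj)]

end values

/-! ### The equilibrium gap in a zero-sum game -/

section zeroSum
variable {S : ℕ} {A : Fin 2 → ℕ} {G : Game 2 S A}

/-- Both discounted values use the nominal kernel, so opposite rewards give opposite values; the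
robust values need not have this property. -/
lemma Game.IsZeroSum.sum_policyDisc (hG : G.IsZeroSum) (π : Profile S A) {n : ℕ} (hn : n ≤ G.H)
    (s : Fin S) : G.policyDisc π 0 n s + G.policyDisc π 1 n s = 0 := by
  induction n generalizing s with
  | zero => simp [Game.policyDisc]
  | succ n ih =>
    have hmem : G.H - n ∈ Icc 1 G.H := mem_Icc.2 ⟨by omega, by omega⟩
    rw [Game.policyDisc, Game.policyDisc, ← prodMean_add]
    refine Finset.sum_eq_zero fun a _ => mul_eq_zero_of_right _ ?_
    simp only [Game.discGain, (hG _ hmem s a).2]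
    have : ∑ s', G.P0 (G.H - n) s a s' * G.policyDisc π 0 n s'
        + ∑ s', G.P0 (G.H - n) s a s' * G.policyDisc π 1 n s' = 0 := by
      rw [← Finset.sum_add_distrib]
      refine Finset.sum_eq_zero fun s' _ => ?_
      rw [← mul_add, ih (by omega), mul_zero]
    linear_combination (1 - G.R) * this

variable [NeZero S] [∀ i, NeZero (A i)]

/-- In a zero-sum game the equilibrium gap is controlled by the sums of the two players' optimal
discounted values. -/
lemma Game.IsZeroSum.gapNE_le (hG : G.IsZeroSum) (hR0 : 0 ≤ G.R) (hR1 : G.R ≤ 1)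
    {π : Profile S A} (hπ : G.IsProfile π) (e : ℕ → ℝ)
    (he : ∀ n ≤ G.H, ∀ s, G.bestDisc π 0 n s + G.bestDisc π 1 n s ≤ e n) :
    G.gapNE π ≤ e G.H + G.R * ∑ j ∈ range G.H, e j := by
  -- The two players' losses against a best response are nonnegative and, by the zero-sum property,
  -- add up to the sum of the optimal values; so each is at most this sum.
  have hdiff : ∀ i : Fin 2, ∀ n ≤ G.H, ∀ s,
      G.bestDisc π i n s - G.policyDisc π i n s ≤ e n := by
    intro i n hn s
    have h0 := Game.policyDisc_le_bestDisc hR1 hπ 0 hn s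
    have h1 := Game.policyDisc_le_bestDisc hR1 hπ 1 hn s
    have hz := hG.sum_policyDisc π hn s
    have := he n hn s
    fin_cases i <;> simp only [Fin.zero_eta, Fin.mk_one] <;> linarith
  refine ciSup_le fun s => ciSup_le fun i => ?_
  have h1 := Game.bestResponseValue_le hR0 hR1 hπ i s
  have h2 := Game.le_robustValue hR0 hπ i s
  have h3 : ∀ j ∈ range G.H, ⨅ s', G.bestDisc π i j s' ≤ (⨅ s', G.policyDisc π i j s') + e j := by
    intro j hj
    obtain ⟨t, ht⟩ := exists_eq_finite_iInf (G.policyDisc π i j)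
    have := finite_iInf_le (G.bestDisc π i j) t
    have := hdiff i j (mem_range.1 hj).le t
    linarith
  have h4 := Finset.sum_le_sum h3
  rw [Finset.sum_add_distrib] at h4
  have h5 := hdiff i G.H le_rfl s
  nlinarith [mul_le_mul_of_nonneg_left h4 hR0]

end zeroSum
end RobustMG
end

noncomputable section
namespace RobustMG
open Finset
open scoped ENNReal

/-! ### Concentration of the data of one step -/

section concentration
variable {m S : ℕ} {A : Fin m → ℕ} (G : Game m S A)

/-- The sampled gain of player `i`, centred by the least next value. -/
def Game.centredGain (h : ℕ) (V : Fin m → Fin S → ℝ) (i : Fin m) (s : Fin S)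
    (z : Joint A × Fin S) : ℝ :=
  G.r i h s z.1 + (1 - G.R) * (V i z.2 - ⨅ s', V i s')

/-- The expectation of a function of the centred gain when the actions have the product
law `μ`. -/
def Game.gainMean (h : ℕ) (V : Fin m → Fin S → ℝ) (i : Fin m) (s : Fin S) (φ : ℝ → ℝ)
    (μ : (j : Fin m) → Fin (A j) → ℝ) : ℝ :=
  prodMean μ fun a => ∑ s', G.P0 h s a s' * φ (G.centredGain h V i s (a, s'))

/-- The variance of the centred gain when the actions have the product law `μ`. -/
def Game.gainVar (h : ℕ) (V : Fin m → Fin S → ℝ) (i : Fin m) (s : Fin S)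
    (μ : (j : Fin m) → Fin (A j) → ℝ) : ℝ :=
  G.gainMean h V i s (fun y => y ^ 2) μ - G.gainMean h V i s (fun y => y) μ ^ 2

variable {G}

lemma Game.qHat_eq (h : ℕ) (V : Fin m → Fin S → ℝ) (x : Sample S A) (i : Fin m) (s : Fin S)
    (ai : Fin (A i)) :
    G.qHat h V x i s ai = G.centredGain h V i s (x i s ai) + ⨅ s', V i s' := by
  simp only [Game.qHat, Game.centredGain]; ring

lemma Game.gainMean_eq_sum (h : ℕ) (V : Fin m → Fin S → ℝ) (i : Fin m) (s : Fin S) (φ : ℝ → ℝ)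
    (μ : (j : Fin m) → Fin (A j) → ℝ) :
    G.gainMean h V i s φ μ
      = ∑ a, μ i a * G.gainMean h V i s φ (Function.update μ i (Pi.single a 1)) :=
  prodMean_eq_sum μ i _

/-- Three marginalizations, over players, states and own actions, isolate one entry of the table. -/
lemma Game.rexp_sampleLaw (h : ℕ) (p : (i : Fin m) → Fin S → stdSimplex ℝ (Fin (A i)))
    (i : Fin m) (s : Fin S) (ai : Fin (A i)) (f : Joint A × Fin S → ℝ) :
    rexp (G.sampleLaw h p) (fun y => f (y i s ai))
      = prodMean (Function.update (fun j a => p j s a) i (Pi.single ai 1))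
          fun a => ∑ s', G.P0 h s a s' * f (a, s') := by
  refine (rexp_indepPMF_apply (X := fun i : Fin m => Fin S → Fin (A i) → Joint A × Fin S) _ i
    (fun z => f (z s ai))).trans ?_
  refine (rexp_indepPMF_apply (X := fun _ : Fin S => Fin (A i) → Joint A × Fin S) _ s
    (fun z => f (z ai))).trans ?_
  refine (rexp_indepPMF_apply (X := fun _ : Fin (A i) => Joint A × Fin S) _ ai f).trans ?_
  rw [rexp_bind, rexp_indepPMF]
  simp only [rexp_map, rexp_simplexPMF]
  congr 1
  funext j a
  by_cases hj : j = i
  · subst hj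
    simp only [Function.update_self, PMF.pure_apply, Pi.single_apply]
    split_ifs <;> simp
  · simp only [Function.update_of_ne hj, simplexPMF_toReal]

lemma Game.rexp_gain (h : ℕ) (V : Fin m → Fin S → ℝ)
    (p : (i : Fin m) → Fin S → stdSimplex ℝ (Fin (A i)))
    (i : Fin m) (s : Fin S) (ai : Fin (A i)) (φ : ℝ → ℝ) :
    rexp (G.sampleLaw h p) (fun y => φ (G.centredGain h V i s (y i s ai)))
      = G.gainMean h V i s φ (Function.update (fun j a => p j s a) i (Pi.single ai 1)) :=
  G.rexp_sampleLaw h p i s ai fun z => φ (G.centredGain h V i s z)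

lemma Game.rexp_mean_gain (h : ℕ) (V : Fin m → Fin S → ℝ)
    (p : (i : Fin m) → Fin S → stdSimplex ℝ (Fin (A i)))
    (i : Fin m) (s : Fin S) (φ : ℝ → ℝ) :
    rexp (G.sampleLaw h p) (fun y => mean (p i s) fun ai => φ (G.centredGain h V i s (y i s ai)))
      = G.gainMean h V i s φ (fun j a => p j s a) := by
  simp only [mean]
  rw [rexp_sum, G.gainMean_eq_sum]
  refine Finset.sum_congr rfl fun a _ => ?_
  rw [rexp_mul_left, Game.rexp_gain]

/-- Centring at the true mean makes the quantity quadratic with a known expectation. It dominates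
both the squared error of the played mean and the empirical variance. -/
lemma Game.rexp_mean_gain_sub_sq (h : ℕ) (V : Fin m → Fin S → ℝ)
    (p : (i : Fin m) → Fin S → stdSimplex ℝ (Fin (A i))) (i : Fin m) (s : Fin S) :
    rexp (G.sampleLaw h p) (fun y => mean (p i s) fun ai => (G.centredGain h V i s (y i s ai)
      - G.gainMean h V i s (fun y => y) (fun j a => p j s a)) ^ 2)
      = G.gainVar h V i s (fun j a => p j s a) := by
  set c := G.gainMean h V i s (fun y => y) (fun j a => p j s a) with hc
  have e : (fun y : Sample S A => mean (p i s) fun ai => (G.centredGain h V i s (y i s ai) - c) ^ 2)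
      = fun y => mean (p i s) (fun ai => G.centredGain h V i s (y i s ai) ^ 2)
        - 2 * c * mean (p i s) (fun ai => G.centredGain h V i s (y i s ai)) + c ^ 2 := by
    funext y
    rw [mean_sub_sq]
  rw [e, rexp_add, rexp_sub, rexp_mul_left, rexp_const, Game.rexp_mean_gain h V p i s (fun y => y ^ 2),
    Game.rexp_mean_gain h V p i s (fun y => y), Game.gainVar, ← hc]
  ring

lemma Game.QHat_congr (cα : ℝ) (K h : ℕ) (V : Fin m → Fin S → ℝ) {x x' : ℕ → Sample S A}
    (i : Fin m) (s : Fin S) {k : ℕ} (hx : ∀ j ∈ Icc 1 k, x j = x' j) :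
    G.QHat cα K h V x i s k = G.QHat cα K h V x' i s k := by
  induction k with
  | zero => rfl
  | succ k ih =>
    funext ai
    rw [Game.QHat, Game.QHat, hx (k + 1) (by simp), ih fun j hj => hx j (by
      simp only [mem_Icc] at hj ⊢; omega)]

lemma Game.gainMean_le {h : ℕ} {V : Fin m → Fin S → ℝ} {lo D : ℝ} (i : Fin m) (s : Fin S)
    {μ : (j : Fin m) → Fin (A j) → ℝ}
    (hμ : ∀ j, μ j ∈ stdSimplex ℝ (Fin (A j)))
    (hhi : ∀ z, G.centredGain h V i s z ≤ lo + D) :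
    G.gainMean h V i s (fun y => y) μ ≤ lo + D := by
  refine (prodMean_mono μ (fun j => (hμ j).1) fun a => ?_).trans
    (le_of_eq (prodMean_const μ (fun j => (hμ j).2) (lo + D)))
  exact mean_le (G.P0 h s a) _ fun s' => hhi _

lemma Game.le_gainMean {h : ℕ} {V : Fin m → Fin S → ℝ} {lo : ℝ} (i : Fin m) (s : Fin S)
    {μ : (j : Fin m) → Fin (A j) → ℝ}
    (hμ : ∀ j, μ j ∈ stdSimplex ℝ (Fin (A j)))
    (hlo : ∀ z, lo ≤ G.centredGain h V i s z) :
    lo ≤ G.gainMean h V i s (fun y => y) μ := by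
  refine (le_of_eq (prodMean_const μ (fun j => (hμ j).2) lo).symm).trans
    (prodMean_mono μ (fun j => (hμ j).1) fun a => ?_)
  exact le_mean (G.P0 h s a) _ fun s' => hlo _

lemma update_single_mem {S : ℕ} (p : (i : Fin m) → Fin S → stdSimplex ℝ (Fin (A i)))
    (i : Fin m) (s : Fin S) (ai : Fin (A i)) (j : Fin m) :
    Function.update (fun j a => p j s a) i (Pi.single ai 1) j ∈ stdSimplex ℝ (Fin (A j)) := by
  by_cases hj : j = i
  · subst hj
    rw [Function.update_self]
    exact single_mem_stdSimplex ℝ ai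
  · rw [Function.update_of_ne hj]
    exact (p j s).2

variable [∀ i, NeZero (A i)]

/-- Predictability: round `k` is played on the basis of earlier data only, which makes the exponents
below adapted. -/
lemma Game.iterPolicy_congr (cα : ℝ) (K h : ℕ) (V : Fin m → Fin S → ℝ) {x x' : ℕ → Sample S A}
    {k : ℕ} (hx : ∀ j < k, x j = x' j) :
    G.iterPolicy cα K h V x k = G.iterPolicy cα K h V x' k := by
  funext i s
  rw [Game.iterPolicy, Game.iterPolicy, G.QHat_congr cα K h V i s (k := k - 1) fun j hj => hx j (by
    simp only [mem_Icc] at hj; omega)]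

/-- The exponent controlling the estimation error of the gain of one action. -/
def Game.actionExponent (G : Game m S A) (cα : ℝ) (K h : ℕ) (V : Fin m → Fin S → ℝ) (t : ℝ)
    (i : Fin m) (s : Fin S) (ai : Fin (A i)) (k : ℕ) (x : ℕ → Sample S A) (y : Sample S A) : ℝ :=
  t * weightAlpha cα K k * (G.gainMean h V i s (fun y => y)
      (Function.update (fun j a => G.iterPolicy cα K h V x k j s a) i (Pi.single ai 1))
    - G.centredGain h V i s (y i s ai))
  - (t * weightAlpha cα K k) ^ 2 * G.gainVar h V i s
      (Function.update (fun j a => G.iterPolicy cα K h V x k j s a) i (Pi.single ai 1))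

/-- The exponent controlling the estimation error of the gain of the current policy. -/
def Game.policyExponent (G : Game m S A) (cα : ℝ) (K h : ℕ) (V : Fin m → Fin S → ℝ) (t : ℝ)
    (i : Fin m) (s : Fin S) (k : ℕ) (x : ℕ → Sample S A) (y : Sample S A) : ℝ :=
  t * weightAlpha cα K k * (mean (G.iterPolicy cα K h V x k i s)
      (fun ai => G.centredGain h V i s (y i s ai))
    - G.gainMean h V i s (fun y => y) (fun j a => G.iterPolicy cα K h V x k j s a))
  - (t * weightAlpha cα K k) ^ 2 * G.gainVar h V i s
      (fun j a => G.iterPolicy cα K h V x k j s a)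

/-- The exponent controlling the empirical variances. -/
def Game.varExponent (G : Game m S A) (cα : ℝ) (K h : ℕ) (V : Fin m → Fin S → ℝ) (τ : ℝ)
    (i : Fin m) (s : Fin S) (k : ℕ) (x : ℕ → Sample S A) (y : Sample S A) : ℝ :=
  τ * weightAlpha cα K k * var (G.iterPolicy cα K h V x k i s)
      (fun ai => G.centredGain h V i s (y i s ai))
  - 2 * (τ * weightAlpha cα K k * G.gainVar h V i s
      (fun j a => G.iterPolicy cα K h V x k j s a))

/-- The data of a step on which all empirical quantities concentrate. -/
def Game.GoodData (G : Game m S A) (cα : ℝ) (K h : ℕ) (V : Fin m → Fin S → ℝ) (t τ a : ℝ)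
    (x : ℕ → Sample S A) : Prop :=
  ∀ i s, (∀ ai, ∑ k ∈ Icc 1 K, G.actionExponent cα K h V t i s ai k x (x k) ≤ a) ∧
    ∑ k ∈ Icc 1 K, G.policyExponent cα K h V t i s k x (x k) ≤ a ∧
    ∑ k ∈ Icc 1 K, G.varExponent cα K h V τ i s k x (x k) ≤ a

variable {cα : ℝ} {K h : ℕ} {V : Fin m → Fin S → ℝ} {lo D t τ w : ℝ}

lemma Game.rexp_exp_actionExponent_le (hw0 : ∀ k ∈ Icc 1 K, 0 ≤ weightAlpha cα K k)
    (hw : ∀ k ∈ Icc 1 K, weightAlpha cα K k ≤ w) (ht : 0 ≤ t) (hD : 0 ≤ D) (htw : t * w * D ≤ 1)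
    (i : Fin m) (s : Fin S) (hlo : ∀ z, lo ≤ G.centredGain h V i s z)
    (hhi : ∀ z, G.centredGain h V i s z ≤ lo + D) (ai : Fin (A i)) {k : ℕ} (hk : k ∈ Icc 1 K)
    (x : ℕ → Sample S A) :
    rexp (G.sampleLaw h (G.iterPolicy cα K h V x k))
      (fun y => Real.exp (G.actionExponent cα K h V t i s ai k x y)) ≤ 1 := by
  set p := G.iterPolicy cα K h V x k with hp
  set c := t * weightAlpha cα K k with hc
  have hc0 : 0 ≤ c := mul_nonneg ht (hw0 k hk)
  have hcD : c * D ≤ 1 :=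
    (mul_le_mul_of_nonneg_right (mul_le_mul_of_nonneg_left (hw k hk) ht) hD).trans htw
  set μ := Function.update (fun j a => p j s a) i (Pi.single ai (1 : ℝ)) with hμ
  refine rexp_exp_sub_le_one _ _ _ (fun y => ?_) ?_ ?_
  · have h1 := Game.gainMean_le i s (update_single_mem p i s ai) hhi
    have h2 := hlo (y i s ai)
    refine le_trans (mul_le_mul_of_nonneg_left ?_ hc0) hcD
    rw [← hμ] at h1
    linarith
  · rw [rexp_mul_left, rexp_sub, rexp_const, Game.rexp_gain h V p i s ai (fun y => y), sub_self,
      mul_zero]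
  · have e : (fun y : Sample S A => (c * (G.gainMean h V i s (fun y => y) μ
        - G.centredGain h V i s (y i s ai))) ^ 2)
        = fun y => c ^ 2 * (G.centredGain h V i s (y i s ai) ^ 2
          - 2 * G.gainMean h V i s (fun y => y) μ * G.centredGain h V i s (y i s ai)
          + G.gainMean h V i s (fun y => y) μ ^ 2) := by
      funext y; ring
    rw [e, rexp_mul_left, rexp_add, rexp_sub, rexp_mul_left, rexp_const,
      Game.rexp_gain h V p i s ai (fun y => y), Game.rexp_gain h V p i s ai (fun y => y ^ 2),
      ← hμ, Game.gainVar]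
    apply le_of_eq
    ring

/-- By Jensen's inequality the variance of the played mean is at most the variance of the gain under
the joint policy. -/
lemma Game.rexp_exp_policyExponent_le (hw0 : ∀ k ∈ Icc 1 K, 0 ≤ weightAlpha cα K k)
    (hw : ∀ k ∈ Icc 1 K, weightAlpha cα K k ≤ w) (ht : 0 ≤ t) (hD : 0 ≤ D) (htw : t * w * D ≤ 1)
    (i : Fin m) (s : Fin S) (hlo : ∀ z, lo ≤ G.centredGain h V i s z)
    (hhi : ∀ z, G.centredGain h V i s z ≤ lo + D) {k : ℕ} (hk : k ∈ Icc 1 K)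
    (x : ℕ → Sample S A) :
    rexp (G.sampleLaw h (G.iterPolicy cα K h V x k))
      (fun y => Real.exp (G.policyExponent cα K h V t i s k x y)) ≤ 1 := by
  set p := G.iterPolicy cα K h V x k with hp
  set c := t * weightAlpha cα K k with hc
  have hc0 : 0 ≤ c := mul_nonneg ht (hw0 k hk)
  have hcD : c * D ≤ 1 :=
    (mul_le_mul_of_nonneg_right (mul_le_mul_of_nonneg_left (hw k hk) ht) hD).trans htw
  refine rexp_exp_sub_le_one _ _ _ (fun y => ?_) ?_ ?_
  · have h1 := Game.le_gainMean i s (fun j => (p j s).2) hlo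
    have h2 := mean_le (p i s) (fun ai => G.centredGain h V i s (y i s ai)) fun ai => hhi _
    refine le_trans (mul_le_mul_of_nonneg_left ?_ hc0) hcD
    exact (sub_le_sub h2 h1).trans (by linarith)
  · rw [rexp_mul_left, rexp_sub, rexp_const, Game.rexp_mean_gain h V p i s (fun y => y), sub_self,
      mul_zero]
  · rw [← Game.rexp_mean_gain_sub_sq, ← rexp_mul_left]
    refine rexp_mono _ fun y => ?_
    rw [mul_pow]
    refine mul_le_mul_of_nonneg_left ?_ (sq_nonneg _)
    refine le_trans (le_of_eq ?_) (sq_mean_le (p i s) _)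
    congr 1
    simp only [sub_eq_add_neg]
    rw [mean_add, mean_const]

/-- The empirical variance is at most the mean squared deviation from the true mean, whose
expectation is `gainVar`; being nonnegative and bounded, it is controlled by twice its expectation.
-/
lemma Game.rexp_exp_varExponent_le (hw0 : ∀ k ∈ Icc 1 K, 0 ≤ weightAlpha cα K k)
    (hw : ∀ k ∈ Icc 1 K, weightAlpha cα K k ≤ w) (hτ : 0 ≤ τ) (hτw : τ * w * D ^ 2 ≤ 1)
    (i : Fin m) (s : Fin S) (hlo : ∀ z, lo ≤ G.centredGain h V i s z)
    (hhi : ∀ z, G.centredGain h V i s z ≤ lo + D) {k : ℕ} (hk : k ∈ Icc 1 K)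
    (x : ℕ → Sample S A) :
    rexp (G.sampleLaw h (G.iterPolicy cα K h V x k))
      (fun y => Real.exp (G.varExponent cα K h V τ i s k x y)) ≤ 1 := by
  set p := G.iterPolicy cα K h V x k with hp
  set c := τ * weightAlpha cα K k with hc
  have hc0 : 0 ≤ c := mul_nonneg hτ (hw0 k hk)
  have hcD : c * D ^ 2 ≤ 1 :=
    (mul_le_mul_of_nonneg_right (mul_le_mul_of_nonneg_left (hw k hk) hτ) (sq_nonneg D)).trans hτw
  refine rexp_exp_sub_two_mul_le_one _ _ _ (fun y => mul_nonneg hc0 (var_nonneg _ _))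
    (fun y => ?_) ?_
  · refine le_trans (mul_le_mul_of_nonneg_left ?_ hc0) hcD
    have h1 := var_le_mul (p i s) (fun ai => G.centredGain h V i s (y i s ai))
      (fun ai => hlo _) (fun ai => hhi _)
    have h2 := mean_le (p i s) (fun ai => G.centredGain h V i s (y i s ai)) fun ai => hhi _
    have h3 := le_mean (p i s) (fun ai => G.centredGain h V i s (y i s ai)) fun ai => hlo _
    refine h1.trans ?_
    nlinarith
  · rw [← Game.rexp_mean_gain_sub_sq, ← rexp_mul_left]
    refine rexp_mono _ fun y => ?_
    exact mul_le_mul_of_nonneg_left (var_le_mean_sub_sq _ _ _) hc0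

variable [NeZero S]

/-- An adapted product of conditional exponential moments that are at most `1` has expectation at
most `1`. -/
lemma Game.pexp_roundsLaw_exp_le_one (cα : ℝ) (K h : ℕ) (V : Fin m → Fin S → ℝ)
    (z : ℕ → (ℕ → Sample S A) → Sample S A → ℝ)
    (hz : ∀ k x x', (∀ j < k, x j = x' j) → z k x = z k x') {n : ℕ}
    (h1 : ∀ k ∈ Icc 1 n, ∀ x,
      rexp (G.sampleLaw h (G.iterPolicy cα K h V x k)) (fun y => Real.exp (z k x y)) ≤ 1) :
    pexp (G.roundsLaw cα K h V n)
      (fun x => ENNReal.ofReal (Real.exp (∑ k ∈ Icc 1 n, z k x (x k)))) ≤ 1 := by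
  induction n with
  | zero => simp [pexp_const]
  | succ n ih =>
    rw [Game.roundsLaw, pexp_bind]
    refine le_trans (pexp_mono _ fun x => ?_) (ih fun k hk => h1 k (by
      simp only [mem_Icc] at hk ⊢; omega))
    rw [pexp_map]
    have e : ∀ y, ENNReal.ofReal (Real.exp (∑ k ∈ Icc 1 (n + 1),
          z k (Function.update x (n + 1) y) (Function.update x (n + 1) y k)))
        = ENNReal.ofReal (Real.exp (∑ k ∈ Icc 1 n, z k x (x k)))
          * ENNReal.ofReal (Real.exp (z (n + 1) x y)) := by
      intro y
      rw [← ENNReal.ofReal_mul (Real.exp_pos _).le, ← Real.exp_add,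
        Finset.sum_Icc_succ_top (by omega)]
      -- The exponent of round `k` sees only the rounds before `k`, so the new data enter only
      -- through the last argument of the last exponent.
      have hup : ∀ k ≤ n + 1, z k (Function.update x (n + 1) y) = z k x := fun k hk =>
        hz k _ _ fun j hj => Function.update_of_ne (by omega) _ _
      rw [hup (n + 1) le_rfl, Function.update_self]
      congr 3
      refine Finset.sum_congr rfl fun k hk => ?_
      have hk' := (mem_Icc.1 hk).2
      rw [hup k (by omega), Function.update_of_ne (by omega)]
    simp only [e]
    rw [pexp_mul_left, pexp_ofReal _ _ fun y => (Real.exp_pos _).le]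
    refine (mul_le_mul_right (ENNReal.ofReal_le_one.2 (h1 (n + 1) (by simp) x)) _).trans ?_
    rw [mul_one]

/-- Chernoff's bound for the supermartingale above. -/
lemma Game.pexp_roundsLaw_indicator_le (cα : ℝ) (K h : ℕ) (V : Fin m → Fin S → ℝ)
    (z : ℕ → (ℕ → Sample S A) → Sample S A → ℝ)
    (hz : ∀ k x x', (∀ j < k, x j = x' j) → z k x = z k x')
    (h1 : ∀ k ∈ Icc 1 K, ∀ x,
      rexp (G.sampleLaw h (G.iterPolicy cα K h V x k)) (fun y => Real.exp (z k x y)) ≤ 1) (a : ℝ) :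
    pexp (G.roundsLaw cα K h V K) ({x | a < ∑ k ∈ Icc 1 K, z k x (x k)}.indicator 1)
      ≤ ENNReal.ofReal (Real.exp (-a)) := by
  have h := Game.pexp_roundsLaw_exp_le_one cα K h V z hz h1
  calc _ ≤ pexp (G.roundsLaw cα K _ V K) (fun x => ENNReal.ofReal (Real.exp (-a))
        * ENNReal.ofReal (Real.exp (∑ k ∈ Icc 1 K, z k x (x k)))) := by
        refine pexp_mono _ fun x => ?_
        by_cases hx : a < ∑ k ∈ Icc 1 K, z k x (x k)
        · rw [Set.indicator_of_mem (by exact hx), ← ENNReal.ofReal_mul (Real.exp_pos _).le,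
            ← Real.exp_add]
          exact ENNReal.one_le_ofReal.2 (Real.one_le_exp (by linarith))
        · rw [Set.indicator_of_notMem (by exact hx)]
          exact zero_le
    _ ≤ _ := by
        rw [pexp_mul_left]
        refine (mul_le_mul_right h _).trans ?_
        rw [mul_one]

/-- The probability that the data of a step are not good. -/
lemma Game.pexp_not_goodData_le (hw0 : ∀ k ∈ Icc 1 K, 0 ≤ weightAlpha cα K k)
    (hw : ∀ k ∈ Icc 1 K, weightAlpha cα K k ≤ w) (ht : 0 ≤ t) (hτ : 0 ≤ τ) (hD : 0 ≤ D)
    (htw : t * w * D ≤ 1) (hτw : τ * w * D ^ 2 ≤ 1)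
    (hlo : ∀ i s z, lo ≤ G.centredGain h V i s z)
    (hhi : ∀ i s z, G.centredGain h V i s z ≤ lo + D) (a : ℝ) :
    pexp (G.roundsLaw cα K h V K) ({x | ¬ G.GoodData cα K h V t τ a x}.indicator 1)
      ≤ (∑ i, ∑ _s : Fin S, ((A i : ℝ≥0∞) + 2)) * ENNReal.ofReal (Real.exp (-a)) := by
  set P := G.roundsLaw cα K h V K
  set I : ((ℕ → Sample S A) → ℝ) → (ℕ → Sample S A) → ℝ≥0∞ :=
    fun f => {x | a < f x}.indicator 1 with hI
  have hcongr : ∀ k x x', (∀ j < k, x j = x' j) →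
      G.iterPolicy cα K h V x k = G.iterPolicy cα K h V x' k :=
    fun k x x' hx => G.iterPolicy_congr cα K h V hx
  have hIle : ∀ f : (ℕ → Sample S A) → ℝ, ∀ x, a < f x → (1 : ℝ≥0∞) ≤ I f x := by
    intro f x hx
    simp [hI, hx]
  have hdom : ∀ x, ({x | ¬ G.GoodData cα K h V t τ a x}.indicator 1 x : ℝ≥0∞)
      ≤ ∑ i, ∑ s, (∑ ai, I (fun x => ∑ k ∈ Icc 1 K, G.actionExponent cα K h V t i s ai k x (x k)) x
        + (I (fun x => ∑ k ∈ Icc 1 K, G.policyExponent cα K h V t i s k x (x k)) x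
        + I (fun x => ∑ k ∈ Icc 1 K, G.varExponent cα K h V τ i s k x (x k)) x)) := by
    intro x
    by_cases hx : G.GoodData cα K h V t τ a x
    · rw [Set.indicator_of_notMem (by simpa using hx)]
      exact zero_le
    · rw [Set.indicator_of_mem (by simpa using hx)]
      simp only [Game.GoodData, not_forall, not_and_or, not_le] at hx
      obtain ⟨i, s, hx⟩ := hx
      refine le_trans ?_ (Finset.single_le_sum (fun _ _ => zero_le) (mem_univ i))
      refine le_trans ?_ (Finset.single_le_sum (fun _ _ => zero_le) (mem_univ s))
      rcases hx with ⟨ai, hx⟩ | hx | hx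
      · refine le_trans ?_ le_self_add
        refine le_trans ?_ (Finset.single_le_sum (fun _ _ => zero_le) (mem_univ ai))
        exact hIle _ x hx
      · refine le_trans ?_ le_add_self
        exact (hIle _ x hx).trans le_self_add
      · refine le_trans ?_ le_add_self
        exact (hIle _ x hx).trans le_add_self
  refine (pexp_mono P hdom).trans ?_
  rw [pexp_finset_sum, Finset.sum_mul]
  refine Finset.sum_le_sum fun i _ => ?_
  rw [pexp_finset_sum, Finset.sum_mul]
  refine Finset.sum_le_sum fun s _ => ?_
  rw [pexp_add, pexp_add, pexp_finset_sum, add_mul]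
  refine add_le_add ?_ ?_
  · refine (Finset.sum_le_card_nsmul _ _ (ENNReal.ofReal (Real.exp (-a))) fun ai _ => ?_).trans ?_
    · exact Game.pexp_roundsLaw_indicator_le cα K h V (G.actionExponent cα K h V t i s ai)
        (fun k x x' hx => by funext y; simp only [Game.actionExponent, hcongr k x x' hx])
        (fun k hk x => Game.rexp_exp_actionExponent_le hw0 hw ht hD htw i s (hlo i s) (hhi i s)
          ai hk x) a
    · rw [Finset.card_univ, Fintype.card_fin, nsmul_eq_mul]
  · rw [two_mul]
    refine add_le_add ?_ ?_
    · exact Game.pexp_roundsLaw_indicator_le cα K h V (G.policyExponent cα K h V t i s)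
        (fun k x x' hx => by funext y; simp only [Game.policyExponent, hcongr k x x' hx])
        (fun k hk x => Game.rexp_exp_policyExponent_le hw0 hw ht hD htw i s (hlo i s) (hhi i s)
          hk x) a
    · exact Game.pexp_roundsLaw_indicator_le cα K h V (G.varExponent cα K h V τ i s)
        (fun k x x' hx => by funext y; simp only [Game.varExponent, hcongr k x x' hx])
        (fun k hk x => Game.rexp_exp_varExponent_le hw0 hw hτ hτw i s (hlo i s) (hhi i s)
          hk x) a

end concentration
end RobustMG
end

noncomputable section
namespace RobustMG
open Finset
open scoped ENNReal

/-! ### The parameter regime -/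

section regime
variable {m S : ℕ} {A : Fin m → ℕ}

/-- The logarithmic factor `log (K S (A_1 + ⋯ + A_m) / δ)`. -/
def logFactor {m : ℕ} (S : ℕ) (A : Fin m → ℕ) (δ : ℝ) (K : ℕ) : ℝ :=
  Real.log (K * S * (∑ j, (A j : ℝ)) / δ)

/-- The scale `√(log³ / (K L))` of the estimation errors. -/
def Game.errScale (G : Game m S A) (δ : ℝ) (K : ℕ) : ℝ :=
  Real.sqrt (logFactor S A δ K ^ 3 / (K * G.effHorizon))

/-- The coefficient of the quadratic potentials, in units of the error scale. -/
def potConst (cα cb : ℝ) : ℝ := (1 + 64 * cα) * (1 + cb) + 3 * cb + 16 + 2 * Real.sqrt cα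

/-- The relations between the parameters under which one step of the algorithm is analysed. -/
structure Game.Regime (G : Game m S A) (cα cb δ : ℝ) (K : ℕ) : Prop where
  cα_pos : 0 < cα
  one_le_K : 1 ≤ K
  one_le_L : 1 ≤ G.effHorizon
  one_le_step : 1 ≤ cα * Real.log K
  step_le : cα * Real.log K * (3 * Real.exp (1 / cα)) ≤ K / 2
  log_K_le : Real.log K ≤ logFactor S A δ K
  log_A_le : ∀ i, Real.log (A i) ≤ logFactor S A δ K
  half_le : 1 / 2 ≤ logFactor S A δ K
  le_cb : 4 * Real.sqrt (cα * (3 * Real.exp (1 / cα))) ≤ cb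
  small : potConst cα cb * G.errScale δ K * (8 * G.effHorizon) ≤ 1

namespace Game.Regime
variable {G : Game m S A} {cα cb δ : ℝ} {K : ℕ}

lemma K_pos (h : G.Regime cα cb δ K) : (0 : ℝ) < K := by exact_mod_cast h.one_le_K

lemma L_pos (h : G.Regime cα cb δ K) : 0 < G.effHorizon := by linarith [h.one_le_L]

lemma log_pos (h : G.Regime cα cb δ K) : 0 < Real.log K := by
  have h1 := h.one_le_step
  have h2 := h.cα_pos
  by_contra hn
  nlinarith [mul_nonneg h2.le (neg_nonneg.2 (not_lt.1 hn))]

lemma logFactor_pos (h : G.Regime cα cb δ K) : 0 < logFactor S A δ K := by linarith [h.half_le]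

lemma cb_nonneg (h : G.Regime cα cb δ K) : 0 ≤ cb := le_trans (by positivity) h.le_cb

lemma errScale_pos (h : G.Regime cα cb δ K) : 0 < G.errScale δ K :=
  Real.sqrt_pos.2 (div_pos (pow_pos h.logFactor_pos 3) (mul_pos h.K_pos h.L_pos))

lemma errScale_sq (h : G.Regime cα cb δ K) :
    G.errScale δ K ^ 2 * (K * G.effHorizon) = logFactor S A δ K ^ 3 := by
  have h1 := h.K_pos
  have h2 := h.L_pos
  have h3 := h.logFactor_pos
  rw [Game.errScale, Real.sq_sqrt (by positivity)]
  field_simp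

lemma one_le_potConst (h : G.Regime cα cb δ K) : 1 ≤ potConst cα cb := by
  have h1 := h.cb_nonneg
  have h2 := h.cα_pos
  have h3 := Real.sqrt_nonneg cα
  rw [potConst]
  nlinarith [mul_nonneg h2.le h1]

lemma cb_le_potConst (h : G.Regime cα cb δ K) : cb ≤ potConst cα cb := by
  have h1 := h.cb_nonneg
  have h2 := h.cα_pos
  have h3 := Real.sqrt_nonneg cα
  rw [potConst]
  nlinarith [mul_nonneg h2.le h1]

lemma errScale_mul_le (h : G.Regime cα cb δ K) : G.errScale δ K * (8 * G.effHorizon) ≤ 1 := by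
  refine le_trans ?_ h.small
  rw [mul_assoc]
  exact le_mul_of_one_le_left (mul_nonneg h.errScale_pos.le (by linarith [h.L_pos]))
    h.one_le_potConst

lemma cb_mul_errScale_le (h : G.Regime cα cb δ K) : cb * G.errScale δ K * (8 * G.effHorizon) ≤ 1 := by
  refine le_trans ?_ h.small
  have := h.errScale_pos
  have := h.L_pos
  have := h.cb_le_potConst
  gcongr

/-- The bound for the weights of the rounds. -/
lemma weight_le (h : G.Regime cα cb δ K) {k : ℕ} (hk : k ∈ Icc 1 K) :
    weightAlpha cα K k ≤ cα * logFactor S A δ K / K := by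
  refine (weightAlpha_le h.one_le_step hk).trans ?_
  have := h.K_pos
  have := h.cα_pos
  have := h.log_K_le
  gcongr

/-- This makes the cost of the burn-in rounds negligible: `b² K L = ι³ ≥ 1/8` and `8 b L ≤ 1`
together give `b K ≥ 1`. -/
lemma L_div_K_le (h : G.Regime cα cb δ K) : 2 * G.effHorizon / K ≤ 16 * (G.errScale δ K * G.effHorizon) := by
  have h1 := h.errScale_sq
  have h2 := h.errScale_mul_le
  have h3 := h.half_le
  have h4 := h.errScale_pos
  have h5 := h.L_pos
  set b := G.errScale δ K
  set L := G.effHorizon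
  set ι := logFactor S A δ K
  rw [div_le_iff₀ h.K_pos]
  have h6 : (1 / 2) ^ 3 ≤ ι ^ 3 := pow_le_pow_left₀ (by norm_num) h3 3
  have h7 : 1 ≤ 8 * (b ^ 2 * (K * L)) := by rw [h1]; linarith
  have h8 : b * (8 * (b ^ 2 * (K * L))) ≤ b * (b * (8 * L)) * (b * K) := le_of_eq (by ring)
  have h9 : b * (b * (8 * L)) * (b * K) ≤ b * 1 * (b * K) := by
    have := h.K_pos
    gcongr
  have h10 : b * 1 ≤ b * (b * K) := by nlinarith
  have h11 : 1 ≤ b * K := by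
    have := le_of_mul_le_mul_left h10 h4
    linarith
  nlinarith

end Game.Regime
variable {G : Game m S A} {cα cb δ : ℝ} {K : ℕ}

lemma Game.Regime.sum_weight_le (hr : G.Regime cα cb δ K) {f : ℕ → ℝ} {c : ℝ}
    (hf : ∀ k ∈ Icc 1 K, f k ≤ c) : ∑ k ∈ Icc 1 K, weightAlpha cα K k * f k ≤ c := by
  calc _ ≤ ∑ k ∈ Icc 1 K, weightAlpha cα K k * c := Finset.sum_le_sum fun k hk =>
        mul_le_mul_of_nonneg_left (hf k hk) (weightAlpha_nonneg hr.one_le_step hk)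
    _ = c := by
        rw [← Finset.sum_mul, sum_weightAlpha hr.one_le_step hr.one_le_K, one_mul]

lemma Game.Regime.le_sum_weight (hr : G.Regime cα cb δ K) {f : ℕ → ℝ} {c : ℝ}
    (hf : ∀ k ∈ Icc 1 K, c ≤ f k) : c ≤ ∑ k ∈ Icc 1 K, weightAlpha cα K k * f k := by
  calc c = ∑ k ∈ Icc 1 K, weightAlpha cα K k * c := by
        rw [← Finset.sum_mul, sum_weightAlpha hr.one_le_step hr.one_le_K, one_mul]
    _ ≤ _ := Finset.sum_le_sum fun k hk =>
        mul_le_mul_of_nonneg_left (hf k hk) (weightAlpha_nonneg hr.one_le_step hk)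

/-- Jensen's inequality for the weights of the rounds. -/
lemma Game.Regime.sq_sum_weight_le (hr : G.Regime cα cb δ K) (f : ℕ → ℝ) :
    (∑ k ∈ Icc 1 K, weightAlpha cα K k * f k) ^ 2
      ≤ ∑ k ∈ Icc 1 K, weightAlpha cα K k * f k ^ 2 := by
  set c := ∑ k ∈ Icc 1 K, weightAlpha cα K k * f k with hc
  have h0 : 0 ≤ ∑ k ∈ Icc 1 K, weightAlpha cα K k * (f k - c) ^ 2 :=
    Finset.sum_nonneg fun k hk =>
      mul_nonneg (weightAlpha_nonneg hr.one_le_step hk) (sq_nonneg _)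
  have e : ∀ k, weightAlpha cα K k * (f k - c) ^ 2 = weightAlpha cα K k * f k ^ 2
      - 2 * c * (weightAlpha cα K k * f k) + weightAlpha cα K k * c ^ 2 := fun k => by ring
  simp only [e, Finset.sum_add_distrib, Finset.sum_sub_distrib, ← Finset.mul_sum,
    ← Finset.sum_mul] at h0
  rw [sum_weightAlpha hr.one_le_step hr.one_le_K, ← hc] at h0
  nlinarith

end regime

/-! ### Deterministic bounds for one step -/

section step
variable {m S : ℕ} {A : Fin m → ℕ} [∀ i, NeZero (A i)] {G : Game m S A} {cα cb δ : ℝ} {K h : ℕ}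
  {V : Fin m → Fin S → ℝ} {x : ℕ → Sample S A}

/-- The weighted mean of the sampled gains under the current policies. -/
def Game.playedGain (G : Game m S A) (cα : ℝ) (K h : ℕ) (V : Fin m → Fin S → ℝ)
    (x : ℕ → Sample S A) (i : Fin m) (s : Fin S) : ℝ :=
  ∑ k ∈ Icc 1 K, weightAlpha cα K k *
    mean (G.iterPolicy cα K h V x k i s) (G.qHat h V (x k) i s)

/-- The weighted variance of the sampled gains under the current policies. -/
def Game.playedVar (G : Game m S A) (cα : ℝ) (K h : ℕ) (V : Fin m → Fin S → ℝ)
    (x : ℕ → Sample S A) (i : Fin m) (s : Fin S) : ℝ :=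
  ∑ k ∈ Icc 1 K, weightAlpha cα K k *
    var (G.iterPolicy cα K h V x k i s) (G.qHat h V (x k) i s)

lemma Game.Regime.valueHat_eq (hr : G.Regime cα cb δ K) (i : Fin m) (s : Fin S) :
    G.valueHat cα cb δ K h V x i s
      = min (G.playedGain cα K h V x i s + cb * G.errScale δ K * G.playedVar cα K h V x i s
          + cb * G.errScale δ K * G.effHorizon) ((G.H : ℝ) - h + 1) := by
  rw [Game.valueHat, Game.bonus]
  congr 1
  change G.playedGain cα K h V x i s + cb * G.errScale δ K * _ = _
  have : ∑ k ∈ Icc 1 K, weightAlpha cα K k *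
      (var (G.iterPolicy cα K h V x k i s) (G.qHat h V (x k) i s) + G.effHorizon)
      = G.playedVar cα K h V x i s + G.effHorizon := by
    simp only [mul_add, Finset.sum_add_distrib, ← Finset.sum_mul]
    rw [sum_weightAlpha hr.one_le_step hr.one_le_K, one_mul, Game.playedVar]
  rw [this]; ring

lemma Game.Regime.playedVar_nonneg (hr : G.Regime cα cb δ K) (i : Fin m) (s : Fin S) :
    0 ≤ G.playedVar cα K h V x i s :=
  Finset.sum_nonneg fun _ hk => mul_nonneg (weightAlpha_nonneg hr.one_le_step hk) (var_nonneg _ _)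

variable {lo D : ℝ} {i : Fin m}

/-- By the Bhatia–Davis inequality a variance near the top of the range is proportional to the
distance from the top, so the variance part of the bonus never pushes the estimate beyond the range.
-/
lemma Game.Regime.playedGain_add_le (hr : G.Regime cα cb δ K) (hD : D ≤ 2 * G.effHorizon)
    (s : Fin S)
    (hlo : ∀ k s ai, lo ≤ G.qHat h V (x k) i s ai)
    (hhi : ∀ k s ai, G.qHat h V (x k) i s ai ≤ lo + D) :
    G.playedGain cα K h V x i s + cb * G.errScale δ K * G.playedVar cα K h V x i s ≤ lo + D := by
  rw [Game.playedGain, Game.playedVar, Finset.mul_sum, ← Finset.sum_add_distrib]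
  have hb : 0 ≤ cb * G.errScale δ K := mul_nonneg hr.cb_nonneg hr.errScale_pos.le
  refine le_trans (le_of_eq (Finset.sum_congr rfl fun k _ => ?_))
    (hr.sum_weight_le (f := fun k => mean (G.iterPolicy cα K h V x k i s) (G.qHat h V (x k) i s)
      + cb * G.errScale δ K * var (G.iterPolicy cα K h V x k i s) (G.qHat h V (x k) i s))
      fun k _ => mean_add_mul_var_le _ _ (hlo k s) (hhi k s) hb ?_)
  · ring
  · have h1 := hr.cb_mul_errScale_le
    have h2 : cb * G.errScale δ K * D ≤ cb * G.errScale δ K * (8 * G.effHorizon) :=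
      mul_le_mul_of_nonneg_left (by linarith [hr.L_pos]) hb
    rw [add_sub_cancel_left]
    linarith

/-- Truncation changes the value estimate by at most the constant part of the bonus. -/
lemma Game.Regime.le_valueHat (hr : G.Regime cα cb δ K) (hD : D ≤ 2 * G.effHorizon) (s : Fin S)
    (hlo : ∀ k s ai, lo ≤ G.qHat h V (x k) i s ai)
    (hhi : ∀ k s ai, G.qHat h V (x k) i s ai ≤ lo + D) (hcap : lo + D ≤ (G.H : ℝ) - h + 1) :
    G.playedGain cα K h V x i s + cb * G.errScale δ K * G.playedVar cα K h V x i s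
      ≤ G.valueHat cα cb δ K h V x i s := by
  have hb : 0 ≤ cb * G.errScale δ K := mul_nonneg hr.cb_nonneg hr.errScale_pos.le
  rw [hr.valueHat_eq]
  refine le_min ?_ ((hr.playedGain_add_le hD s hlo hhi).trans hcap)
  linarith [mul_nonneg hb hr.L_pos.le]

lemma Game.Regime.valueHat_le (hr : G.Regime cα cb δ K) (s : Fin S) :
    G.valueHat cα cb δ K h V x i s ≤ G.playedGain cα K h V x i s
      + cb * G.errScale δ K * G.playedVar cα K h V x i s
      + cb * G.errScale δ K * G.effHorizon := by
  rw [hr.valueHat_eq]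
  exact min_le_left _ _

lemma Game.Regime.lo_le_valueHat (hr : G.Regime cα cb δ K) (hD : D ≤ 2 * G.effHorizon) (s : Fin S)
    (hlo : ∀ k s ai, lo ≤ G.qHat h V (x k) i s ai)
    (hhi : ∀ k s ai, G.qHat h V (x k) i s ai ≤ lo + D) (hcap : lo + D ≤ (G.H : ℝ) - h + 1) :
    lo ≤ G.valueHat cα cb δ K h V x i s := by
  refine le_trans ?_ (hr.le_valueHat hD s hlo hhi hcap)
  have hb : 0 ≤ cb * G.errScale δ K := mul_nonneg hr.cb_nonneg hr.errScale_pos.le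
  have h1 : lo ≤ G.playedGain cα K h V x i s := hr.le_sum_weight fun k _ => le_mean _ _ (hlo k s)
  linarith [mul_nonneg hb (hr.playedVar_nonneg (h := h) (V := V) (x := x) i s)]

/-- The span of the new value estimates is at most the range of the sampled gains. -/
lemma Game.Regime.valueHat_sub_le (hr : G.Regime cα cb δ K) (hD : D ≤ 2 * G.effHorizon)
    (hD0 : 0 ≤ D) (s s' : Fin S)
    (hlo : ∀ k s ai, lo ≤ G.qHat h V (x k) i s ai)
    (hhi : ∀ k s ai, G.qHat h V (x k) i s ai ≤ lo + D) :
    G.valueHat cα cb δ K h V x i s - G.valueHat cα cb δ K h V x i s' ≤ D := by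
  have hb : 0 ≤ cb * G.errScale δ K := mul_nonneg hr.cb_nonneg hr.errScale_pos.le
  have h1 : lo ≤ G.playedGain cα K h V x i s' := hr.le_sum_weight fun k _ => le_mean _ _ (hlo k s')
  have h2 := mul_nonneg hb (hr.playedVar_nonneg (h := h) (V := V) (x := x) i s')
  have h3 := hr.playedGain_add_le hD s hlo hhi
  -- Both states have the same cap and the same constant bonus, so these two terms cannot enlarge
  -- the span.
  rw [hr.valueHat_eq, hr.valueHat_eq, sub_le_iff_le_add', ← min_add_add_right]
  exact min_le_min (by linarith) (by linarith)

/-- The regret of every action against the averaged gains. -/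
lemma Game.Regime.QHat_le (hr : G.Regime cα cb δ K) (hD : D ≤ 2 * G.effHorizon)
    (hD0 : 0 ≤ D) (s : Fin S)
    (hlo : ∀ k s ai, lo ≤ G.qHat h V (x k) i s ai)
    (hhi : ∀ k s ai, G.qHat h V (x k) i s ai ≤ lo + D) (ai : Fin (A i)) :
    ∑ k ∈ Icc 1 K, weightAlpha cα K k * G.qHat h V (x k) i s ai
      ≤ G.playedGain cα K h V x i s + cb * G.errScale δ K * G.playedVar cα K h V x i s
        + (16 + 2 * Real.sqrt cα) * (G.errScale δ K * G.effHorizon) := by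
  set M := 3 * Real.exp (1 / cα) with hM
  have hMpos : 0 < M := by positivity
  have hQsum : ∀ n, ∀ a, G.QHat cα K h V x i s n a
      = ∑ k ∈ Icc 1 n, stepWeight (stepAlpha cα K) n k * G.qHat h V (x k) i s a := by
    intro n a
    induction n with
    | zero => simp [Game.QHat]
    | succ n ih => rw [sum_stepWeight_succ, ← ih, Game.QHat]
  have hk₀ : 1 ≤ burnIn M K := by
    have := hr.K_pos
    exact Nat.one_le_ceil_iff.2 (by positivity)
  have hθ : ∀ k, burnIn M K < k →
      G.stepEta cα K k * stepAlpha cα K k / (1 - stepAlpha cα K k) ≤ cb * G.errScale δ K :=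
    fun k hk => (stepEta_mul_div_le G hr.cα_pos hr.one_le_step hr.one_le_K hr.log_pos hr.L_pos
      hMpos hr.step_le hr.log_K_le hr.half_le hk).trans
      (mul_le_mul_of_nonneg_right hr.le_cb hr.errScale_pos.le)
  have hb : 0 ≤ cb * G.errScale δ K := mul_nonneg hr.cb_nonneg hr.errScale_pos.le
  have key := expWeights_regret (stepAlpha cα K) (G.stepEta cα K)
    (fun k => G.qHat h V (x k) i s) (fun k => G.QHat cα K h V x i s k) (n := K)
    (k₀ := burnIn M K) (D := D) lo hr.one_le_K hk₀ (stepAlpha_one hr.one_le_step)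
    (fun k hk => stepAlpha_pos hr.one_le_step hk) (fun k hk => stepAlpha_lt_one hr.one_le_step hk)
    (fun k hk => stepEta_pos G hr.one_le_step hr.log_pos hr.L_pos hk)
    (fun k hk => one_sub_mul_stepEta_le G hr.one_le_step hr.log_pos hr.L_pos hk)
    (fun _ => rfl) (fun _ _ => rfl) (fun k _ => hlo k s) (fun k _ => hhi k s)
    (fun k hk => by
      have h1 := hr.cb_mul_errScale_le
      have h2 := hθ k (by have := (mem_Icc.1 hk).1; omega)
      have h3 : cb * G.errScale δ K * D ≤ cb * G.errScale δ K * (8 * G.effHorizon) :=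
        mul_le_mul_of_nonneg_left (by linarith [hr.L_pos]) hb
      have h4 := mul_le_mul_of_nonneg_right h2 hD0
      linarith) ai
  have hlog := log_div_stepEta_le G hr.cα_pos hr.one_le_K hr.log_pos hr.L_pos
    (a := Real.log (Fintype.card (Fin (A i)))) (by simpa using hr.log_A_le i) hr.half_le
  change _ ≤ 2 * Real.sqrt cα * (G.errScale δ K * G.effHorizon) at hlog
  have hmain : ∑ k ∈ Icc 1 K, weightAlpha cα K k *
      (mean (G.iterPolicy cα K h V x k i s) (G.qHat h V (x k) i s)
        + if burnIn M K < k then G.stepEta cα K k * stepAlpha cα K k / (1 - stepAlpha cα K k) *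
            var (G.iterPolicy cα K h V x k i s) (G.qHat h V (x k) i s) else D)
      ≤ G.playedGain cα K h V x i s + cb * G.errScale δ K * G.playedVar cα K h V x i s
        + D * (1 / K) := by
    -- The early rounds lose the full range `D`, but their total weight is at most `1 / K`.
    have h1 : ∑ k ∈ Icc 1 K, (if k ≤ burnIn M K then weightAlpha cα K k else 0) ≤ 1 / K := by
      rw [← Finset.sum_filter]
      refine le_trans ?_ (sum_weightAlpha_burnIn_le hr.cα_pos hr.one_le_step hr.one_le_K hM
        hr.step_le)
      refine Finset.sum_le_sum_of_subset_of_nonneg ?_ fun k hk _ => ?_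
      · intro k hk
        simp only [mem_filter, mem_Icc] at hk ⊢
        omega
      · have hk' := (mem_Icc.1 hk).1
        exact stepWeight_nonneg _ (fun _ h => (stepAlpha_pos hr.one_le_step h).le)
          (fun _ h => stepAlpha_le_one hr.one_le_step h) hk'
    refine le_trans ?_ (add_le_add_right (mul_le_mul_of_nonneg_left h1 hD0) _)
    rw [Game.playedGain, Game.playedVar, Finset.mul_sum, Finset.mul_sum,
      ← Finset.sum_add_distrib, ← Finset.sum_add_distrib]
    refine Finset.sum_le_sum fun k hk => ?_
    have hw := weightAlpha_nonneg hr.one_le_step hk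
    by_cases hkk : burnIn M K < k
    · rw [if_pos hkk, if_neg (by omega), mul_zero, add_zero]
      have := mul_le_mul_of_nonneg_left (mul_le_mul_of_nonneg_right (hθ k hkk)
        (var_nonneg (G.iterPolicy cα K h V x k i s) (G.qHat h V (x k) i s))) hw
      linarith
    · rw [if_neg hkk, if_pos (by omega)]
      have := mul_nonneg hb (mul_nonneg hw
        (var_nonneg (G.iterPolicy cα K h V x k i s) (G.qHat h V (x k) i s)))
      linarith
  rw [hQsum] at key
  refine (key.trans (add_le_add hmain hlog)).trans ?_
  have h5 := hr.L_div_K_le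
  have h6 : D * (1 / K) ≤ 2 * G.effHorizon / K := by
    rw [mul_one_div]
    exact div_le_div_of_nonneg_right hD hr.K_pos.le
  linarith

end step

/-! ### Quadratic potentials -/

/-- In the application `U` is the excess of the new value `v'`, `μ` the old minimum, `Y` and `Q` the
first two moments of the centred gain, and `E` the expected old squared excess. A large `U` forces a
large mean: `Y ≥ U - 2 - β v` with `v = Q - Y²`. Hence `Q - Y²` is at most about `E - U²`, and `β v`
is absorbed by the drop of the potential; the part of `v` that reappears on the right is at most `v
/ 2` because `8 β L ≤ 1`. This gives `v ≤ 2 (E - U²) + 26 L`, and the extra `L` in the hypothesis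
makes `27`. -/
lemma potential_upper {v' μ U Y Q E β L : ℝ} (hβ : 0 ≤ β) (hL : 1 ≤ L) (hβL : β * (8 * L) ≤ 1)
    (hU0 : 0 ≤ U) (hU : U ≤ 2 * L) (hUv : U ≤ v' - μ + 1) (hQ : Q ≤ E + (1 + 4 * L))
    (hv : 0 ≤ Q - Y ^ 2) (h : v' ≤ μ + Y + β * (Q - Y ^ 2 + L)) :
    v' + 2 * β * U ^ 2 ≤ μ + Y + 2 * β * E + 27 * (β * L) := by
  set v := Q - Y ^ 2 with hvdef
  have h1 : U - 2 - β * v ≤ Y := by nlinarith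
  have h2 : U ^ 2 - 2 * U * (2 + β * v) ≤ Y ^ 2 := by
    nlinarith [sq_nonneg (Y - U), mul_le_mul_of_nonneg_left h1 hU0]
  have h3 : 2 * U * (2 + β * v) ≤ 4 * L * (2 + β * v) :=
    mul_le_mul_of_nonneg_right (by linarith) (by positivity)
  have h4 : 4 * L * (β * v) ≤ v / 2 := by nlinarith [mul_le_mul_of_nonneg_right hβL hv]
  have h5 : v ≤ 2 * (E - U ^ 2) + 26 * L := by nlinarith
  nlinarith [mul_le_mul_of_nonneg_left h5 hβ]

/-- With `g = v' - μ - Y` the same computation gives `v ≤ E - U² + 9 L + 2 U g`. If `g ≤ 0`, the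
last term helps and `-g ≤ β (v + L)` finishes. If `g ≥ 0`, then `0 ≤ v` bounds a possible increase
of the potential, and `4 β U ≤ 1` lets `g` pay for it. -/
lemma potential_lower {v' μ U Y Q E β L : ℝ} (hβ : 0 ≤ β) (hL : 1 ≤ L) (hβL : β * (8 * L) ≤ 1)
    (hU0 : 0 ≤ U) (hU : U ≤ 2 * L) (hUv : U ≤ v' - μ + 1) (hQ : Q ≤ E + (1 + 4 * L))
    (hv : 0 ≤ Q - Y ^ 2) (h : μ + Y ≤ v' + β * (Q - Y ^ 2 + L)) :
    μ + Y - 2 * β * E ≤ v' - 2 * β * U ^ 2 + 27 * (β * L) := by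
  set v := Q - Y ^ 2 with hvdef
  set g := v' - μ - Y with hg
  have h1 : U - g - 1 ≤ Y := by linarith
  have h2 : U ^ 2 - 2 * U * (g + 1) ≤ Y ^ 2 := by
    nlinarith [sq_nonneg (Y - U), mul_le_mul_of_nonneg_left h1 hU0]
  have h3 : v ≤ E - U ^ 2 + 9 * L + 2 * U * g := by nlinarith
  have hgoal : -g ≤ 2 * β * (E - U ^ 2) + 19 * (β * L) := by
    rcases le_total g 0 with hg0 | hg0
    · have h4 : 0 ≤ -(U * g) := by nlinarith
      have h5 : v ≤ E - U ^ 2 + 9 * L := by linarith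
      have h6 : -g ≤ β * (v + L) := by linarith
      nlinarith [mul_le_mul_of_nonneg_left h5 hβ, mul_nonneg hβ hv]
    · have h4 : β * 0 ≤ β * (E - U ^ 2 + 9 * L + 2 * U * g) :=
        mul_le_mul_of_nonneg_left (hv.trans h3) hβ
      have h5 : 4 * β * U ≤ 1 := by nlinarith
      nlinarith [mul_le_mul_of_nonneg_right h5 hg0]
  have : 0 ≤ β * L := by positivity
  nlinarith

end RobustMG
end

noncomputable section
namespace RobustMG
open Finset
open scoped ENNReal

/-! ### One step of the algorithm -/

section oneStep
variable {m S : ℕ} {A : Fin m → ℕ}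

/-- The excess of a value function over its minimum. -/
def excess (V : Fin m → Fin S → ℝ) (i : Fin m) (s : Fin S) : ℝ := V i s - ⨅ s', V i s'

/-- The discounted mean of the squared excess at the next state. -/
def Game.quadMean (G : Game m S A) (h : ℕ) (V : Fin m → Fin S → ℝ) (i : Fin m) (s : Fin S)
    (μ : (j : Fin m) → Fin (A j) → ℝ) : ℝ :=
  prodMean μ fun a => (1 - G.R) * ∑ s', G.P0 h s a s' * excess V i s' ^ 2

lemma excess_nonneg (V : Fin m → Fin S → ℝ) (i : Fin m) (s : Fin S) : 0 ≤ excess V i s :=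
  sub_nonneg.2 (finite_iInf_le _ s)

variable {G : Game m S A} {h : ℕ} {V : Fin m → Fin S → ℝ} {i : Fin m} {s : Fin S}
  {μ : (j : Fin m) → Fin (A j) → ℝ}

lemma Game.quadMean_nonneg (hR1 : G.R ≤ 1) (hμ : ∀ j, μ j ∈ stdSimplex ℝ (Fin (A j))) :
    0 ≤ G.quadMean h V i s μ := by
  refine Finset.sum_nonneg fun a _ => mul_nonneg (Finset.prod_nonneg fun j _ => (hμ j).1 _) ?_
  refine mul_nonneg (by linarith) (Finset.sum_nonneg fun s' _ => ?_)
  exact mul_nonneg (simplex_nonneg _ _) (sq_nonneg _)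

/-- Translates between the centred gains of the concentration argument and the discounted Bellman
operator, applied to the value plus its potential. -/
lemma Game.iInf_add_gainMean (hμ : ∀ j, μ j ∈ stdSimplex ℝ (Fin (A j))) (c : ℝ) :
    (⨅ s', V i s') + G.gainMean h V i s (fun y => y) μ + c * G.quadMean h V i s μ
      = prodMean μ (G.discGain i h s fun s' => V i s' + c * excess V i s' ^ 2)
        + G.R * ⨅ s', V i s' := by
  have hs : ∀ j, ∑ a, μ j a = 1 := fun j => (hμ j).2
  rw [← prodMean_const μ hs (⨅ s', V i s'), Game.gainMean, Game.quadMean, ← prodMean_mul_left,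
    ← prodMean_add, ← prodMean_add, prodMean_const μ hs,
    ← prodMean_const μ hs (G.R * ⨅ s', V i s'), ← prodMean_add]
  congr 1
  funext a
  have h1 : ∑ s', G.P0 h s a s' * G.centredGain h V i s (a, s')
      = G.r i h s a + (1 - G.R) * (∑ s', G.P0 h s a s' * V i s')
        - (1 - G.R) * ⨅ s', V i s' := by
    have e : ∀ s', G.P0 h s a s' * G.centredGain h V i s (a, s')
        = G.P0 h s a s' * (G.r i h s a - (1 - G.R) * ⨅ s', V i s')
          + (1 - G.R) * (G.P0 h s a s' * V i s') := by
      intro s'; simp only [Game.centredGain]; ring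
    simp only [e, Finset.sum_add_distrib, ← Finset.sum_mul, ← Finset.mul_sum, simplex_sum]
    ring
  have h2 : ∑ s', G.P0 h s a s' * (V i s' + c * excess V i s' ^ 2)
      = ∑ s', G.P0 h s a s' * V i s' + c * ∑ s', G.P0 h s a s' * excess V i s' ^ 2 := by
    rw [Finset.mul_sum, ← Finset.sum_add_distrib]
    exact Finset.sum_congr rfl fun s' _ => by ring
  rw [Game.discGain, h1, h2]
  ring

lemma Game.gainVar_nonneg (hμ : ∀ j, μ j ∈ stdSimplex ℝ (Fin (A j))) :
    0 ≤ G.gainVar h V i s μ := by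
  have hs : ∀ j, ∑ a, μ j a = 1 := fun j => (hμ j).2
  set c := G.gainMean h V i s (fun y => y) μ with hc
  have h0 : 0 ≤ G.gainMean h V i s (fun y => (y - c) ^ 2) μ := by
    refine Finset.sum_nonneg fun a _ => mul_nonneg (Finset.prod_nonneg fun j _ => (hμ j).1 _) ?_
    exact Finset.sum_nonneg fun s' _ => mul_nonneg (simplex_nonneg _ _) (sq_nonneg _)
  have e : G.gainMean h V i s (fun y => (y - c) ^ 2) μ
      = G.gainMean h V i s (fun y => y ^ 2) μ + (-(2 * c)) * G.gainMean h V i s (fun y => y) μ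
        + c ^ 2 := by
    conv_rhs => rw [← prodMean_const μ hs (c ^ 2)]
    simp only [Game.gainMean]
    rw [← prodMean_mul_left, ← prodMean_add, ← prodMean_add]
    congr 1
    funext a
    have := mean_sub_sq (G.P0 h s a) (fun s' => G.centredGain h V i s (a, s')) c
    simp only [mean] at this
    rw [this]; ring
  rw [e, ← hc] at h0
  rw [Game.gainVar, ← hc]
  nlinarith

/-- The gain is a reward plus the discounted excess. Since `(1 - R)² ≤ 1 - R`, the square of the
second part fits into one discounted expectation; the rest is `O(L)`. -/
lemma Game.gainMean_sq_le (hR0 : 0 ≤ G.R) (hR1 : G.R ≤ 1) {L : ℝ}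
    (hrew : ∀ a, |G.r i h s a| ≤ 1) (hV : ∀ s', excess V i s' ≤ 2 * L)
    (hμ : ∀ j, μ j ∈ stdSimplex ℝ (Fin (A j))) :
    G.gainMean h V i s (fun y => y ^ 2) μ ≤ G.quadMean h V i s μ + (1 + 4 * L) := by
  have hs : ∀ j, ∑ a, μ j a = 1 := fun j => (hμ j).2
  rw [← prodMean_const μ hs (1 + 4 * L), Game.quadMean, ← prodMean_add]
  refine prodMean_mono μ (fun j => (hμ j).1) fun a => ?_
  have h1 : (1 - G.R) * (∑ s', G.P0 h s a s' * excess V i s' ^ 2) + (1 + 4 * L)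
      = ∑ s', G.P0 h s a s' * ((1 - G.R) * excess V i s' ^ 2 + (1 + 4 * L)) := by
    simp only [mul_add, Finset.sum_add_distrib, ← Finset.sum_mul, simplex_sum, Finset.mul_sum,
      one_mul]
    congr 1
    · exact Finset.sum_congr rfl fun s' _ => by ring
  rw [h1]
  refine Finset.sum_le_sum fun s' _ => mul_le_mul_of_nonneg_left ?_ (simplex_nonneg _ _)
  have h2 := abs_le.1 (hrew a)
  have h3 := excess_nonneg V i s'
  have h4 := hV s'
  change (G.r i h s a + (1 - G.R) * excess V i s') ^ 2 ≤ _
  set u := excess V i s'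
  set r := G.r i h s a
  have hg0 : 0 ≤ 1 - G.R := by linarith
  have hg1 : (1 - G.R) ^ 2 * u ^ 2 ≤ (1 - G.R) * u ^ 2 := by
    have : (1 - G.R) ^ 2 ≤ 1 - G.R := by nlinarith
    exact mul_le_mul_of_nonneg_right this (sq_nonneg _)
  have hg2 : (1 - G.R) * u ≤ 2 * L := by nlinarith
  have hg3 : 0 ≤ (1 - G.R) * u := mul_nonneg hg0 h3
  nlinarith

variable {cα cb δ : ℝ} {K : ℕ}

namespace Game.Regime

/-- The parameter of the exponents for the gains. -/
def gainParam (G : Game m S A) (cα δ : ℝ) (K : ℕ) : ℝ :=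
  G.errScale δ K / (cα * logFactor S A δ K / K)

/-- The parameter of the exponents for the variances. -/
def varParam (G : Game m S A) (cα δ : ℝ) (K : ℕ) : ℝ :=
  1 / (cα * logFactor S A δ K / K * (2 * G.effHorizon) ^ 2)

end Game.Regime

/-- `gainParam` is chosen so that its product with any weight is at most `b`; dividing the exponent
bound by it leaves `b` times the weighted variance, and `b² K L = ι³` turns `8 ι` into `O(b L)`. -/
lemma Game.Regime.sum_weight_error_le (hr : G.Regime cα cb δ K) (X v : ℕ → ℝ)
    (hv : ∀ k ∈ Icc 1 K, 0 ≤ v k)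
    (hX : ∑ k ∈ Icc 1 K, (Regime.gainParam G cα δ K * weightAlpha cα K k * X k
      - (Regime.gainParam G cα δ K * weightAlpha cα K k) ^ 2 * v k) ≤ 8 * logFactor S A δ K) :
    ∑ k ∈ Icc 1 K, weightAlpha cα K k * X k
      ≤ G.errScale δ K * (∑ k ∈ Icc 1 K, weightAlpha cα K k * v k)
        + 16 * cα * (G.errScale δ K * G.effHorizon) := by
  have hb := hr.errScale_pos
  have hK := hr.K_pos
  have hα := hr.cα_pos
  have hι := hr.logFactor_pos
  have hsq := hr.errScale_sq
  have hhalf := hr.half_le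
  set w := cα * logFactor S A δ K / K with hw
  have hwpos : 0 < w := by positivity
  set t := Regime.gainParam G cα δ K with ht
  have htw : t * w = G.errScale δ K := by
    rw [ht, Regime.gainParam, ← hw]; field_simp
  have htpos : 0 < t := by
    rw [ht, Regime.gainParam, ← hw]; positivity
  have h1 : ∀ k ∈ Icc 1 K, t * (weightAlpha cα K k * X k)
      - t * (G.errScale δ K * (weightAlpha cα K k * v k))
      ≤ t * weightAlpha cα K k * X k - (t * weightAlpha cα K k) ^ 2 * v k := by
    intro k hk
    have hw0 := weightAlpha_nonneg hr.one_le_step hk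
    have hw1 : weightAlpha cα K k ≤ w := hr.weight_le hk
    have h2 : t * weightAlpha cα K k ≤ G.errScale δ K := by
      rw [← htw]; exact mul_le_mul_of_nonneg_left hw1 htpos.le
    have h3 : 0 ≤ t * weightAlpha cα K k * v k :=
      mul_nonneg (mul_nonneg htpos.le hw0) (hv k hk)
    nlinarith [mul_le_mul_of_nonneg_right h2 h3]
  have h4 := (Finset.sum_le_sum h1).trans hX
  rw [Finset.sum_sub_distrib, ← Finset.mul_sum, ← Finset.mul_sum, ← Finset.mul_sum,
    ← mul_sub] at h4
  have h5 : 8 * logFactor S A δ K ≤ t * (16 * cα * (G.errScale δ K * G.effHorizon)) := by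
    have e : t * (16 * cα * (G.errScale δ K * G.effHorizon))
        = 16 * (G.errScale δ K ^ 2 * (K * G.effHorizon)) / logFactor S A δ K := by
      rw [ht, Regime.gainParam]; field_simp
    rw [e, hsq, le_div_iff₀ hι]
    nlinarith [pow_pos hι 2]
  have h6 := le_of_mul_le_mul_left (h4.trans h5) htpos
  linarith

lemma Game.Regime.sum_weight_var_le (hr : G.Regime cα cb δ K) (Z v : ℕ → ℝ)
    (hX : ∑ k ∈ Icc 1 K, (Regime.varParam G cα δ K * weightAlpha cα K k * Z k
      - 2 * (Regime.varParam G cα δ K * weightAlpha cα K k * v k)) ≤ 8 * logFactor S A δ K) :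
    ∑ k ∈ Icc 1 K, weightAlpha cα K k * Z k
      ≤ 2 * (∑ k ∈ Icc 1 K, weightAlpha cα K k * v k) + 64 * cα * G.effHorizon := by
  have hb := hr.errScale_pos
  have hK := hr.K_pos
  have hL := hr.L_pos
  have hα := hr.cα_pos
  have hι := hr.logFactor_pos
  have hsq := hr.errScale_sq
  have hhalf := hr.half_le
  have hsm := hr.errScale_mul_le
  set t := Regime.varParam G cα δ K with ht
  have htpos : 0 < t := by
    rw [ht, Regime.varParam]; positivity
  have e : ∀ k, t * weightAlpha cα K k * Z k - 2 * (t * weightAlpha cα K k * v k)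
      = t * (weightAlpha cα K k * Z k - 2 * (weightAlpha cα K k * v k)) := fun k => by ring
  simp only [e] at hX
  rw [← Finset.mul_sum, Finset.sum_sub_distrib, ← Finset.mul_sum] at hX
  have h5 : 8 * logFactor S A δ K ≤ t * (64 * cα * G.effHorizon) := by
    have e : t * (64 * cα * G.effHorizon) = 16 * K / (logFactor S A δ K * G.effHorizon) := by
      rw [ht, Regime.varParam]; field_simp; norm_num
    rw [e, le_div_iff₀ (mul_pos hι hL)]
    set b := G.errScale δ K
    set L := G.effHorizon
    set ι := logFactor S A δ K
    have h6 : ι ^ 3 * L = K * (b * L) ^ 2 := by rw [← hsq]; ring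
    have h7 : (b * L) ^ 2 ≤ 1 := by
      have h8 : b * L ≤ 1 := by nlinarith [mul_pos hb hL]
      exact pow_le_one₀ (mul_pos hb hL).le h8
    have h9 : ι ^ 3 * L ≤ K := by rw [h6]; nlinarith
    have h10 : ι ^ 2 * L * (1 / 2) ≤ ι ^ 2 * L * ι :=
      mul_le_mul_of_nonneg_left hhalf (by positivity)
    nlinarith
  have h6 := le_of_mul_le_mul_left (hX.trans h5) htpos
  linarith

/-- The average of the variances is at most the variance of the mixture, the form in which the
potential argument uses it. -/
lemma Game.Regime.sum_weight_gainVar_le (hr : G.Regime cα cb δ K) (i : Fin m) (s : Fin S)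
    (ν : ℕ → (j : Fin m) → Fin (A j) → ℝ) :
    ∑ k ∈ Icc 1 K, weightAlpha cα K k * G.gainVar h V i s (ν k)
      ≤ ∑ k ∈ Icc 1 K, weightAlpha cα K k * G.gainMean h V i s (fun y => y ^ 2) (ν k)
        - (∑ k ∈ Icc 1 K, weightAlpha cα K k * G.gainMean h V i s (fun y => y) (ν k)) ^ 2 := by
  have h1 := hr.sq_sum_weight_le fun k => G.gainMean h V i s (fun y => y) (ν k)
  simp only [Game.gainVar, mul_sub, Finset.sum_sub_distrib]
  linarith

variable [∀ i, NeZero (A i)] {x : ℕ → Sample S A}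

/-- The data are good at the confidence level used in the analysis. -/
def Game.Regime.Good (G : Game m S A) (cα δ : ℝ) (K h : ℕ) (V : Fin m → Fin S → ℝ)
    (x : ℕ → Sample S A) : Prop :=
  G.GoodData cα K h V (gainParam G cα δ K) (varParam G cα δ K)
    (8 * logFactor S A δ K) x

/-- The policies played in round `k`, as weights. -/
def Game.roundWeights (G : Game m S A) (cα : ℝ) (K h : ℕ) (V : Fin m → Fin S → ℝ)
    (x : ℕ → Sample S A) (s : Fin S) (k : ℕ) : (j : Fin m) → Fin (A j) → ℝ :=
  fun j a => G.iterPolicy cα K h V x k j s a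

lemma Game.roundWeights_mem (s : Fin S) (k : ℕ) (j : Fin m) :
    G.roundWeights cα K h V x s k j ∈ stdSimplex ℝ (Fin (A j)) :=
  (G.iterPolicy cα K h V x k j s).2

lemma Game.roundWeights_update_mem (s : Fin S) (k : ℕ) (i : Fin m) (ai : Fin (A i)) (j : Fin m) :
    Function.update (G.roundWeights cα K h V x s k) i (Pi.single ai 1) j
      ∈ stdSimplex ℝ (Fin (A j)) :=
  update_single_mem (G.iterPolicy cα K h V x k) i s ai j

lemma Game.Regime.playedGain_eq (hr : G.Regime cα cb δ K) (i : Fin m) (s : Fin S) :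
    G.playedGain cα K h V x i s = ∑ k ∈ Icc 1 K, weightAlpha cα K k *
      mean (G.iterPolicy cα K h V x k i s) (fun ai => G.centredGain h V i s (x k i s ai))
      + ⨅ s', V i s' := by
  have e : ∀ k, weightAlpha cα K k * mean (G.iterPolicy cα K h V x k i s) (G.qHat h V (x k) i s)
      = weightAlpha cα K k * mean (G.iterPolicy cα K h V x k i s)
        (fun ai => G.centredGain h V i s (x k i s ai)) + weightAlpha cα K k * ⨅ s', V i s' := by
    intro k
    rw [← mul_add, show G.qHat h V (x k) i s
      = fun ai => G.centredGain h V i s (x k i s ai) + ⨅ s', V i s' from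
        funext fun ai => Game.qHat_eq h V (x k) i s ai, mean_add, mean_const]
  simp only [Game.playedGain, e, Finset.sum_add_distrib, ← Finset.sum_mul]
  rw [sum_weightAlpha hr.one_le_step hr.one_le_K, one_mul]

lemma Game.playedVar_eq (i : Fin m) (s : Fin S) :
    G.playedVar cα K h V x i s = ∑ k ∈ Icc 1 K, weightAlpha cα K k *
      var (G.iterPolicy cα K h V x k i s) (fun ai => G.centredGain h V i s (x k i s ai)) := by
  refine Finset.sum_congr rfl fun k _ => ?_
  rw [show G.qHat h V (x k) i s = fun ai => G.centredGain h V i s (x k i s ai) + ⨅ s', V i s' from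
    funext fun ai => Game.qHat_eq h V (x k) i s ai, var_add_const]

/-- On good data the value estimate is bounded by the mean gain of the played policies. -/
lemma Game.Regime.valueHat_le_of_good (hr : G.Regime cα cb δ K)
    (hx : Regime.Good G cα δ K h V x) (i : Fin m) (s : Fin S) :
    G.valueHat cα cb δ K h V x i s ≤ (⨅ s', V i s')
      + (∑ k ∈ Icc 1 K, weightAlpha cα K k *
          G.gainMean h V i s (fun y => y) (G.roundWeights cα K h V x s k))
      + potConst cα cb * G.errScale δ K *
        (∑ k ∈ Icc 1 K, weightAlpha cα K k *
            G.gainMean h V i s (fun y => y ^ 2) (G.roundWeights cα K h V x s k)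
          - (∑ k ∈ Icc 1 K, weightAlpha cα K k *
            G.gainMean h V i s (fun y => y) (G.roundWeights cα K h V x s k)) ^ 2
          + G.effHorizon) := by
  have h1 := hr.valueHat_le (h := h) (V := V) (x := x) (i := i) s
  rw [hr.playedGain_eq] at h1
  have hv := hr.sum_weight_gainVar_le (h := h) (V := V) i s (G.roundWeights cα K h V x s)
  have hgv : ∀ k ∈ Icc 1 K, 0 ≤ G.gainVar h V i s (G.roundWeights cα K h V x s k) :=
    fun k _ => Game.gainVar_nonneg (G.roundWeights_mem s k)
  have h2 := hr.sum_weight_error_le (fun k => mean (G.iterPolicy cα K h V x k i s)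
      (fun ai => G.centredGain h V i s (x k i s ai))
      - G.gainMean h V i s (fun y => y) (G.roundWeights cα K h V x s k))
    (fun k => G.gainVar h V i s (G.roundWeights cα K h V x s k)) hgv (hx i s).2.1
  simp only [mul_sub, Finset.sum_sub_distrib] at h2
  have h3 := hr.sum_weight_var_le (fun k => var (G.iterPolicy cα K h V x k i s)
      (fun ai => G.centredGain h V i s (x k i s ai)))
    (fun k => G.gainVar h V i s (G.roundWeights cα K h V x s k)) (hx i s).2.2
  rw [← Game.playedVar_eq] at h3
  have hv0 : 0 ≤ ∑ k ∈ Icc 1 K, weightAlpha cα K k *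
      G.gainVar h V i s (G.roundWeights cα K h V x s k) :=
    Finset.sum_nonneg fun k hk => mul_nonneg (weightAlpha_nonneg hr.one_le_step hk) (hgv k hk)
  set v₁ := ∑ k ∈ Icc 1 K, weightAlpha cα K k *
      G.gainVar h V i s (G.roundWeights cα K h V x s k)
  set Y := ∑ k ∈ Icc 1 K, weightAlpha cα K k *
      G.gainMean h V i s (fun y => y) (G.roundWeights cα K h V x s k)
  set v := ∑ k ∈ Icc 1 K, weightAlpha cα K k *
      G.gainMean h V i s (fun y => y ^ 2) (G.roundWeights cα K h V x s k) - Y ^ 2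
  have hb := hr.errScale_pos
  have hL := hr.L_pos
  have hα := hr.cα_pos
  have hcb := hr.cb_nonneg
  have hsα := Real.sqrt_nonneg cα
  set b := G.errScale δ K
  set L := G.effHorizon
  have hbv : 0 ≤ b * v := mul_nonneg hb.le (hv0.trans hv)
  have hbL : 0 ≤ b * L := mul_nonneg hb.le hL.le
  have h4 : cb * b * G.playedVar cα K h V x i s ≤ cb * b * (2 * v + 64 * cα * L) :=
    mul_le_mul_of_nonneg_left (by linarith) (mul_nonneg hcb hb.le)
  have h5 : b * v₁ ≤ b * v := mul_le_mul_of_nonneg_left hv hb.le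
  have h6 : (1 + 2 * cb) * (b * v) ≤ potConst cα cb * (b * v) := by
    refine mul_le_mul_of_nonneg_right ?_ hbv
    rw [potConst]; nlinarith [mul_nonneg hα.le hcb]
  have h7 : (16 * cα + 64 * cα * cb + cb) * (b * L) ≤ potConst cα cb * (b * L) := by
    refine mul_le_mul_of_nonneg_right ?_ hbL
    rw [potConst]; nlinarith [mul_nonneg hα.le hcb]
  nlinarith

/-- On good data the value estimate dominates the mean gain of every action. -/
lemma Game.Regime.le_valueHat_of_good (hr : G.Regime cα cb δ K)
    (hx : Regime.Good G cα δ K h V x) {lo D : ℝ} {i : Fin m} (hD : D ≤ 2 * G.effHorizon)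
    (hD0 : 0 ≤ D) (s : Fin S)
    (hlo : ∀ k s ai, lo ≤ G.qHat h V (x k) i s ai)
    (hhi : ∀ k s ai, G.qHat h V (x k) i s ai ≤ lo + D) (hcap : lo + D ≤ (G.H : ℝ) - h + 1)
    (ai : Fin (A i)) :
    (⨅ s', V i s') + (∑ k ∈ Icc 1 K, weightAlpha cα K k * G.gainMean h V i s (fun y => y)
        (Function.update (G.roundWeights cα K h V x s k) i (Pi.single ai 1)))
      ≤ G.valueHat cα cb δ K h V x i s + potConst cα cb * G.errScale δ K *
        (∑ k ∈ Icc 1 K, weightAlpha cα K k * G.gainMean h V i s (fun y => y ^ 2)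
            (Function.update (G.roundWeights cα K h V x s k) i (Pi.single ai 1))
          - (∑ k ∈ Icc 1 K, weightAlpha cα K k * G.gainMean h V i s (fun y => y)
            (Function.update (G.roundWeights cα K h V x s k) i (Pi.single ai 1))) ^ 2
          + G.effHorizon) := by
  set ν : ℕ → (j : Fin m) → Fin (A j) → ℝ :=
    fun k => Function.update (G.roundWeights cα K h V x s k) i (Pi.single ai 1) with hν
  have h1 := hr.le_valueHat hD s hlo hhi hcap
  have hreg := hr.QHat_le hD hD0 s hlo hhi ai
  have e : ∀ k, weightAlpha cα K k * G.qHat h V (x k) i s ai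
      = weightAlpha cα K k * G.centredGain h V i s (x k i s ai)
        + weightAlpha cα K k * ⨅ s', V i s' := by
    intro k; rw [Game.qHat_eq]; ring
  simp only [e, Finset.sum_add_distrib, ← Finset.sum_mul] at hreg
  rw [sum_weightAlpha hr.one_le_step hr.one_le_K, one_mul] at hreg
  have hv := hr.sum_weight_gainVar_le (h := h) (V := V) i s ν
  have hgv : ∀ k ∈ Icc 1 K, 0 ≤ G.gainVar h V i s (ν k) :=
    fun k _ => Game.gainVar_nonneg (G.roundWeights_update_mem s k i ai)
  have h2 := hr.sum_weight_error_le (fun k => G.gainMean h V i s (fun y => y) (ν k)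
      - G.centredGain h V i s (x k i s ai)) (fun k => G.gainVar h V i s (ν k)) hgv
      ((hx i s).1 ai)
  simp only [mul_sub, Finset.sum_sub_distrib] at h2
  have hv0 : 0 ≤ ∑ k ∈ Icc 1 K, weightAlpha cα K k * G.gainVar h V i s (ν k) :=
    Finset.sum_nonneg fun k hk => mul_nonneg (weightAlpha_nonneg hr.one_le_step hk) (hgv k hk)
  set v₁ := ∑ k ∈ Icc 1 K, weightAlpha cα K k * G.gainVar h V i s (ν k)
  change (⨅ s', V i s') + (∑ k ∈ Icc 1 K, weightAlpha cα K k *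
      G.gainMean h V i s (fun y => y) (ν k)) ≤ _ + _ * (∑ k ∈ Icc 1 K, weightAlpha cα K k *
      G.gainMean h V i s (fun y => y ^ 2) (ν k) - (∑ k ∈ Icc 1 K, weightAlpha cα K k *
      G.gainMean h V i s (fun y => y) (ν k)) ^ 2 + _)
  set Y := ∑ k ∈ Icc 1 K, weightAlpha cα K k * G.gainMean h V i s (fun y => y) (ν k)
  set v := ∑ k ∈ Icc 1 K, weightAlpha cα K k *
      G.gainMean h V i s (fun y => y ^ 2) (ν k) - Y ^ 2
  have hb := hr.errScale_pos
  have hL := hr.L_pos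
  have hα := hr.cα_pos
  have hcb := hr.cb_nonneg
  have hsα := Real.sqrt_nonneg cα
  set b := G.errScale δ K
  set L := G.effHorizon
  have hbv : 0 ≤ b * v := mul_nonneg hb.le (hv0.trans hv)
  have hbL : 0 ≤ b * L := mul_nonneg hb.le hL.le
  have h5 : b * v₁ ≤ b * v := mul_le_mul_of_nonneg_left hv hb.le
  have h6 : 1 * (b * v) ≤ potConst cα cb * (b * v) :=
    mul_le_mul_of_nonneg_right hr.one_le_potConst hbv
  have h7 : (16 * cα + 16 + 2 * Real.sqrt cα) * (b * L) ≤ potConst cα cb * (b * L) := by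
    refine mul_le_mul_of_nonneg_right ?_ hbL
    rw [potConst]; nlinarith [mul_nonneg hα.le hcb]
  nlinarith

end oneStep
end RobustMG
end

noncomputable section
namespace RobustMG
open Finset
open scoped ENNReal

/-! ### The potential recursion at one step -/

section stepBound
variable {m S : ℕ} {A : Fin m → ℕ}

/-- Rewards at step `h` bounded by `1` and next values of span at most `D'` below the cap. -/
structure Game.StepInput (G : Game m S A) (h : ℕ) (V : Fin m → Fin S → ℝ) (D' : ℝ) : Prop where
  R_nonneg : 0 ≤ G.R
  R_le : G.R ≤ 1
  rew : ∀ i s a, |G.r i h s a| ≤ 1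
  span : ∀ i s s', V i s - V i s' ≤ D'
  cap : ∀ i s, V i s ≤ (G.H : ℝ) - h
  span_nonneg : 0 ≤ D'
  span_le : D' ≤ 2 * G.effHorizon
  next_span_le : 2 + (1 - G.R) * D' ≤ 2 * G.effHorizon

variable {G : Game m S A} {h : ℕ} {V : Fin m → Fin S → ℝ} {D' : ℝ} {cα cb δ : ℝ} {K : ℕ}

lemma Game.StepInput.le_centredGain (hi : G.StepInput h V D') (i : Fin m) (s : Fin S)
    (z : Joint A × Fin S) : -1 ≤ G.centredGain h V i s z := by
  have h1 := (abs_le.1 (hi.rew i s z.1)).1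
  have h2 := mul_nonneg (sub_nonneg.2 hi.R_le) (excess_nonneg V i z.2)
  change -1 ≤ G.r i h s z.1 + (1 - G.R) * excess V i z.2
  linarith

lemma Game.Regime.sum_weight_prodMean_eq (hr : G.Regime cα cb δ K) (i : Fin m) (s : Fin S)
    {ν : ℕ → (j : Fin m) → Fin (A j) → ℝ} (hν : ∀ k j, ν k j ∈ stdSimplex ℝ (Fin (A j))) (c : ℝ) :
    ∑ k ∈ Icc 1 K, weightAlpha cα K k * prodMean (ν k)
        (G.discGain i h s fun s' => V i s' + c * excess V i s' ^ 2) + G.R * (⨅ s', V i s')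
      = (⨅ s', V i s') + ∑ k ∈ Icc 1 K, weightAlpha cα K k * G.gainMean h V i s (fun y => y) (ν k)
        + c * ∑ k ∈ Icc 1 K, weightAlpha cα K k * G.quadMean h V i s (ν k) := by
  have e : ∀ k, weightAlpha cα K k * prodMean (ν k)
        (G.discGain i h s fun s' => V i s' + c * excess V i s' ^ 2)
      = weightAlpha cα K k * ((⨅ s', V i s') - G.R * (⨅ s', V i s'))
        + weightAlpha cα K k * G.gainMean h V i s (fun y => y) (ν k)
        + c * (weightAlpha cα K k * G.quadMean h V i s (ν k)) := by
    intro k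
    have := Game.iInf_add_gainMean (G := G) (h := h) (V := V) (i := i) (s := s) (hν k) c
    linear_combination -(weightAlpha cα K k) * this
  simp only [e, Finset.sum_add_distrib, ← Finset.sum_mul, ← Finset.mul_sum]
  rw [sum_weightAlpha hr.one_le_step hr.one_le_K]
  ring

/-- The coefficient of the potential. -/
def Game.potCoeff (G : Game m S A) (cα cb δ : ℝ) (K : ℕ) : ℝ :=
  2 * (potConst cα cb * G.errScale δ K)

/-- The error of a good step. -/
def Game.stepError (G : Game m S A) (cα cb δ : ℝ) (K : ℕ) : ℝ :=
  27 * (potConst cα cb * G.errScale δ K * G.effHorizon)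

lemma Game.Regime.pot_nonneg (hr : G.Regime cα cb δ K) : 0 ≤ potConst cα cb * G.errScale δ K :=
  mul_nonneg (by linarith [hr.one_le_potConst]) hr.errScale_pos.le

section
variable [NeZero S]

lemma Game.StepInput.excess_le (hi : G.StepInput h V D') (i : Fin m) (s : Fin S) :
    excess V i s ≤ D' := by
  obtain ⟨t, ht⟩ := exists_eq_finite_iInf (V i)
  rw [excess, ← ht]
  exact hi.span i s t

lemma Game.StepInput.centredGain_le (hi : G.StepInput h V D') (i : Fin m) (s : Fin S)
    (z : Joint A × Fin S) : G.centredGain h V i s z ≤ -1 + (2 + (1 - G.R) * D') := by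
  have h1 := (abs_le.1 (hi.rew i s z.1)).2
  have h2 := mul_le_mul_of_nonneg_left (hi.excess_le i z.2) (sub_nonneg.2 hi.R_le)
  change G.r i h s z.1 + (1 - G.R) * excess V i z.2 ≤ _
  linarith

/-- The range of the sampled gains, taking the cap into account. -/
lemma Game.StepInput.exists_range (hi : G.StepInput h V D') (x : ℕ → Sample S A) (i : Fin m) :
    ∃ D, 0 ≤ D ∧ D ≤ 2 + (1 - G.R) * D' ∧ (⨅ s', V i s') - 1 + D ≤ (G.H : ℝ) - h + 1 ∧
      (∀ k s ai, (⨅ s', V i s') - 1 ≤ G.qHat h V (x k) i s ai) ∧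
      ∀ k s ai, G.qHat h V (x k) i s ai ≤ (⨅ s', V i s') - 1 + D := by
  obtain ⟨t, ht⟩ := exists_eq_finite_iInf (V i)
  have hm : ⨅ s', V i s' ≤ (G.H : ℝ) - h := by rw [← ht]; exact hi.cap i t
  have hg : 0 ≤ 1 - G.R := sub_nonneg.2 hi.R_le
  -- The gains also lie below the cap, so the range is cut there; truncation then removes at most
  -- the constant part of the bonus.
  refine ⟨min (2 + (1 - G.R) * D') ((G.H : ℝ) - h + 1 - ((⨅ s', V i s') - 1)),
    le_min ?_ (by linarith), min_le_left _ _, ?_, fun k s ai => ?_, fun k s ai => ?_⟩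
  · linarith [mul_nonneg hg hi.span_nonneg]
  · linarith [min_le_right (2 + (1 - G.R) * D') ((G.H : ℝ) - h + 1 - ((⨅ s', V i s') - 1))]
  · rw [Game.qHat_eq]
    linarith [hi.le_centredGain i s (x k i s ai)]
  · rw [← sub_le_iff_le_add']
    refine le_min ?_ ?_
    · rw [Game.qHat_eq]
      linarith [hi.centredGain_le i s (x k i s ai)]
    · have h1 := (abs_le.1 (hi.rew i s (x k i s ai).1)).2
      have h2 := mul_le_mul_of_nonneg_left (hi.cap i (x k i s ai).2) hg
      have h3 := mul_le_mul_of_nonneg_left hm hi.R_nonneg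
      rw [Game.qHat]
      linarith

end

variable [∀ i, NeZero (A i)] {x : ℕ → Sample S A}

/-- The new values `V'`, corrected by a quadratic potential, are up to `f` below the gains of the
played policies and above the gain of every action. -/
def Game.StepBound (G : Game m S A) (cα : ℝ) (K h : ℕ) (V : Fin m → Fin S → ℝ)
    (x : ℕ → Sample S A) (V' : Fin m → Fin S → ℝ) (c f : ℝ) : Prop :=
  ∀ i s, V' i s + c * excess V' i s ^ 2
      ≤ ∑ k ∈ Icc 1 K, weightAlpha cα K k * prodMean (G.roundWeights cα K h V x s k)
          (G.discGain i h s fun s' => V i s' + c * excess V i s' ^ 2) + G.R * (⨅ s', V i s') + f ∧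
    ∀ ai, ∑ k ∈ Icc 1 K, weightAlpha cα K k *
        prodMean (Function.update (G.roundWeights cα K h V x s k) i (Pi.single ai 1))
          (G.discGain i h s fun s' => V i s' + (-c) * excess V i s' ^ 2) + G.R * (⨅ s', V i s')
      ≤ V' i s - c * excess V' i s ^ 2 + f

lemma Game.valueHat_le_cap (i : Fin m) (s : Fin S) :
    G.valueHat cα cb δ K h V x i s ≤ (G.H : ℝ) - h + 1 := min_le_right _ _

variable [NeZero S]

lemma Game.StepInput.valueHat_span (hi : G.StepInput h V D') (hr : G.Regime cα cb δ K)
    (x : ℕ → Sample S A) (i : Fin m) (s s' : Fin S) :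
    G.valueHat cα cb δ K h V x i s - G.valueHat cα cb δ K h V x i s' ≤ 2 + (1 - G.R) * D' := by
  obtain ⟨D, hD0, hD, _, hlo, hhi⟩ := hi.exists_range x i
  exact (hr.valueHat_sub_le (hD.trans hi.next_span_le) hD0 s s' hlo hhi).trans hD

lemma Game.StepInput.excess_valueHat_le (hi : G.StepInput h V D') (hr : G.Regime cα cb δ K)
    (x : ℕ → Sample S A) (i : Fin m) (s : Fin S) :
    excess (G.valueHat cα cb δ K h V x) i s ≤ 2 * G.effHorizon := by
  obtain ⟨t, ht⟩ := exists_eq_finite_iInf (G.valueHat cα cb δ K h V x i)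
  rw [excess, ← ht]
  exact (hi.valueHat_span hr x i s t).trans hi.next_span_le

lemma Game.StepInput.excess_valueHat_le_sub (hi : G.StepInput h V D') (hr : G.Regime cα cb δ K)
    (x : ℕ → Sample S A) (i : Fin m) (s : Fin S) :
    excess (G.valueHat cα cb δ K h V x) i s
      ≤ G.valueHat cα cb δ K h V x i s - (⨅ s', V i s') + 1 := by
  obtain ⟨D, hD0, hD, hcap, hlo, hhi⟩ := hi.exists_range x i
  obtain ⟨t, ht⟩ := exists_eq_finite_iInf (G.valueHat cα cb δ K h V x i)
  rw [excess, ← ht]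
  have := hr.lo_le_valueHat (hD.trans hi.next_span_le) t hlo hhi hcap
  linarith

/-- The two potential inequalities, with the played joint policies for the upper part and with
player `i` fixed to one action for the lower part. -/
lemma Game.StepInput.stepBound_of_good (hi : G.StepInput h V D') (hr : G.Regime cα cb δ K)
    (hx : Regime.Good G cα δ K h V x) :
    G.StepBound cα K h V x (G.valueHat cα cb δ K h V x) (G.potCoeff cα cb δ K)
      (G.stepError cα cb δ K) := by
  intro i s
  have hsq : ∀ ν : ℕ → (j : Fin m) → Fin (A j) → ℝ,
      (∀ k j, ν k j ∈ stdSimplex ℝ (Fin (A j))) →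
      ∑ k ∈ Icc 1 K, weightAlpha cα K k * G.gainMean h V i s (fun y => y ^ 2) (ν k)
        ≤ ∑ k ∈ Icc 1 K, weightAlpha cα K k * G.quadMean h V i s (ν k)
          + (1 + 4 * G.effHorizon) := by
    intro ν hν
    have h1 : ∑ k ∈ Icc 1 K, weightAlpha cα K k * G.gainMean h V i s (fun y => y ^ 2) (ν k)
        ≤ ∑ k ∈ Icc 1 K, weightAlpha cα K k * (G.quadMean h V i s (ν k)
          + (1 + 4 * G.effHorizon)) :=
      Finset.sum_le_sum fun k hk => mul_le_mul_of_nonneg_left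
        (Game.gainMean_sq_le hi.R_nonneg hi.R_le (hi.rew i s)
          (fun s' => (hi.excess_le i s').trans hi.span_le) (hν k))
        (weightAlpha_nonneg hr.one_le_step hk)
    refine h1.trans (le_of_eq ?_)
    simp only [mul_add, Finset.sum_add_distrib, ← Finset.sum_mul]
    rw [sum_weightAlpha hr.one_le_step hr.one_le_K]
    ring
  have hvar : ∀ ν : ℕ → (j : Fin m) → Fin (A j) → ℝ,
      (∀ k j, ν k j ∈ stdSimplex ℝ (Fin (A j))) →
      0 ≤ ∑ k ∈ Icc 1 K, weightAlpha cα K k * G.gainMean h V i s (fun y => y ^ 2) (ν k)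
        - (∑ k ∈ Icc 1 K, weightAlpha cα K k * G.gainMean h V i s (fun y => y) (ν k)) ^ 2 :=
    fun ν hν => le_trans (Finset.sum_nonneg fun k hk =>
      mul_nonneg (weightAlpha_nonneg hr.one_le_step hk) (Game.gainVar_nonneg (hν k)))
      (hr.sum_weight_gainVar_le i s ν)
  have hU0 := excess_nonneg (G.valueHat cα cb δ K h V x) i s
  have hU := hi.excess_valueHat_le hr x i s
  have hUv := hi.excess_valueHat_le_sub hr x i s
  refine ⟨?_, fun ai => ?_⟩
  · have hν : ∀ k j, G.roundWeights cα K h V x s k j ∈ stdSimplex ℝ (Fin (A j)) :=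
      fun k j => G.roundWeights_mem s k j
    rw [hr.sum_weight_prodMean_eq i s hν]
    exact potential_upper hr.pot_nonneg hr.one_le_L hr.small hU0 hU hUv (hsq _ hν) (hvar _ hν)
      (hr.valueHat_le_of_good hx i s)
  · have hν : ∀ k j, Function.update (G.roundWeights cα K h V x s k) i (Pi.single ai 1) j
        ∈ stdSimplex ℝ (Fin (A j)) := fun k j => G.roundWeights_update_mem s k i ai j
    obtain ⟨D, hD0, hD, hcap, hlo, hhi⟩ := hi.exists_range x i
    rw [hr.sum_weight_prodMean_eq i s hν]
    have := potential_lower hr.pot_nonneg hr.one_le_L hr.small hU0 hU hUv (hsq _ hν) (hvar _ hν)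
      (hr.le_valueHat_of_good hx (hD.trans hi.next_span_le) hD0 s hlo hhi hcap ai)
    rw [Game.potCoeff, Game.stepError]
    linarith

/-- Without any assumption on the data the error of a step is of the order of the effective
horizon. -/
lemma Game.StepInput.stepBound (hi : G.StepInput h V D') (hr : G.Regime cα cb δ K)
    (x : ℕ → Sample S A) :
    G.StepBound cα K h V x (G.valueHat cα cb δ K h V x) (G.potCoeff cα cb δ K)
      (G.stepError cα cb δ K + 5 * G.effHorizon) := by
  intro i s
  obtain ⟨D, hD0, hD, hcap, hlo, hhi⟩ := hi.exists_range x i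
  have hD2 := hD.trans hi.next_span_le
  have hU0 := excess_nonneg (G.valueHat cα cb δ K h V x) i s
  have hU := hi.excess_valueHat_le hr x i s
  have hL := hr.one_le_L
  have hβ := hr.pot_nonneg
  have hquad : ∀ ν : ℕ → (j : Fin m) → Fin (A j) → ℝ,
      (∀ k j, ν k j ∈ stdSimplex ℝ (Fin (A j))) →
      0 ≤ G.potCoeff cα cb δ K * ∑ k ∈ Icc 1 K, weightAlpha cα K k * G.quadMean h V i s (ν k) :=
    fun ν hν => mul_nonneg (by rw [Game.potCoeff]; linarith) (Finset.sum_nonneg fun k hk =>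
      mul_nonneg (weightAlpha_nonneg hr.one_le_step hk) (Game.quadMean_nonneg hi.R_le (hν k)))
  have hpot : G.potCoeff cα cb δ K * excess (G.valueHat cα cb δ K h V x) i s ^ 2
      ≤ G.effHorizon := by
    have h1 : excess (G.valueHat cα cb δ K h V x) i s ^ 2 ≤ (2 * G.effHorizon) ^ 2 :=
      pow_le_pow_left₀ hU0 hU 2
    have h2 := mul_le_mul_of_nonneg_left h1 hβ
    have h3 := mul_le_mul_of_nonneg_right hr.small hr.L_pos.le
    rw [Game.potCoeff]
    nlinarith
  have hf : 0 ≤ G.stepError cα cb δ K := by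
    have := mul_nonneg hβ hr.L_pos.le
    rw [Game.stepError]; linarith
  have hv1 := hr.lo_le_valueHat hD2 s hlo hhi hcap
  have hv2 : G.valueHat cα cb δ K h V x i s ≤ (⨅ s', V i s') - 1 + D + 1 := by
    have h1 := hr.valueHat_le (h := h) (V := V) (x := x) (i := i) s
    have h2 := hr.playedGain_add_le hD2 s hlo hhi
    have h3 := hr.cb_mul_errScale_le
    have h4 := mul_nonneg (mul_nonneg hr.cb_nonneg hr.errScale_pos.le) hr.L_pos.le
    linarith
  refine ⟨?_, fun ai => ?_⟩
  · have hν : ∀ k j, G.roundWeights cα K h V x s k j ∈ stdSimplex ℝ (Fin (A j)) :=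
      fun k j => G.roundWeights_mem s k j
    rw [hr.sum_weight_prodMean_eq i s hν]
    have h1 := hr.le_sum_weight (f := fun k => G.gainMean h V i s (fun y => y)
      (G.roundWeights cα K h V x s k)) fun k _ =>
        Game.le_gainMean i s (hν k) (hi.le_centredGain i s)
    linarith [hquad _ hν]
  · have hν : ∀ k j, Function.update (G.roundWeights cα K h V x s k) i (Pi.single ai 1) j
        ∈ stdSimplex ℝ (Fin (A j)) := fun k j => G.roundWeights_update_mem s k i ai j
    rw [hr.sum_weight_prodMean_eq i s hν]
    have h1 := hr.sum_weight_le (f := fun k => G.gainMean h V i s (fun y => y)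
      (Function.update (G.roundWeights cα K h V x s k) i (Pi.single ai 1))) fun k _ =>
        Game.gainMean_le i s (hν k) (hi.centredGain_le i s)
    have h2 := hi.next_span_le
    linarith [hquad _ hν]

/-- The probability that the data of a step are not good. -/
lemma Game.StepInput.pexp_not_good_le (hi : G.StepInput h V D') (hr : G.Regime cα cb δ K) :
    pexp (G.roundsLaw cα K h V K) ({x | ¬ Regime.Good G cα δ K h V x}.indicator 1)
      ≤ (∑ i, ∑ _s : Fin S, ((A i : ℝ≥0∞) + 2))
        * ENNReal.ofReal (Real.exp (-(8 * logFactor S A δ K))) := by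
  have hb := hr.errScale_pos
  have hK := hr.K_pos
  have hL := hr.L_pos
  have hα := hr.cα_pos
  have hι := hr.logFactor_pos
  refine Game.pexp_not_goodData_le (lo := -1) (D := 2 * G.effHorizon)
    (w := cα * logFactor S A δ K / K) (fun k hk => weightAlpha_nonneg hr.one_le_step hk)
    (fun k hk => hr.weight_le hk) ?_ ?_ (by positivity) ?_ ?_
    (fun i s z => hi.le_centredGain i s z)
    (fun i s z => (hi.centredGain_le i s z).trans (by linarith [hi.next_span_le])) _
  · rw [Regime.gainParam]; positivity
  · rw [Regime.varParam]; positivity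
  · rw [Regime.gainParam, div_mul_cancel₀ _ (by positivity)]
    linarith [hr.errScale_mul_le, mul_pos hb hL]
  · rw [Regime.varParam, mul_assoc, one_div, inv_mul_cancel₀ (by positivity)]

end stepBound
end RobustMG
end

noncomputable section
namespace RobustMG
open Finset
open scoped ENNReal

/-! ### The induction over the steps -/

section induction
variable {S : ℕ} {A : Fin 2 → ℕ} {G : Game 2 S A}

lemma Game.bestDisc_congr {π π' : Profile S A} (i : Fin 2) {n : ℕ}
    (h : ∀ j, ∀ k < n, π j (G.H - k) = π' j (G.H - k)) :
    G.bestDisc π i n = G.bestDisc π' i n := by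
  induction n with
  | zero => rfl
  | succ n ih =>
    funext s
    rw [Game.bestDisc, Game.bestDisc, ih fun j k hk => h j k (by omega)]
    simp only [h _ n (Nat.lt_succ_self n)]

lemma Game.discGain_add_const (i : Fin 2) (h : ℕ) (s : Fin S) (W : Fin S → ℝ) (c : ℝ)
    (a : Joint A) :
    G.discGain i h s (fun s' => W s' + c) a = G.discGain i h s W a + (1 - G.R) * c := by
  simp only [Game.discGain, mul_add, Finset.sum_add_distrib, ← Finset.sum_mul, simplex_sum]
  ring

/-- The state after `n` steps: the value estimates have controlled span, and up to an error that
grows by `f` per step and by a multiple of the effective horizon at each of `N` exceptional steps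
they bracket the optimal discounted values. -/
structure Game.Inv (G : Game 2 S A) (c f : ℝ) (n : ℕ) (o : (Fin 2 → Fin S → ℝ) × Profile S A)
    (N : ℕ) : Prop where
  profile : ∀ i, ∀ h ∈ Icc (G.H - n + 1) G.H, ∀ s, o.2 i h s ∈ stdSimplex ℝ (Fin (A i))
  span : ∀ i s s', o.1 i s - o.1 i s' ≤ 2 * ∑ j ∈ range n, (1 - G.R) ^ j
  cap : ∀ i s, o.1 i s ≤ n
  -- `k` collects the `R * min` shifts, so that `o.1 i s - k i` estimates a discounted value; `e` is
  -- its current error, `E` bounds the earlier sums of optimal values, and `d` their contribution to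
  -- the gap. The potential has opposite signs in the first two clauses. The combination `4 * e + d`
  -- loses nothing to discounting: what leaves `e` enters `d`.
  exists_bounds : ∃ (k : Fin 2 → ℝ) (e d : ℝ) (E : ℕ → ℝ),
    (∀ i s, G.bestDisc o.2 i n s ≤ o.1 i s - k i - c * excess o.1 i s ^ 2 + e) ∧
    (∀ s, (o.1 0 s - k 0 + c * excess o.1 0 s ^ 2) + (o.1 1 s - k 1 + c * excess o.1 1 s ^ 2)
      ≤ 2 * e) ∧
    (∀ j < n, ∀ s, G.bestDisc o.2 0 j s + G.bestDisc o.2 1 j s ≤ E j) ∧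
    G.R * ∑ j ∈ range n, E j ≤ d ∧ 4 * e + d ≤ 4 * (n * f + N * (5 * G.effHorizon))

/-- Contamination acts as discounting, which is why the span of the values is governed by `min {H,
1/R}`. -/
lemma Game.sum_pow_le_effHorizon (hR0 : 0 ≤ G.R) (hR1 : G.R < 1) {n : ℕ} (hn : n ≤ G.H) :
    ∑ j ∈ range n, (1 - G.R) ^ j ≤ G.effHorizon := by
  have h1 : ∑ j ∈ range n, (1 - G.R) ^ j ≤ G.H := by
    calc ∑ j ∈ range n, (1 - G.R) ^ j ≤ ∑ _j ∈ range n, (1 : ℝ) :=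
          Finset.sum_le_sum fun j _ => pow_le_one₀ (by linarith) (by linarith)
      _ = n := by simp
      _ ≤ G.H := by exact_mod_cast hn
  rw [Game.effHorizon]
  split_ifs with hR
  · exact h1
  · refine le_min h1 ?_
    have hRpos : 0 < G.R := lt_of_le_of_ne hR0 (Ne.symm hR)
    rw [le_div_iff₀ hRpos]
    have h2 := geom_sum_mul (1 - G.R) n
    have h3 : 0 ≤ (1 - G.R) ^ n := pow_nonneg (by linarith) n
    linarith

/-- The initial state satisfies the invariant. -/
lemma Game.inv_zero [NeZero S] (c f : ℝ) : G.Inv c f 0 (0, 0) 0 where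
  profile := by
    intro i h hh s
    simp only [mem_Icc] at hh
    omega
  span := by intro i s s'; simp
  cap := by intro i s; simp
  exists_bounds := by
    refine ⟨0, 0, 0, 0, ?_, ?_, ?_, ?_, ?_⟩ <;> simp [Game.bestDisc, excess]

/-- Against a fixed action, averaging the weights of the single opponent averages the gain. -/
lemma sum_mul_prodMean_update {κ : Type} (t : Finset κ) (w : κ → ℝ)
    (ν : κ → (j : Fin 2) → Fin (A j) → ℝ) (i : Fin 2) (p : Fin (A i) → ℝ) (F : Joint A → ℝ) :
    ∑ k ∈ t, w k * prodMean (Function.update (ν k) i p) F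
      = prodMean (Function.update (fun j a => ∑ k ∈ t, w k * ν k j a) i p) F := by
  -- With two players, only one factor remains once player `i` is fixed, so the product is linear in
  -- the round's policies.
  obtain ⟨j, hj⟩ : ∃ j : Fin 2, j ≠ i := exists_ne i
  have hup : ∀ μ : (j : Fin 2) → Fin (A j) → ℝ, Function.update μ i p
      = Function.update (Function.update (fun (l : Fin 2) (_ : Fin (A l)) => (0 : ℝ)) i p)
          j (μ j) := by
    intro μ
    funext l
    by_cases hl : l = i
    · subst hl
      rw [Function.update_self, Function.update_of_ne hj.symm, Function.update_self]
    · have : l = j := by omega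
      subst this
      rw [Function.update_self, Function.update_of_ne hl]
  rw [hup fun j a => ∑ k ∈ t, w k * ν k j a,
    prodMean_update_sum t _ j w (fun k => ν k j) F]
  exact Finset.sum_congr rfl fun k _ => by rw [← hup (ν k)]

lemma Game.Inv.stepInput {c f : ℝ} {n N : ℕ} {o : (Fin 2 → Fin S → ℝ) × Profile S A}
    (hG : G.IsZeroSum) (hR0 : 0 ≤ G.R) (hR1 : G.R < 1) (hn : n < G.H) (hI : G.Inv c f n o N) :
    G.StepInput (G.H - n) o.1 (2 * ∑ j ∈ range n, (1 - G.R) ^ j) where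
  R_nonneg := hR0
  R_le := hR1.le
  rew := by
    intro i s a
    obtain ⟨⟨h1, h2⟩, h3⟩ := hG (G.H - n) (mem_Icc.2 ⟨by omega, by omega⟩) s a
    fin_cases i
    · exact abs_le.2 ⟨by simp only [Fin.zero_eta]; linarith, h2⟩
    · simp only [Fin.mk_one, h3, abs_neg]
      exact abs_le.2 ⟨by linarith, h2⟩
  span := hI.span
  cap := by
    intro i s
    rw [Nat.cast_sub hn.le]
    linarith [hI.cap i s]
  span_nonneg := mul_nonneg (by norm_num) (Finset.sum_nonneg fun j _ => pow_nonneg (by linarith) j)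
  span_le := by
    have := Game.sum_pow_le_effHorizon hR0 hR1 hn.le
    linarith
  next_span_le := by
    have h1 := Game.sum_pow_le_effHorizon hR0 hR1 (n := n + 1) hn
    rw [Finset.sum_range_succ', pow_zero] at h1
    have h2 : (1 - G.R) * ∑ j ∈ range n, (1 - G.R) ^ j = ∑ j ∈ range n, (1 - G.R) ^ (j + 1) := by
      rw [Finset.mul_sum]
      exact Finset.sum_congr rfl fun j _ => by ring
    linarith

variable [∀ i, NeZero (A i)] {cα cb δ : ℝ} {K h : ℕ} {V : Fin 2 → Fin S → ℝ}
  {x : ℕ → Sample S A}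

lemma Game.sum_weight_prodMean_update (i : Fin 2) (s : Fin S) (ai : Fin (A i))
    (F : Joint A → ℝ) :
    ∑ k ∈ Icc 1 K, weightAlpha cα K k *
        prodMean (Function.update (G.roundWeights cα K h V x s k) i (Pi.single ai 1)) F
      = prodMean (Function.update (fun j => G.avgPolicy cα K h V x j s) i (Pi.single ai 1)) F :=
  sum_mul_prodMean_update (Icc 1 K) (fun k => weightAlpha cα K k)
    (fun k => G.roundWeights cα K h V x s k) i (Pi.single ai 1) F

lemma Game.Regime.avgPolicy_mem (hr : G.Regime cα cb δ K) (i : Fin 2) (s : Fin S) :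
    G.avgPolicy cα K h V x i s ∈ stdSimplex ℝ (Fin (A i)) := by
  refine ⟨fun a => Finset.sum_nonneg fun k hk =>
    mul_nonneg (weightAlpha_nonneg hr.one_le_step hk) (simplex_nonneg _ _), ?_⟩
  simp only [Game.avgPolicy]
  rw [Finset.sum_comm]
  simp only [← Finset.mul_sum, simplex_sum, mul_one]
  exact sum_weightAlpha hr.one_le_step hr.one_le_K

/-- The state after one more step with the data `x`. -/
def Game.stepState (G : Game 2 S A) (cα cb δ : ℝ) (K n : ℕ)
    (o : (Fin 2 → Fin S → ℝ) × Profile S A) (x : ℕ → Sample S A) :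
    (Fin 2 → Fin S → ℝ) × Profile S A :=
  (G.valueHat cα cb δ K (G.H - n) o.1 x,
    fun i => Function.update (o.2 i) (G.H - n) (G.avgPolicy cα K (G.H - n) o.1 x i))

variable [NeZero S]

/-- A step with error `f'` preserves the invariant. -/
lemma Game.Inv.step {c f f' : ℝ} {n N N' : ℕ} {o : (Fin 2 → Fin S → ℝ) × Profile S A}
    (hG : G.IsZeroSum) (hR0 : 0 ≤ G.R) (hR1 : G.R < 1) (hc : 0 ≤ c) (hr : G.Regime cα cb δ K)
    (hn : n < G.H) (hI : G.Inv c f n o N)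
    (hb : G.StepBound cα K (G.H - n) o.1 x (G.valueHat cα cb δ K (G.H - n) o.1 x) c f')
    (hf : f' + N * (5 * G.effHorizon) ≤ f + N' * (5 * G.effHorizon)) :
    G.Inv c f (n + 1) (G.stepState cα cb δ K n o x) N' := by
  have hin := hI.stepInput hG hR0 hR1 hn
  have hmem : G.H - n ∈ Icc 1 G.H := mem_Icc.2 ⟨by omega, by omega⟩
  have hg : 0 ≤ 1 - G.R := by linarith
  obtain ⟨k, e, d, E, hlow, hup, hE, hEd, hed⟩ := hI.exists_bounds
  set V' := G.valueHat cα cb δ K (G.H - n) o.1 x with hV'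
  have hbest : ∀ i, ∀ j ≤ n, G.bestDisc (G.stepState cα cb δ K n o x).2 i j
      = G.bestDisc o.2 i j := by
    intro i j hj
    refine Game.bestDisc_congr i fun l r hr => ?_
    exact Function.update_of_ne (by omega) _ _
  have havg : ∀ j s, (G.stepState cα cb δ K n o x).2 j (G.H - n) s
      = G.avgPolicy cα K (G.H - n) o.1 x j s := by
    intro j s
    simp [Game.stepState]
  refine ⟨?_, ?_, ?_, ?_⟩
  · intro i h hh s
    by_cases hhn : h = G.H - n
    · subst hhn
      rw [havg]
      exact hr.avgPolicy_mem i s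
    · have : (G.stepState cα cb δ K n o x).2 i h = o.2 i h := Function.update_of_ne hhn _ _
      rw [this]
      refine hI.profile i h ?_ s
      simp only [mem_Icc] at hh ⊢
      omega
  · intro i s s'
    refine (hin.valueHat_span hr x i s s').trans (le_of_eq ?_)
    rw [Finset.sum_range_succ', pow_zero, mul_add, ← mul_assoc, mul_comm (1 - G.R) 2, mul_assoc,
      Finset.mul_sum (range n) _ (1 - G.R)]
    simp only [pow_succ']
    ring
  · intro i s
    have h1 : V' i s ≤ _ := Game.valueHat_le_cap i s
    rw [Nat.cast_sub hn.le] at h1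
    change V' i s ≤ _
    push_cast
    linarith
  -- The shifts and errors follow the Bellman recursion: old ones are discounted and the new `R *
  -- min` and `f'` are added. The bound `4 * e` for the sum of optimal values at time `n` is
  -- recorded, so `4 * e + d` grows by exactly `4 * f'`.
  · refine ⟨fun i => (1 - G.R) * k i + G.R * ⨅ s', o.1 i s', (1 - G.R) * e + f',
      d + G.R * (4 * e), Function.update E n (4 * e), ?_, ?_, ?_, ?_, ?_⟩
    · intro i s
      change _ ≤ V' i s - _ - c * excess V' i s ^ 2 + _
      rw [Game.bestDisc]
      refine ciSup_le fun ai => ?_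
      simp only [havg]
      have hμ : ∀ j, Function.update (fun j => G.avgPolicy cα K (G.H - n) o.1 x j s) i
          (Pi.single ai 1) j ∈ stdSimplex ℝ (Fin (A j)) := by
        intro j
        by_cases hj : j = i
        · subst hj
          rw [Function.update_self]
          exact single_mem_stdSimplex ℝ ai
        · rw [Function.update_of_ne hj]
          exact hr.avgPolicy_mem j s
      have h1 := (hb i s).2 ai
      rw [Game.sum_weight_prodMean_update] at h1
      have h2 : prodMean (Function.update (fun j => G.avgPolicy cα K (G.H - n) o.1 x j s) i
            (Pi.single ai 1))
            (G.discGain i (G.H - n) s (G.bestDisc (G.stepState cα cb δ K n o x).2 i n))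
          ≤ prodMean (Function.update (fun j => G.avgPolicy cα K (G.H - n) o.1 x j s) i
            (Pi.single ai 1))
            (G.discGain i (G.H - n) s fun s' => o.1 i s' + (-c) * excess o.1 i s' ^ 2)
            + (1 - G.R) * (e - k i) := by
        rw [← prodMean_const _ (fun j => (hμ j).2) ((1 - G.R) * (e - k i)), ← prodMean_add]
        refine prodMean_mono _ (fun j => (hμ j).1) fun a => ?_
        rw [← Game.discGain_add_const, hbest i n le_rfl]
        refine Game.discGain_mono hR1.le i _ s (fun s' => ?_) a
        linarith [hlow i s']
      refine h2.trans ?_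
      nlinarith
    · intro s
      change (V' 0 s - _ + c * excess V' 0 s ^ 2) + (V' 1 s - _ + c * excess V' 1 s ^ 2) ≤ _
      have h0 := (hb 0 s).1
      have h1 := (hb 1 s).1
      have h2 : ∑ k ∈ Icc 1 K, weightAlpha cα K k * prodMean (G.roundWeights cα K (G.H - n) o.1 x s k)
            (G.discGain 0 (G.H - n) s fun s' => o.1 0 s' + c * excess o.1 0 s' ^ 2)
          + ∑ k ∈ Icc 1 K, weightAlpha cα K k * prodMean (G.roundWeights cα K (G.H - n) o.1 x s k)
            (G.discGain 1 (G.H - n) s fun s' => o.1 1 s' + c * excess o.1 1 s' ^ 2)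
          ≤ (1 - G.R) * (2 * e + k 0 + k 1) := by
        -- Both players average over the same joint law in each round, so the opposite rewards
        -- cancel and only the next values, bounded by `hup`, remain.
        rw [← Finset.sum_add_distrib]
        simp only [← mul_add, ← prodMean_add]
        refine hr.sum_weight_le fun l _ => ?_
        refine (prodMean_mono _ (fun j => (G.roundWeights_mem s l j).1) fun a => ?_).trans
          (le_of_eq (prodMean_const _ (fun j => (G.roundWeights_mem s l j).2) _))
        simp only [Game.discGain, (hG _ hmem s a).2]
        have h3 : ∑ s', G.P0 (G.H - n) s a s' * (o.1 0 s' + c * excess o.1 0 s' ^ 2)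
            + ∑ s', G.P0 (G.H - n) s a s' * (o.1 1 s' + c * excess o.1 1 s' ^ 2)
            ≤ 2 * e + k 0 + k 1 := by
          rw [← Finset.sum_add_distrib]
          simp only [← mul_add]
          refine mean_le (G.P0 (G.H - n) s a) _ fun s' => ?_
          linarith [hup s']
        nlinarith [mul_le_mul_of_nonneg_left h3 hg]
      nlinarith
    · intro j hj s
      rw [hbest 0 j (by omega), hbest 1 j (by omega)]
      by_cases hjn : j = n
      · subst hjn
        rw [Function.update_self]
        have h0 := hlow 0 s
        have h1 := hlow 1 s
        have h2 := hup s
        have h3 := mul_nonneg hc (sq_nonneg (excess o.1 0 s))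
        have h4 := mul_nonneg hc (sq_nonneg (excess o.1 1 s))
        linarith
      · rw [Function.update_of_ne hjn]
        exact hE j (by omega) s
    · rw [Finset.sum_range_succ, Function.update_self, mul_add]
      refine add_le_add (le_trans (le_of_eq ?_) hEd) le_rfl
      congr 1
      refine Finset.sum_congr rfl fun j hj => Function.update_of_ne ?_ _ _
      have := mem_range.1 hj
      omega
    · push_cast
      nlinarith

/-- The invariant after the last step bounds the equilibrium gap. -/
lemma Game.Inv.isRobustNE {c f ε : ℝ} {N : ℕ} {o : (Fin 2 → Fin S → ℝ) × Profile S A}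
    (hG : G.IsZeroSum) (hR0 : 0 ≤ G.R) (hR1 : G.R < 1) (hc : 0 ≤ c) (hI : G.Inv c f G.H o N)
    (hε : 4 * (G.H * f + N * (5 * G.effHorizon)) ≤ ε) : G.IsRobustNE ε o.2 := by
  obtain ⟨k, e, d, E, hlow, hup, hE, hEd, hed⟩ := hI.exists_bounds
  have hprof : G.IsProfile o.2 := by
    intro i h hh s
    exact hI.profile i h (by simpa using hh) s
  refine ⟨hprof, ?_⟩
  -- Adding the two lower clauses and the upper clause gives `2 * e + 2 * e`; the potentials are
  -- nonnegative and are dropped.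
  have hgap := hG.gapNE_le hR0 hR1.le hprof (Function.update E G.H (4 * e)) (by
    intro n hn s
    by_cases hnH : n = G.H
    · subst hnH
      rw [Function.update_self]
      have h0 := hlow 0 s
      have h1 := hlow 1 s
      have h2 := hup s
      have h3 := mul_nonneg hc (sq_nonneg (excess o.1 0 s))
      have h4 := mul_nonneg hc (sq_nonneg (excess o.1 1 s))
      linarith
    · rw [Function.update_of_ne hnH]
      exact hE n (by omega) s)
  rw [Function.update_self] at hgap
  have h5 : ∑ j ∈ range G.H, Function.update E G.H (4 * e) j = ∑ j ∈ range G.H, E j :=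
    Finset.sum_congr rfl fun j hj => Function.update_of_ne (by
      have := mem_range.1 hj
      omega) _ _
  rw [h5] at hgap
  linarith

/-- The least number of exceptional steps compatible with a state. -/
def Game.badCount (G : Game 2 S A) (c f : ℝ) (n : ℕ)
    (o : (Fin 2 → Fin S → ℝ) × Profile S A) : ℝ≥0∞ :=
  ⨅ N : ℕ, ⨅ _ : G.Inv c f n o N, (N : ℝ≥0∞)

/-- The expected number of exceptional steps grows at most linearly. -/
lemma Game.Regime.pexp_badCount_le (hr : G.Regime cα cb δ K) (hG : G.IsZeroSum) (hR0 : 0 ≤ G.R)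
    (hR1 : G.R < 1) {n : ℕ} (hn : n ≤ G.H) :
    pexp (G.run cα cb δ K n) (G.badCount (G.potCoeff cα cb δ K) (G.stepError cα cb δ K) n)
      ≤ n * ((∑ i, ∑ _s : Fin S, ((A i : ℝ≥0∞) + 2))
        * ENNReal.ofReal (Real.exp (-(8 * logFactor S A δ K)))) := by
  set p := (∑ i, ∑ _s : Fin S, ((A i : ℝ≥0∞) + 2))
        * ENNReal.ofReal (Real.exp (-(8 * logFactor S A δ K))) with hp
  set c := G.potCoeff cα cb δ K with hcdef
  set f := G.stepError cα cb δ K with hfdef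
  have hc : 0 ≤ c := by
    have := hr.pot_nonneg
    rw [hcdef, Game.potCoeff]; linarith
  induction n with
  | zero =>
    rw [Game.run, pexp_pure]
    refine (iInf₂_le 0 (Game.inv_zero c f)).trans ?_
    simp
  | succ n ih =>
    have hnH : n < G.H := hn
    rw [Game.run, pexp_bind]
    simp only [pexp_map]
    change pexp (G.run cα cb δ K n) (fun o => pexp (G.roundsLaw cα K (G.H - n) o.1 K)
      fun x => G.badCount c f (n + 1) (G.stepState cα cb δ K n o x)) ≤ _
    have hstep : ∀ o, pexp (G.roundsLaw cα K (G.H - n) o.1 K)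
        (fun x => G.badCount c f (n + 1) (G.stepState cα cb δ K n o x))
        ≤ G.badCount c f n o + p := by
      intro o
      rw [Game.badCount, ENNReal.iInf_add]
      -- Any count compatible with the old state gives one for the new state: the same after good
      -- data, one more after bad data.
      refine le_iInf fun N => ?_
      by_cases hI : G.Inv c f n o N
      · rw [iInf_pos hI]
        have hin := hI.stepInput hG hR0 hR1 hnH
        have hx : ∀ x, G.badCount c f (n + 1) (G.stepState cα cb δ K n o x)
            ≤ (N : ℝ≥0∞) + {x | ¬ Regime.Good G cα δ K (G.H - n) o.1 x}.indicator 1 x := by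
          intro x
          by_cases hgood : Regime.Good G cα δ K (G.H - n) o.1 x
          · rw [Set.indicator_of_notMem (by simpa using hgood), add_zero]
            exact iInf₂_le N (hI.step hG hR0 hR1 hc hr hnH (hin.stepBound_of_good hr hgood) le_rfl)
          · rw [Set.indicator_of_mem (by simpa using hgood)]
            refine (iInf₂_le (N + 1) (hI.step hG hR0 hR1 hc hr hnH (hin.stepBound hr x) ?_)).trans ?_
            · push_cast
              linarith
            · simp
        refine (pexp_mono _ hx).trans ?_
        rw [pexp_add, pexp_const]
        exact add_le_add le_rfl (hin.pexp_not_good_le hr)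
      · rw [iInf_neg hI]
        simp
    refine (pexp_mono _ hstep).trans ?_
    rw [pexp_add, pexp_const, Nat.cast_add, Nat.cast_one, add_mul, one_mul]
    exact add_le_add (ih hnH.le) le_rfl

end induction
end RobustMG
end

/-! ### Constants and conclusion -/

open Finset RobustMG in
/-- The sample size condition puts the algorithm into the regime of the analysis. -/
lemma RobustMG.Game.regime_of_le {S : ℕ} [NeZero S] {A : Fin 2 → ℕ} [∀ i, NeZero (A i)]
    {G : RobustMG.Game 2 S A} {cα cb C δ ε : ℝ} {K : ℕ} (hα : 0 < cα)
    (hcb : 4 * Real.sqrt (cα * (3 * Real.exp (1 / cα))) ≤ cb)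
    (hC1 : 8 * (cα * (3 * Real.exp (1 / cα))) ≤ C) (hC2 : 8 * Real.exp (1 / cα) ≤ C)
    (hC3 : (216 * potConst cα cb) ^ 2 ≤ C) (hR0 : 0 ≤ G.R) (hR1 : G.R < 1) (hε : 0 < ε)
    (hεH : ε ≤ G.H) (hδ : 0 < δ) (hδ1 : δ < 1) (hK : 0 < K)
    (h : C * (G.H : ℝ) ^ 2 * G.effHorizon * logFactor S A δ K ^ 3 ≤ K * ε ^ 2) :
    G.Regime cα cb δ K ∧ 216 * potConst cα cb * (G.errScale δ K * G.effHorizon) * G.H ≤ ε := by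
  have hC : 0 < C := lt_of_lt_of_le (by positivity) hC2
  have hκ : 0 < potConst cα cb := by
    have : 0 ≤ cb := le_trans (by positivity) hcb
    rw [potConst]; positivity
  have hHpos : (0 : ℝ) < G.H := hε.trans_le hεH
  have hH1 : (1 : ℝ) ≤ G.H := by
    have : 0 < G.H := by exact_mod_cast hHpos
    exact_mod_cast this
  have hK1 : (1 : ℝ) ≤ K := by exact_mod_cast hK
  have hS1 : (1 : ℝ) ≤ S := by exact_mod_cast NeZero.one_le
  have hA1 : ∀ i, (1 : ℝ) ≤ A i := fun i => by exact_mod_cast NeZero.one_le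
  have hL1 : 1 ≤ G.effHorizon := by
    rw [Game.effHorizon]
    split_ifs with hR
    · exact hH1
    · have hRpos : 0 < G.R := lt_of_le_of_ne hR0 (Ne.symm hR)
      exact le_min hH1 (by rw [le_div_iff₀ hRpos]; linarith)
  have hsum : (∑ j, (A j : ℝ)) = A 0 + A 1 := Fin.sum_univ_two _
  have hA2 : 2 ≤ ∑ j, (A j : ℝ) := by rw [hsum]; linarith [hA1 0, hA1 1]
  have hlogK0 : 0 ≤ Real.log K := Real.log_nonneg hK1
  have harg : ∀ y : ℝ, 0 ≤ y → y ≤ K * S * (∑ j, (A j : ℝ)) →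
      y ≤ K * S * (∑ j, (A j : ℝ)) / δ := by
    intro y hy0 hy
    rw [le_div_iff₀ hδ]
    exact (mul_le_of_le_one_right hy0 hδ1.le).trans hy
  -- There are at least two actions in total, so the logarithm contains `log 2`, which exceeds
  -- `1/2`.
  have hι1 : Real.log 2 + Real.log K ≤ logFactor S A δ K := by
    rw [← Real.log_mul (by norm_num) (by positivity)]
    refine Real.log_le_log (by positivity) (harg _ (by positivity) ?_)
    have : (K : ℝ) * 1 * 2 ≤ K * S * ∑ j, (A j : ℝ) := by gcongr
    linarith
  have hlog2 := Real.log_two_gt_d9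
  have hhalf : 1 / 2 ≤ logFactor S A δ K := by linarith
  set ι := logFactor S A δ K with hι
  set L := G.effHorizon with hL
  have hιpos : 0 < ι := by linarith
  have hι2 : 1 / 4 ≤ ι ^ 2 := by nlinarith
  have hι3 : ι / 4 ≤ ι ^ 3 := by nlinarith
  have hKbig : C * ι ^ 3 ≤ K := by
    have h1 : C * ε ^ 2 * 1 * ι ^ 3 ≤ C * (G.H : ℝ) ^ 2 * L * ι ^ 3 := by gcongr
    have h2 : C * ι ^ 3 * ε ^ 2 ≤ K * ε ^ 2 := by linarith
    exact le_of_mul_le_mul_right h2 (by positivity)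
  have hbL : (G.errScale δ K * L) ^ 2 = ι ^ 3 * L / K := by
    rw [Game.errScale, mul_pow, Real.sq_sqrt (by positivity), ← hι, ← hL]
    field_simp
  have hbound : (G.errScale δ K * L * G.H) ^ 2 * C ≤ ε ^ 2 := by
    rw [mul_pow, hbL]
    have : ι ^ 3 * L / K * (G.H : ℝ) ^ 2 * C = C * (G.H : ℝ) ^ 2 * L * ι ^ 3 / K := by ring
    rw [this, div_le_iff₀ (by positivity)]
    linarith
  have hmain : 216 * potConst cα cb * (G.errScale δ K * L) * G.H ≤ ε := by
    refine le_of_sq_le_sq ?_ hε.le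
    have h1 : (216 * potConst cα cb * (G.errScale δ K * L) * G.H) ^ 2
        = (G.errScale δ K * L * G.H) ^ 2 * (216 * potConst cα cb) ^ 2 := by ring
    rw [h1]
    exact (mul_le_mul_of_nonneg_left hC3 (sq_nonneg _)).trans hbound
  refine ⟨⟨hα, hK, hL1, ?_, ?_, by linarith, ?_, hhalf, hcb, ?_⟩, hmain⟩
  · have h1 : Real.exp (1 / cα) ≤ K := by
      have : (1 / 2) ^ 3 ≤ ι ^ 3 := pow_le_pow_left₀ (by norm_num) hhalf 3
      have h2 := mul_le_mul hC2 this (by norm_num) hC.le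
      linarith
    have h2 := Real.log_le_log (Real.exp_pos _) h1
    rw [Real.log_exp, div_le_iff₀ hα] at h2
    linarith
  · set M := 3 * Real.exp (1 / cα)
    have hM : 0 < cα * M := by positivity
    have h1 : C * (Real.log K / 4) ≤ K := by
      refine le_trans (mul_le_mul_of_nonneg_left ?_ hC.le) hKbig
      linarith
    have h2 : 8 * (cα * M) * (Real.log K / 4) ≤ C * (Real.log K / 4) :=
      mul_le_mul_of_nonneg_right hC1 (by linarith)
    linarith
  · intro i
    refine Real.log_le_log (by linarith [hA1 i]) (harg _ (by linarith [hA1 i]) ?_)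
    have h1 : (A i : ℝ) ≤ ∑ j, (A j : ℝ) :=
      Finset.single_le_sum (f := fun j => (A j : ℝ)) (fun j _ => by positivity) (mem_univ i)
    have h2 : 1 * 1 * ∑ j, (A j : ℝ) ≤ K * S * ∑ j, (A j : ℝ) := by gcongr
    linarith
  -- Smallness of the error scale follows from the accuracy bound, because `ε ≤ H`.
  · have h1 : 216 * potConst cα cb * (G.errScale δ K * L) * G.H ≤ G.H := hmain.trans hεH
    have h2 : 216 * potConst cα cb * (G.errScale δ K * L) ≤ 1 := by
      rw [← mul_le_mul_iff_left₀ hHpos]; linarith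
    have h3 : 0 ≤ potConst cα cb * (G.errScale δ K * L) :=
      mul_nonneg hκ.le (mul_nonneg (Real.sqrt_nonneg _) (by linarith))
    linarith

open RobustMG in
theorem corollary1 :
    ∀ cα : ℝ, 0 < cα → ∃ cb₀ : ℝ, 0 < cb₀ ∧ ∀ cb : ℝ, cb₀ ≤ cb → ∃ C : ℝ, 0 < C ∧
      ∀ (S : ℕ) [NeZero S] (A : Fin 2 → ℕ) [∀ i, NeZero (A i)] (G : RobustMG.Game 2 S A),
        G.IsZeroSum → 0 ≤ G.R → G.R < 1 →
        ∀ (ε δ : ℝ) (K : ℕ), 0 < ε → ε ≤ G.H → 0 < δ → δ < 1 → 0 < K →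
          C * (G.H : ℝ) ^ 3 * S * (A 0 + A 1) / ε ^ 2 * G.effHorizon *
              Real.log (K * S * (A 0 + A 1) / δ) ^ 3
            ≤ (K : ℝ) * G.H * S * (A 0 + A 1) →
          ENNReal.ofReal (1 - δ) ≤
            (G.output cα cb δ K).toOuterMeasure {π | G.IsRobustNE ε π} := by
  intro cα hα
  refine ⟨4 * Real.sqrt (cα * (3 * Real.exp (1 / cα))), by positivity, fun cb hcb => ?_⟩
  have hκ0 := sq_nonneg (216 * potConst cα cb)
  have hM0 : 0 < cα * (3 * Real.exp (1 / cα)) := by positivity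
  have hE0 := Real.exp_pos (1 / cα)
  -- The summands serve, in order: small step sizes after the burn-in, `1 ≤ cα * log K`, the
  -- accuracy (`216 = 2 * 4 * 27`), and the failure probability.
  refine ⟨8 * (cα * (3 * Real.exp (1 / cα))) + 8 * Real.exp (1 / cα)
    + (216 * potConst cα cb) ^ 2 + 960, by positivity, ?_⟩
  set C := 8 * (cα * (3 * Real.exp (1 / cα))) + 8 * Real.exp (1 / cα)
    + (216 * potConst cα cb) ^ 2 + 960 with hCdef
  intro S _ A _ G hG hR0 hR1 ε δ K hε hεH hδ hδ1 hK hyp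
  have hC960 : 960 ≤ C := by linarith
  have hS1 : (1 : ℝ) ≤ S := by exact_mod_cast NeZero.one_le
  have hA1 : ∀ i, (1 : ℝ) ≤ A i := fun i => by exact_mod_cast NeZero.one_le
  have hsum : (∑ j, (A j : ℝ)) = A 0 + A 1 := Fin.sum_univ_two _
  have hHpos : (0 : ℝ) < G.H := hε.trans_le hεH
  have hKpos : (0 : ℝ) < K := by exact_mod_cast hK
  have hApos : (0 : ℝ) < A 0 + A 1 := by linarith [hA1 0, hA1 1]
  have hιeq : Real.log (K * S * (A 0 + A 1) / δ) = logFactor S A δ K := by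
    rw [logFactor, hsum]
  have hyp' : C * (G.H : ℝ) ^ 2 * G.effHorizon * logFactor S A δ K ^ 3 ≤ K * ε ^ 2 := by
    rw [hιeq] at hyp
    have hpos : 0 < (G.H : ℝ) * S * (A 0 + A 1) := by positivity
    refine le_of_mul_le_mul_right ?_ hpos
    have h1 := mul_le_mul_of_nonneg_right hyp (sq_nonneg ε)
    have h2 : C * (G.H : ℝ) ^ 3 * S * (A 0 + A 1) / ε ^ 2 * G.effHorizon
        * logFactor S A δ K ^ 3 * ε ^ 2
        = C * (G.H : ℝ) ^ 2 * G.effHorizon * logFactor S A δ K ^ 3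
          * (G.H * S * (A 0 + A 1)) := by field_simp
    rw [h2] at h1
    linarith
  obtain ⟨hr, hsmall⟩ := Game.regime_of_le hα hcb (by linarith) (by linarith) (by linarith)
    hR0 hR1 hε hεH hδ hδ1 hK hyp'
  have hL1 := hr.one_le_L
  have hLpos := hr.L_pos
  have hιpos := hr.logFactor_pos
  have hc : 0 ≤ G.potCoeff cα cb δ K := by
    have := hr.pot_nonneg
    rw [Game.potCoeff]; linarith
  have hbad := hr.pexp_badCount_le hG hR0 hR1 le_rfl
  set c := G.potCoeff cα cb δ K
  set f := G.stepError cα cb δ K with hf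
  -- Fewer than `x₀` exceptional steps cost at most `4 * x₀ * 5 L = ε / 2`; the regular errors take
  -- the other half.
  set x₀ : ℝ := ε / (40 * G.effHorizon) with hx₀
  have hx₀pos : 0 < x₀ := by positivity
  rw [ENNReal.ofReal_sub _ hδ.le, ENNReal.ofReal_one, Game.output, PMF.toOuterMeasure_map_apply]
  refine one_sub_le_toOuterMeasure _ _
    (fun o => ENNReal.ofReal x₀⁻¹ * G.badCount c f G.H o) _ ?_ ?_
  · rw [pexp_mul_left]
    refine (mul_le_mul_right hbad _).trans ?_
    have hcount : (∑ i, ∑ _s : Fin S, ((A i : ENNReal) + 2))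
        = ENNReal.ofReal (S * (A 0 + 2) + S * (A 1 + 2)) := by
      rw [Fin.sum_univ_two]
      simp only [Finset.sum_const, Finset.card_univ, Fintype.card_fin, nsmul_eq_mul]
      rw [ENNReal.ofReal_add (by positivity) (by positivity),
        ENNReal.ofReal_mul (by positivity), ENNReal.ofReal_mul (by positivity),
        ENNReal.ofReal_add (by positivity) (by positivity),
        ENNReal.ofReal_add (by positivity) (by positivity)]
      simp
    rw [hcount, ← ENNReal.ofReal_natCast, ← ENNReal.ofReal_mul (by positivity),
      ← ENNReal.ofReal_mul (by positivity), ← ENNReal.ofReal_mul (by positivity)]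
    refine ENNReal.ofReal_le_ofReal ?_
    have hexp : Real.exp (logFactor S A δ K) = K * S * (A 0 + A 1) / δ := by
      rw [logFactor, hsum, Real.exp_log (by positivity)]
    have h1 : Real.exp (-(8 * logFactor S A δ K)) ≤ δ / (K * S * (A 0 + A 1)) := by
      calc Real.exp (-(8 * logFactor S A δ K)) ≤ Real.exp (-logFactor S A δ K) :=
            Real.exp_le_exp.2 (by linarith)
        _ = δ / (K * S * (A 0 + A 1)) := by rw [Real.exp_neg, hexp, inv_div]
    have h2 : S * (A 0 + 2) + S * (A 1 + 2) ≤ 3 * (S * ((A 0 : ℝ) + A 1)) := by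
      nlinarith [hA1 0, hA1 1]
    -- Although `H` alone need not be bounded by `K`, the quantity `H L / ε` is: multiply the sample
    -- size condition by its consequence `C L ≤ 8 K` and take the square root. The factor `K`
    -- cancels against the `1 / K` in the failure probability of a step.
    have h3 : x₀⁻¹ * G.H ≤ 320 * K / C := by
      have hι3 : (1 / 2) ^ 3 ≤ logFactor S A δ K ^ 3 :=
        pow_le_pow_left₀ (by norm_num) hr.half_le 3
      have hCpos : 0 < C := by linarith
      have hLK : C * G.effHorizon ≤ 8 * K := by
        have h4 : C * ε ^ 2 * G.effHorizon * (1 / 2) ^ 3 ≤ K * ε ^ 2 := by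
          refine le_trans ?_ hyp'
          gcongr
        have h5 : C * G.effHorizon * (1 / 2) ^ 3 * ε ^ 2 ≤ K * ε ^ 2 := by linarith
        have h6 := le_of_mul_le_mul_right h5 (by positivity)
        linarith
      have hsq : (C * (G.H * G.effHorizon)) ^ 2 ≤ (8 * (K * ε)) ^ 2 := by
        have h4 : C * (G.H : ℝ) ^ 2 * G.effHorizon * (1 / 2) ^ 3 ≤ K * ε ^ 2 := by
          refine le_trans ?_ hyp'
          gcongr
        have h5 := mul_le_mul h4 hLK (by positivity) (by positivity)
        linarith
      have h7 := le_of_sq_le_sq hsq (by positivity)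
      have e : x₀⁻¹ * G.H = 40 * (G.H * G.effHorizon) / ε := by
        rw [hx₀]; field_simp
      rw [e, div_le_div_iff₀ hε hCpos]
      linarith
    calc x₀⁻¹ * (G.H * ((S * (A 0 + 2) + S * (A 1 + 2)) * Real.exp (-(8 * logFactor S A δ K))))
        = x₀⁻¹ * G.H * ((S * (A 0 + 2) + S * (A 1 + 2))
          * Real.exp (-(8 * logFactor S A δ K))) := by ring
      _ ≤ 320 * K / C * (3 * (S * ((A 0 : ℝ) + A 1)) * (δ / (K * S * (A 0 + A 1)))) := by
          gcongr
      _ = 960 / C * δ := by field_simp; norm_num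
      _ ≤ 1 * δ := by
          gcongr
          rw [div_le_one (by linarith)]
          exact hC960
      _ = δ := one_mul _
  · intro o ho
    by_contra hlt
    rw [not_le] at hlt
    have hlt' : G.badCount c f G.H o < ENNReal.ofReal x₀ := by
      rw [ENNReal.ofReal_inv_of_pos hx₀pos, mul_comm, ← div_eq_mul_inv,
        ENNReal.div_lt_iff (Or.inl (by simpa using hx₀pos)) (Or.inl ENNReal.ofReal_ne_top),
        one_mul] at hlt
      exact hlt
    rw [Game.badCount] at hlt'
    obtain ⟨N, hN⟩ := iInf_lt_iff.1 hlt'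
    obtain ⟨hI, hN⟩ := iInf_lt_iff.1 hN
    have hNx : (N : ℝ) < x₀ := by
      rw [← ENNReal.ofReal_natCast] at hN
      exact (ENNReal.ofReal_lt_ofReal_iff hx₀pos).1 hN
    refine ho (hI.isRobustNE hG hR0 hR1 hc ?_)
    have h1 : (N : ℝ) * (40 * G.effHorizon) ≤ ε := by
      have := (lt_div_iff₀ (by positivity)).1 hNx
      linarith
    have h2 : 4 * (G.H * f) = 108 * potConst cα cb * (G.errScale δ K * G.effHorizon) * G.H := by
      rw [hf, Game.stepError]; ring
    linarith
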